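/- **Conventions.** Let $I=[0,1]$ and let $\mathrm{Homeo}_+(I)$ be the group of its orientation-preserving homeomorphisms. An *orbital* of $f$ is a component $(u,v)$ of its support; $u,v$ are *transition points*; the restriction of $f$ to an orbital is a *bump*, which is positive or negative according to whether $f$ moves the points of $(u,v)$ to the right or to the left. A *marked function* is an $f\in \mathrm{Homeo}_+(I)$ with a chosen point (marker) $s$ in each orbital $(u,v)$; the *feet* of that bump are $(u,s)$ and $[t,v)$, where $t=f(s)$ for a positive and $t=f^{-1}(s)$ for a negative bump. The *extended support* of $f$ is the interior of the closure of its support. A *standard function* is a marked function with finitely many bumps, whose extended support is a nonempty interval, all of whose positive bumps lie to the right of all its negative bumps, and whose numbers $P,N$ of positive and negative bumps satisfy $N\le P\le N+1$. Write $f\ll g$ if the extended supports are disjoint with that of $f$ on the left, $f\sqsubset g$ if the closure of the extended support of $f$ lies in the extended support of $g$, and $f<g$ if $f\ll g$ or $f\sqsubset g$. If $f$ is standard with more than two orbitals, $f^\circ$ is the restriction of $f$ (with its markers) to all orbitals but the leftmost and the rightmost; if it has one or two, $f^\circ$ is any marked positive bump supported on the left foot (without its endpoints) of the positive orbital. A pair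 $(f,g)$ is *standard* if the feet of $f$ are disjoint from the feet of $g$ and either $f\ll g$, or $f\sqsubset g$ and $(g^\circ,f)$ is standard (a recursive definition). A *standard generating set* is a finite set $A$ of standard functions any two elements of which, in increasing order, form a standard pair. It is totally ordered by $<$. The *oscillation* $o(f,g)$ is the number of orbitals of $g$ containing a transition point of $f$, and the *signature* of $A=\{a_0<\dots<a_{n-1}\}$ is the function $(i,j)\mapsto o(a_i,a_j)$ for $i<j<n$ (with the base $\{0,\dots,n-1\}$ as part of the data). Let $\langle A\rangle$ be the subgroup generated by $A$; for a signature $\mathsf A$, $\langle\mathsf A\rangle$ stands for $\langle A\rangle$, where $A$ is any standard generating set with signature $\mathsf A$. For functions $\mathsf B,\mathsf C$ on pairs $i<j$ from $\{0,\dots,m-1\}$ and $\{0,\dots,n-1\}$, let $\mathsf B+\mathsf C$ (resp. $\mathsf B*\mathsf C$) be the function whose base is that of $\mathsf B$ followed by that of $\mathsf C$, which extends $\mathsf B$ and $\mathsf C$, and which has value $0$ (resp. $1$) on all pairs with one element in each. Let $\exp(\mathsf A)=\mathsf A+1$ pointwise and $E(\mathsf A)=\exp(\exp(\mathsf A))$;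 let $\mathbb 0$ and $\mathbb 1$ be the functions with empty and with one-point base. The class $\mathcal R$ of *reduced signatures*, with $\rho:\mathcal R\to\mathrm{Ord}$, is the smallest class containing $\mathbb 0$ ($\rho=0$) and $\mathbb 1$ ($\rho=1$) and, for each finite sequence $\mathsf X_i\in\mathcal R$ $(i<n)$ with $\rho(\mathsf X_0)\ge\rho(\mathsf X_1)\ge\cdots$, the function $\sum_{i<n}\exp(\mathsf X_i)$, with $\rho$-value $\sum_{i<n}\omega^{-1+\rho(\mathsf X_i)}$ (where $\omega^{-1+0}:=0$, and $-1+\zeta$ is the $\beta$ with $1+\beta=\zeta$ for $\zeta\geq 1$). For groups $G,H$ and an action of $H$ on a set $Y$, the *permutation wreath product* $G\wr H$ is $\big(\bigoplus_Y G\big)\rtimes H$, where $\bigoplus_Y G$ is the group of finitely supported functions $Y\to G$ and $H$ permutes the coordinates. **Proposition.** Every $\mathsf A\in\mathcal R$ is the signature of a standard generating set, and exactly one of the following holds: 1. $\mathsf A=E(\mathsf B)$ for some $\mathsf B\in\mathcal R$; 2. $\mathsf A=\mathsf B+\mathsf C$ for some $\mathsf B,\mathsf C\in\mathcal R\setminus\{\mathbb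 0\}$; 3. $\mathsf A=\mathsf B*\mathsf C$ for some $\mathsf B,\mathsf C\in\mathcal R\setminus\{\mathbb 0\}$. In case 2, for all such $\mathsf B,\mathsf C$, $\langle\mathsf A\rangle\cong\langle\mathsf B\rangle\times\langle\mathsf C\rangle$: if $A,B,C$ are standard generating sets with signatures $\mathsf A,\mathsf B,\mathsf C$, there is an isomorphism $\langle A\rangle\to\langle B\rangle\times\langle C\rangle$ that sends the first $|B|$ elements of $A$, in order, to the elements $(b,1)$, $b\in B$, and the others, in order, to the elements $(1,c)$, $c\in C$. In case 3, for all such $\mathsf B,\mathsf C$, $\langle\mathsf A\rangle\cong\langle\mathsf B\rangle\wr\langle\mathsf C\rangle$: let $A,B,C$ be standard generating sets with signatures $\mathsf A,\mathsf B,\mathsf C$, let $J$ be a nonempty open interval that is contained in the rightmost orbital of each $c\in C$ and disjoint from the feet of all $c\in C$ (some $C$ with signature $\mathsf C$ admits such a $J$), and let $\langle C\rangle$ act on the set $Y$ of the translates of $J$ under $\langle C\rangle$. Then there is an isomorphism $\langle A\rangle\to\langle B\rangle\wr\langle C\rangle=\big(\bigoplus_{Y}\langle B\rangle\big)\rtimes\langle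 C\rangle$ that sends the first $|B|$ elements of $A$, in order, to the elements $b\in B$ placed in the coordinate $J$, and the others, in order, to the elements of $C$. Moreover, each $\mathsf A\neq\mathbb 0$ in $\mathcal R$ is the value of a term in the binary operations $+$ and $*$, the unary operation $E$ and the constant $\mathbb 1$ in which $E(\mathbb 1)$ does not occur as a subterm, and this term is unique up to the bracketing of iterated sums and of iterated products (associativity of $+$ and of $*$). -/

import Mathlib

open scoped unitInterval Pointwise

noncomputable section

namespace OscSig

/-! ### Functions on pairs from a finite linear order, and their arithmetic -/

/-- A natural-number valued function `(i, j) ↦ val i j` on the pairs `i < j` from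
`{0, …, card - 1}`.  It is extended by `0` to all other pairs, so that equality of `PairFun`s is
equality of the bases and of the functions.  These are the canonical representatives (up to
order isomorphism of the base) of functions on pairs from a finite linear order. -/
@[ext]
structure PairFun where
  card : ℕ
  val : ℕ → ℕ → ℕ
  val_eq_zero : ∀ i j, ¬ (i < j ∧ j < card) → val i j = 0

namespace PairFun

/-- The function with empty base. -/
instance : Zero PairFun := ⟨⟨0, fun _ _ => 0, fun _ _ _ => rfl⟩⟩

/-- The function with one-point base. -/
instance : One PairFun := ⟨⟨1, fun _ _ => 0, fun _ _ _ => rfl⟩⟩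

/-- The base of `B` followed by the base of `C`; the value is `k` at each pair consisting of an
element of `B` and an element of `C`. -/
def glue (k : ℕ) (B C : PairFun) : PairFun where
  card := B.card + C.card
  val i j :=
    if j < B.card then B.val i j
    else if i < B.card then (if j < B.card + C.card then k else 0)
    else C.val (i - B.card) (j - B.card)
  val_eq_zero i j h := by
    split_ifs with h1 h2 h3
    · exact B.val_eq_zero i j (by omega)
    · omega
    · rfl
    · exact C.val_eq_zero _ _ (by omega)

instance : Add PairFun := ⟨glue 0⟩

instance : Mul PairFun := ⟨glue 1⟩

/-- Add `1` to all values. -/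
def exp (A : PairFun) : PairFun where
  card := A.card
  val i j := if i < j ∧ j < A.card then A.val i j + 1 else 0
  val_eq_zero _ _ h := if_neg h

/-- The operation `E`, adding `2` to all values. -/
def E (A : PairFun) : PairFun := A.exp.exp

end PairFun

/-- The ordinal function `ζ ↦ ω ^ (-1 + ζ)`, with value `0` at `0`.  (For `ζ ≥ 1`, the ordinal
`ζ - 1` is the unique `β` with `1 + β = ζ`.) -/
def omegaPow (ζ : Ordinal.{0}) : Ordinal.{0} :=
  if ζ = 0 then 0 else Ordinal.omega0 ^ (ζ - 1)

/-- `ReducedAt A ξ`: the function `A` is the value of the normal form of `ξ`, computed with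
`0, 1, +, exp` in place of `0, 1, +, ζ ↦ ω ^ (-1 + ζ)`. -/
inductive ReducedAt : PairFun → Ordinal.{0} → Prop
  | zero : ReducedAt 0 0
  | one : ReducedAt 1 1
  | sum (l : List (PairFun × Ordinal.{0})) (hl : ∀ p ∈ l, ReducedAt p.1 p.2)
      (hdec : l.Pairwise fun p q => q.2 ≤ p.2) :
      ReducedAt (l.map fun p => p.1.exp).sum (l.map fun p => omegaPow p.2).sum

/-- The reduced signatures. -/
def Reduced (A : PairFun) : Prop := ∃ ξ, ReducedAt A ξ

/-- `A = E(B)` for some reduced `B`. -/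
def IsEForm (A : PairFun) : Prop := ∃ B, Reduced B ∧ A = B.E

/-- `A = B + C` for some nonzero reduced `B` and `C`. -/
def IsSumForm (A : PairFun) : Prop :=
  ∃ B C, Reduced B ∧ Reduced C ∧ B ≠ 0 ∧ C ≠ 0 ∧ A = B + C

/-- `A = B * C` for some nonzero reduced `B` and `C`. -/
def IsProdForm (A : PairFun) : Prop :=
  ∃ B C, Reduced B ∧ Reduced C ∧ B ≠ 0 ∧ C ≠ 0 ∧ A = B * C

/-! ### Terms -/

/-- Formal terms in `+`, `*`, `E` and the constant `1`. -/
inductive Term : Type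
  | one : Term
  | add : Term → Term → Term
  | mul : Term → Term → Term
  | E : Term → Term

namespace Term

/-- The value of a term. -/
def eval : Term → PairFun
  | one => 1
  | add s t => s.eval + t.eval
  | mul s t => s.eval * t.eval
  | E t => t.eval.E

/-- `E(1)` does not occur as a subterm. -/
def NoEOne : Term → Prop
  | one => True
  | add s t => s.NoEOne ∧ t.NoEOne
  | mul s t => s.NoEOne ∧ t.NoEOne
  | E t => t ≠ one ∧ t.NoEOne

/-- Two terms differ only by the bracketing of iterated sums and iterated products: the
congruence generated by the associative laws for `+` and for `*`. -/
inductive AssocEq : Term → Term → Prop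
  | refl (s) : AssocEq s s
  | symm {s t} : AssocEq s t → AssocEq t s
  | trans {s t u} : AssocEq s t → AssocEq t u → AssocEq s u
  | add {s s' t t'} : AssocEq s s' → AssocEq t t' → AssocEq (add s t) (add s' t')
  | mul {s s' t t'} : AssocEq s s' → AssocEq t t' → AssocEq (mul s t) (mul s' t')
  | E {s s'} : AssocEq s s' → AssocEq (E s) (E s')
  | add_assoc (s t u) : AssocEq (add (add s t) u) (add s (add t u))
  | mul_assoc (s t u) : AssocEq (mul (mul s t) u) (mul s (mul t u))

end Term

/-! ### Homeomorphisms of the unit interval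

The group of orientation preserving homeomorphisms of `I = [0,1]` is the group `I ≃o I` of order
automorphisms.  It acts on the left here. -/

/-- `(u, v)` is an orbital of `f`: a component of the support of `f`. -/
def IsOrbital (f : I ≃o I) (u v : I) : Prop :=
  u < v ∧ f u = u ∧ f v = v ∧ ∀ t, u < t → t < v → f t ≠ t

def IsPosOrbital (f : I ≃o I) (u v : I) : Prop :=
  IsOrbital f u v ∧ ∀ t, u < t → t < v → t < f t

def IsNegOrbital (f : I ≃o I) (u v : I) : Prop :=
  IsOrbital f u v ∧ ∀ t, u < t → t < v → f t < t

def orbitals (f : I ≃o I) : Set (I × I) := {p | IsOrbital f p.1 p.2}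

/-- The leftmost orbital. -/
def IsMinOrbital (f : I ≃o I) (u v : I) : Prop :=
  IsOrbital f u v ∧ ∀ u' v', IsOrbital f u' v' → u ≤ u'

/-- The rightmost orbital. -/
def IsMaxOrbital (f : I ≃o I) (u v : I) : Prop :=
  IsOrbital f u v ∧ ∀ u' v', IsOrbital f u' v' → u' ≤ u

def IsTransitionPoint (f : I ≃o I) (x : I) : Prop :=
  ∃ u v, IsOrbital f u v ∧ (x = u ∨ x = v)

/-- The interior of the closure of the support, as a subset of the line. -/
def extSupport (f : I ≃o I) : Set ℝ :=
  interior (closure ((fun t : I => (t : ℝ)) '' {t | f t ≠ t}))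

/-- A homeomorphism with a marking: a choice of one point in each orbital. -/
structure MarkedFun where
  map : I ≃o I
  marks : Set I
  marks_subset : ∀ s ∈ marks, map s ≠ s
  existsUnique_mark : ∀ u v, IsOrbital map u v → ∃! s, s ∈ marks ∧ u < s ∧ s < v

/-- The union of the feet of all bumps of `f`: if `s` is the marker of the bump with orbital
`(u, v)`, then the feet of this bump are `(u, s)` and `[t, v)`, where `t = f s` if the bump is
positive and `t = f⁻¹ s` if it is negative. -/
def MarkedFun.feet (f : MarkedFun) : Set I :=
  {x | ∃ u v s, s ∈ f.marks ∧ u < s ∧ s < v ∧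
    ((IsOrbital f.map u v ∧ x ∈ Set.Ioo u s) ∨
     (IsPosOrbital f.map u v ∧ x ∈ Set.Ico (f.map s) v) ∨
     (IsNegOrbital f.map u v ∧ x ∈ Set.Ico (f.map.symm s) v))}

/-- The pair `{f, g}` is fast. -/
def Fast (f g : MarkedFun) : Prop := Disjoint f.feet g.feet

/-- Standard functions. -/
structure IsStandard (f : MarkedFun) : Prop where
  finite : (orbitals f.map).Finite
  nonempty : (extSupport f.map).Nonempty
  interval : (extSupport f.map).OrdConnected
  neg_pos : ∀ u v u' v', IsNegOrbital f.map u v → IsPosOrbital f.map u' v' → v ≤ u'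
  neg_le_pos : {p : I × I | IsNegOrbital f.map p.1 p.2}.ncard ≤
    {p : I × I | IsPosOrbital f.map p.1 p.2}.ncard
  pos_le_neg_add_one : {p : I × I | IsPosOrbital f.map p.1 p.2}.ncard ≤
    {p : I × I | IsNegOrbital f.map p.1 p.2}.ncard + 1

/-- `f ≪ g` -/
def LeftOf (f g : MarkedFun) : Prop :=
  Disjoint (extSupport f.map) (extSupport g.map) ∧
    ∀ x ∈ extSupport f.map, ∀ y ∈ extSupport g.map, x < y

/-- `f ⊏ g` -/
def Inside (f g : MarkedFun) : Prop :=
  closure (extSupport f.map) ⊆ extSupport g.map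

/-- The union of all orbitals of `f` except the leftmost and the rightmost one. -/
def innerOrbitals (f : I ≃o I) : Set I :=
  {t | ∃ u v, IsOrbital f u v ∧ ¬ IsMinOrbital f u v ∧ ¬ IsMaxOrbital f u v ∧ u < t ∧ t < v}

/-- `f'` is (a choice of) `f°`.  If `f` has more than two orbitals, then `f°` is the restriction of
`f` to its inner orbitals, with the inherited markers.  If `f` has one or two orbitals, then `f°`
is a positive bump supported on the left foot of the positive orbital of `f`, with any marker. -/
def IsReduct (f f' : MarkedFun) : Prop :=
  (2 < (orbitals f.map).ncard ∧
    (∀ t ∈ innerOrbitals f.map, f'.map t = f.map t) ∧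
    (∀ t, t ∉ innerOrbitals f.map → f'.map t = t) ∧
    f'.marks = f.marks ∩ innerOrbitals f.map) ∨
  ((orbitals f.map).ncard ≤ 2 ∧
    ∃ r v s, IsPosOrbital f.map r v ∧ s ∈ f.marks ∧ r < s ∧ s < v ∧
      (∀ t, f'.map t ≠ t ↔ r < t ∧ t < s) ∧ IsPosOrbital f'.map r s)

/-- Standard pairs. -/
inductive StandardPair : MarkedFun → MarkedFun → Prop
  | left {f g : MarkedFun} : Fast f g → LeftOf f g → StandardPair f g
  | inside {f g g' : MarkedFun} : Fast f g → Inside f g → IsReduct g g' →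
      StandardPair g' f → StandardPair f g

/-- The oscillation `o(f, g)`: the number of orbitals of `g` which contain a transition point
of `f`. -/
def osc (f g : MarkedFun) : ℕ :=
  {p : I × I | IsOrbital g.map p.1 p.2 ∧
    ∃ x, IsTransitionPoint f.map x ∧ p.1 < x ∧ x < p.2}.ncard

/-- A standard generating set, listed in increasing order. -/
structure IsStandardGenSet {n : ℕ} (a : Fin n → MarkedFun) : Prop where
  standard : ∀ i, IsStandard (a i)
  pair : ∀ i j, i < j → StandardPair (a i) (a j)

/-- `a` is (the increasing enumeration of) a standard generating set with signature `A`. -/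
structure HasSignature (A : PairFun) (a : Fin A.card → MarkedFun) : Prop where
  genSet : IsStandardGenSet a
  osc_eq : ∀ i j, i < j → osc (a i) (a j) = A.val i j

/-- The group generated by the functions in `a`. -/
def grp {n : ℕ} (a : Fin n → MarkedFun) : Subgroup (I ≃o I) :=
  Subgroup.closure (Set.range fun i => (a i).map)

/-- The generators, as elements of the generated group. -/
def gen {n : ℕ} (a : Fin n → MarkedFun) (i : Fin n) : grp a :=
  ⟨(a i).map, Subgroup.subset_closure ⟨i, rfl⟩⟩

/-! ### Permutation wreath products -/

section Wreath

variable (G H Y : Type*) [Group G] [Group H] [MulAction H Y]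

/-- The direct sum of copies of `G` indexed by `Y`: finitely supported functions `Y → G` under
pointwise multiplication. -/
def directSum : Subgroup (Y → G) where
  carrier := {φ | (Function.mulSupport φ).Finite}
  one_mem' := by simp
  mul_mem' ha hb := (ha.union hb).subset (Function.mulSupport_mul _ _)
  inv_mem' ha := by
    simpa only [Set.mem_ofPred_eq, Function.mulSupport_inv] using ha

/-- The action of `H` on the direct sum: `(h • φ) y = φ (h⁻¹ • y)`. -/
def directSumAction : H →* MulAut (directSum G Y) where
  toFun h :=
    { toFun := fun φ => ⟨fun y => φ.1 (h⁻¹ • y), by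
        refine (φ.2.image fun y => h • y).subset fun y hy => ⟨h⁻¹ • y, hy, ?_⟩
        simp⟩
      invFun := fun φ => ⟨fun y => φ.1 (h • y), by
        refine (φ.2.image fun y => h⁻¹ • y).subset fun y hy => ⟨h • y, hy, ?_⟩
        simp⟩
      left_inv := fun φ => by ext y; simp
      right_inv := fun φ => by ext y; simp
      map_mul' := fun φ ψ => rfl }
  map_one' := by ext φ y; simp
  map_mul' h k := by
    ext φ y
    simp [mul_smul]

/-- The permutation wreath product `G ≀ H` with respect to the action of `H` on `Y`. -/
abbrev PermWreath := directSum G Y ⋊[directSumAction G H Y] H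

variable {G Y}

open Classical in
/-- The element of the direct sum with value `g` at `y`, and `1` elsewhere. -/
def single (y : Y) (g : G) : directSum G Y :=
  ⟨Pi.mulSingle y g, (Set.finite_singleton y).subset (Pi.mulSupport_mulSingle_subset)⟩

end Wreath

/-- `(p, q)` is a nonempty open interval which is contained in the rightmost orbital of every
function in `c` and disjoint from the feet of every function in `c`. -/
def IsGap {n : ℕ} (c : Fin n → MarkedFun) (p q : I) : Prop :=
  p < q ∧ ∀ j, (∃ u v, IsMaxOrbital (c j).map u v ∧ u ≤ p ∧ q ≤ v) ∧
    Disjoint (Set.Ioo p q) (c j).feet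

/-- The set `{h(J) | h ∈ ⟨c⟩}` of translates of `J = (p, q)`, on which `⟨c⟩` acts. -/
abbrev translates {n : ℕ} (c : Fin n → MarkedFun) (p q : I) : Set (Set I) :=
  MulAction.orbit (grp c) (Set.Ioo p q)

/-- The interval `J = (p, q)` itself, as an element of the set of its translates. -/
def base {n : ℕ} (c : Fin n → MarkedFun) (p q : I) : translates c p q :=
  ⟨Set.Ioo p q, MulAction.mem_orbit_self _⟩

end OscSig

end

noncomputable section

namespace OscSig

/-! ### Arithmetic of functions on pairs -/

namespace PairFun

/-! The combinatorial claims rest on one number, the value at the pair of the first and the last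
element (`endVal`). It is 0 for a proper sum, 1 for a proper product, and at least 2 for E(B) on two
or more points, so the three cases exclude each other. Because exp(B + C) = exp B * exp C, unfolding
the normal form twice produces one of the three forms (`Reduced.form`). For terms, the end value
determines the outermost operation, and the first indecomposable summand or factor is determined by
where it can be cut off (`Term.assocEq_of_eval_eq`).

The group claims rest on the fact that a standard generating set is determined, as a marked group,
by its signature (`HasSignature.exists_mulEquiv`). Count the orbitals of each function from the
outside inwards and call the number of the orbital containing a point its level. The oscillation of
a standard pair equals the number of inclusions in its recursive definition
(`StandardPairDepth.osc_eq`), and this number fixes the level, with respect to each function of the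
pair, of every foot of the other (`Interlaced`). Since feet are disjoint, the generators play
ping-pong: each sends the points of its support that are outside its inner feet into its outer feet,
and its inverse does the opposite. A point of a foot therefore has a well-defined last letter, and
points can be coded by histories, which are words. Letters act on histories by being pushed,
cancelled or ignored, and which of these happens depends only on levels, hence only on the
signature. A word acts nontrivially exactly if it moves some symbolic history at least as long as
itself (`PingPong.exists_symMoves`, `PingPong.Rich.ev_ne_one`). The number of orbitals is not part
of the signature, but beyond a certain depth the levels with respect to the other functions no
longer change, so deep feet can be traded for shallower ones (`SymMoves.translate`).

It then suffices to look at the subgroups generated inside A by its two parts. In a sum their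
supports are disjoint. In a product the supports of the first part lie in a common gap of the
second; every element of the second group fixes that gap pointwise or moves it off itself, and which
one happens is again decided by the signature. Such an action generates a permutation wreath product
(`exists_mulEquiv_permWreath`).

For existence, transition points are placed at integers. A sum juxtaposes two patterns, a product
inserts one into a gap of the other, and E wraps one new point on each side around every function.
As `exp` alone has no such description, A and exp A are treated together in one induction
(`IsArith.exists_describes`); the same device yields the terms (`IsArith.exists_term`). -/

@[simp] theorem card_zero : (0 : PairFun).card = 0 := rfl
@[simp] theorem card_one : (1 : PairFun).card = 1 := rfl
@[simp] theorem card_glue (k : ℕ) (B C : PairFun) : (glue k B C).card = B.card + C.card := rfl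
@[simp] theorem card_add (B C : PairFun) : (B + C).card = B.card + C.card := rfl
@[simp] theorem card_mul (B C : PairFun) : (B * C).card = B.card + C.card := rfl
@[simp] theorem card_exp (A : PairFun) : A.exp.card = A.card := rfl
@[simp] theorem card_E (A : PairFun) : A.E.card = A.card := rfl

theorem add_eq_glue (B C : PairFun) : B + C = glue 0 B C := rfl
theorem mul_eq_glue (B C : PairFun) : B * C = glue 1 B C := rfl

theorem val_glue (k : ℕ) (B C : PairFun) (i j : ℕ) : (glue k B C).val i j =
    if j < B.card then B.val i j
    else if i < B.card then (if j < B.card + C.card then k else 0)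
    else C.val (i - B.card) (j - B.card) := rfl

theorem val_exp (A : PairFun) (i j : ℕ) :
    A.exp.val i j = if i < j ∧ j < A.card then A.val i j + 1 else 0 := rfl

theorem ext_of_lt {A B : PairFun} (hc : A.card = B.card)
    (h : ∀ i j, i < j → j < A.card → A.val i j = B.val i j) : A = B := by
  refine PairFun.ext hc ?_
  funext i j
  by_cases hij : i < j ∧ j < A.card
  · exact h i j hij.1 hij.2
  · rw [A.val_eq_zero i j hij, B.val_eq_zero i j (by rwa [← hc])]

theorem eq_zero_iff_card {A : PairFun} : A = 0 ↔ A.card = 0 := by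
  constructor
  · rintro rfl; rfl
  · intro h
    exact ext_of_lt h (by intro i j _ hj; omega)

theorem card_pos {A : PairFun} (h : A ≠ 0) : 0 < A.card :=
  Nat.pos_of_ne_zero fun h' => h (eq_zero_iff_card.2 h')

theorem eq_one_of_card {A : PairFun} (h : A.card = 1) : A = 1 :=
  ext_of_lt h (by intro i j _ hj; omega)

theorem zero_glue (k : ℕ) (A : PairFun) : glue k 0 A = A :=
  ext_of_lt (by simp) (by intro i j _ _; simp [val_glue])

theorem glue_zero (k : ℕ) (A : PairFun) : glue k A 0 = A :=
  ext_of_lt (by simp) (by intro i j _ hj; simp at hj; simp [val_glue, hj])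

theorem glue_assoc (k : ℕ) (A B C : PairFun) :
    glue k (glue k A B) C = glue k A (glue k B C) := by
  refine ext_of_lt (by simp [add_assoc]) ?_
  intro i j hij hj
  simp only [card_glue] at hj
  simp only [val_glue, card_glue]
  grind

theorem exp_glue (k : ℕ) (B C : PairFun) : (glue k B C).exp = glue (k + 1) B.exp C.exp := by
  refine ext_of_lt rfl ?_
  intro i j hij hj
  simp only [card_exp, card_glue] at hj
  simp only [val_exp, val_glue, card_exp, card_glue]
  grind

/-- Products enter the arithmetic of reduced signatures only through this identity. -/
theorem exp_add (B C : PairFun) : (B + C).exp = B.exp * C.exp := exp_glue 0 B C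

@[simp] theorem exp_zero : (0 : PairFun).exp = 0 := eq_zero_iff_card.2 rfl
@[simp] theorem exp_one : (1 : PairFun).exp = 1 := eq_one_of_card rfl

theorem exp_injective : Function.Injective exp := by
  intro A B h
  have hc : A.card = B.card := congrArg card (a₁ := A.exp) (a₂ := B.exp) h
  refine ext_of_lt hc fun i j hij hj => ?_
  have h2 : A.exp.val i j = B.exp.val i j := by rw [h]
  simp only [val_exp, hij, hj, hc ▸ hj, true_and, if_true] at h2
  omega

/-- The value at the pair consisting of the first and the last element. -/
def endVal (A : PairFun) : ℕ := A.val 0 (A.card - 1)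

/-- The first element lies in `B` and the last in `C`, so the end value records the operation. -/
theorem endVal_glue (k : ℕ) {B C : PairFun} (hB : B ≠ 0) (hC : C ≠ 0) :
    (glue k B C).endVal = k := by
  have := card_pos hB
  have := card_pos hC
  simp only [endVal, val_glue, card_glue]
  split_ifs <;> first | rfl | omega

theorem endVal_exp {A : PairFun} (h : 2 ≤ A.card) : A.exp.endVal = A.endVal + 1 := by
  simp only [endVal, val_exp, card_exp]
  rw [if_pos (by omega)]

theorem two_le_card_glue (k : ℕ) {B C : PairFun} (hB : B ≠ 0) (hC : C ≠ 0) :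
    2 ≤ (glue k B C).card := by
  have := card_pos hB
  have := card_pos hC
  simp; omega

theorem glue_injective {k : ℕ} {B C B' C' : PairFun} (hc : B.card = B'.card)
    (h : glue k B C = glue k B' C') : B = B' ∧ C = C' := by
  have hcard : C.card = C'.card := by
    have := congrArg card h
    simp at this; omega
  have hv : ∀ i j, (glue k B C).val i j = (glue k B' C').val i j := by rw [h]; intros; rfl
  constructor
  · refine ext_of_lt hc fun i j _ hj => ?_
    have := hv i j
    simpa only [val_glue, hj, hc ▸ hj, if_true] using this
  · refine ext_of_lt hcard fun i j _ hj => ?_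
    have := hv (i + B.card) (j + B.card)
    simpa [val_glue, ← hc] using this

/-- The cut after `B` separates the first from the last element of the longer part `B'`, so `B'` has
the end value of a glued function. -/
theorem endVal_le_of_glue_eq {k : ℕ} {B C B' C' : PairFun} (hB : B ≠ 0)
    (h : glue k B C = glue k B' C') (hlt : B.card < B'.card) : B'.endVal = k := by
  have hB' := card_pos hB
  have hcard := congrArg card h
  simp at hcard
  have hv : (glue k B C).val 0 (B'.card - 1) = (glue k B' C').val 0 (B'.card - 1) := by rw [h]
  simp only [val_glue] at hv
  rw [if_neg (by omega), if_pos hB', if_pos (by omega), if_pos (by omega)] at hv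
  exact hv.symm

end PairFun

open PairFun

/-! ### Reduced signatures -/

/-- The closure of `0` and `1` under addition and `exp`. -/
inductive IsArith : PairFun → Prop
  | zero : IsArith 0
  | one : IsArith 1
  | add {B C} : IsArith B → IsArith C → IsArith (B + C)
  | exp {A} : IsArith A → IsArith A.exp

theorem IsArith.of_reduced {A : PairFun} (h : Reduced A) : IsArith A := by
  obtain ⟨ξ, h⟩ := h
  induction h with
  | zero => exact .zero
  | one => exact .one
  | sum l hl hdec ih =>
    clear hdec
    induction l with
    | nil => exact .zero
    | cons p l ihl =>
      simp only [List.map_cons, List.sum_cons]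
      exact .add (.exp (ih p (by simp)))
        (ihl (fun q hq => hl q (by simp [hq])) (fun q hq => ih q (by simp [hq])))

theorem Reduced.exp {A : PairFun} (h : Reduced A) : Reduced A.exp := by
  obtain ⟨ξ, h⟩ := h
  have := ReducedAt.sum [(A, ξ)] (by simpa using h) (by simp)
  simp only [List.map_cons, List.map_nil, List.sum_cons, List.sum_nil] at this
  rw [add_eq_glue, glue_zero] at this
  exact ⟨_, this⟩

/-- Terms exp 0 = 0 are discarded; the first nonzero term is then either everything or a proper
first summand, and the tail of a decreasing list is again admissible. -/
theorem reduced_list_cases (l : List (PairFun × Ordinal.{0}))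
    (hl : ∀ p ∈ l, ReducedAt p.1 p.2) (hdec : l.Pairwise fun p q => q.2 ≤ p.2) :
    (∃ X, Reduced X ∧ (l.map fun p => p.1.exp).sum = X.exp) ∨
    ∃ X R, Reduced X ∧ Reduced R ∧ X ≠ 0 ∧ R ≠ 0 ∧
      (l.map fun p => p.1.exp).sum = X.exp + R := by
  induction l with
  | nil => exact Or.inl ⟨0, ⟨_, .zero⟩, by simp⟩
  | cons p l ih =>
    have hl' : ∀ q ∈ l, ReducedAt q.1 q.2 := fun q hq => hl q (by simp [hq])
    have hp : Reduced p.1 := ⟨_, hl p (by simp)⟩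
    have hR : Reduced (l.map fun p => p.1.exp).sum :=
      ⟨_, ReducedAt.sum l hl' (List.pairwise_cons.1 hdec).2⟩
    simp only [List.map_cons, List.sum_cons]
    by_cases h0 : p.1 = 0
    · rw [h0, exp_zero, add_eq_glue, zero_glue]
      exact ih hl' (List.pairwise_cons.1 hdec).2
    · by_cases h1 : (l.map fun p => p.1.exp).sum = 0
      · rw [h1, add_eq_glue, glue_zero]
        exact Or.inl ⟨_, hp, rfl⟩
      · exact Or.inr ⟨_, _, hp, hR, h0, h1, rfl⟩

theorem Reduced.cases {A : PairFun} (h : Reduced A) : (∃ X, Reduced X ∧ A = X.exp) ∨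
    ∃ X R, Reduced X ∧ Reduced R ∧ X ≠ 0 ∧ R ≠ 0 ∧ A = X.exp + R := by
  obtain ⟨ξ, h⟩ := h
  cases h with
  | zero => exact Or.inl ⟨0, ⟨_, .zero⟩, by simp⟩
  | one => exact Or.inl ⟨1, ⟨_, .one⟩, by simp⟩
  | sum l hl hdec => exact reduced_list_cases l hl hdec

theorem exp_ne_zero {A : PairFun} (h : A ≠ 0) : A.exp ≠ 0 := fun h' =>
  h (eq_zero_iff_card.2 (eq_zero_iff_card (A := A.exp) |>.1 h'))

/-- If A = exp X, apply the decomposition once more to X: exp of exp Y is E(Y), and exp of a proper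
sum is a proper product. -/
theorem Reduced.form {A : PairFun} (h : Reduced A) :
    IsEForm A ∨ IsSumForm A ∨ IsProdForm A := by
  rcases h.cases with ⟨X, hX, rfl⟩ | ⟨X, R, hX, hR, hX0, hR0, rfl⟩
  · rcases hX.cases with ⟨Y, hY, rfl⟩ | ⟨Y, R, hY, hR, hY0, hR0, rfl⟩
    · exact Or.inl ⟨Y, hY, rfl⟩
    · exact Or.inr (Or.inr ⟨Y.exp.exp, R.exp, hY.exp.exp, hR.exp,
        exp_ne_zero (exp_ne_zero hY0), exp_ne_zero hR0, exp_add _ _⟩)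
  · exact Or.inr (Or.inl ⟨_, _, hX.exp, hR, exp_ne_zero hX0, hR0, rfl⟩)

theorem IsSumForm.endVal {A : PairFun} (h : IsSumForm A) : 2 ≤ A.card ∧ A.endVal = 0 := by
  obtain ⟨B, C, -, -, hB, hC, rfl⟩ := h
  exact ⟨two_le_card_glue 0 hB hC, endVal_glue 0 hB hC⟩

theorem IsProdForm.endVal {A : PairFun} (h : IsProdForm A) : 2 ≤ A.card ∧ A.endVal = 1 := by
  obtain ⟨B, C, -, -, hB, hC, rfl⟩ := h
  exact ⟨two_le_card_glue 1 hB hC, endVal_glue 1 hB hC⟩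

theorem IsEForm.endVal {A : PairFun} (h : IsEForm A) (h2 : 2 ≤ A.card) : 2 ≤ A.endVal := by
  obtain ⟨B, -, rfl⟩ := h
  rw [PairFun.E, endVal_exp (by simpa using h2), endVal_exp (by simpa using h2)]
  omega

/-- Proper sums and products have at least two points, and on such bases the end values 0, 1 and at
least 2 tell the three forms apart. -/
theorem forms_exclusive (A : PairFun) : ¬ (IsEForm A ∧ IsSumForm A) ∧
    ¬ (IsEForm A ∧ IsProdForm A) ∧ ¬ (IsSumForm A ∧ IsProdForm A) := by
  refine ⟨fun ⟨h, h'⟩ => ?_, fun ⟨h, h'⟩ => ?_, fun ⟨h, h'⟩ => ?_⟩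
  · have := h.endVal h'.endVal.1
    have := h'.endVal.2
    omega
  · have := h.endVal h'.endVal.1
    have := h'.endVal.2
    omega
  · have := h.endVal.2
    have := h'.endVal.2
    omega

/-- The right factor of a reduced product is an exponential. -/
theorem exists_exp_of_reduced_mul {B C : PairFun} (hC : Reduced C) (hB0 : B ≠ 0) (hC0 : C ≠ 0)
    (h : Reduced (B * C)) : ∃ X, Reduced X ∧ C = X.exp := by
  rcases hC.cases with hX | ⟨X, R, hX, hR, hX0, hR0, hCe⟩
  · exact hX
  -- If C were a proper sum, the first and the last element of C would form a pair of value 0 in B *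
  -- C. An exponential has no such pair, and a proper sum would have end value 0 instead of 1.
  · exfalso
    have e0 : C.endVal = 0 := by rw [hCe]; exact endVal_glue 0 (exp_ne_zero hX0) hR0
    have c2 : 2 ≤ C.card := by rw [hCe]; exact two_le_card_glue 0 (exp_ne_zero hX0) hR0
    have v0 : (B * C).val B.card (B.card + C.card - 1) = 0 := by
      rw [mul_eq_glue, val_glue, if_neg (by omega), if_neg (by omega)]
      rw [← e0, endVal]
      congr 1 <;> omega
    rcases h.cases with ⟨Y, -, hY⟩ | ⟨Y, R, -, -, hY, hR, he⟩
    · have hc := congrArg card hY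
      simp at hc
      rw [hY, val_exp, if_pos (by omega)] at v0
      omega
    · have h1 : (B * C).endVal = 1 := endVal_glue 1 hB0 hC0
      have h2 : (B * C).endVal = 0 := by
        rw [he]; exact endVal_glue 0 (exp_ne_zero hY) hR
      omega

/-! ### Terms -/

namespace Term

theorem eval_ne_zero : ∀ t : Term, t.eval ≠ 0
  | one => fun h => by simpa [eval] using congrArg card h
  | add s t => fun h => by
      have := card_pos (eval_ne_zero s)
      have := congrArg card h
      simp [eval] at this; omega
  | mul s t => fun h => by
      have := card_pos (eval_ne_zero s)
      have := congrArg card h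
      simp [eval] at this; omega
  | E t => exp_ne_zero (exp_ne_zero (eval_ne_zero t))

/-- E(1) and 1 have the same value; this is the only ambiguity that the ban on E(1) has to remove.
-/
theorem eq_one_of_card {t : Term} (h : t.NoEOne) (hc : t.eval.card = 1) : t = one := by
  induction t with
  | one => rfl
  | add s t =>
    have := two_le_card_glue 0 (eval_ne_zero s) (eval_ne_zero t)
    have h' : (glue 0 s.eval t.eval).card = 1 := hc
    omega
  | mul s t =>
    have := two_le_card_glue 1 (eval_ne_zero s) (eval_ne_zero t)
    have h' : (glue 1 s.eval t.eval).card = 1 := hc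
    omega
  | E t ih => exact absurd (ih h.2 hc) h.1

theorem AssocEq.eval_eq {s t : Term} (h : AssocEq s t) : s.eval = t.eval := by
  induction h with
  | refl => rfl
  | symm _ ih => exact ih.symm
  | trans _ _ ih ih' => exact ih.trans ih'
  | add _ _ ih ih' => simp only [eval, ih, ih']
  | mul _ _ ih ih' => simp only [eval, ih, ih']
  | E _ ih => simp only [eval, ih]
  | add_assoc s t u => exact glue_assoc 0 _ _ _
  | mul_assoc s t u => exact glue_assoc 1 _ _ _

/-- Rotating brackets to the right exposes the first summand that is not itself a sum. The size is
preserved, so an induction on size still applies to the two parts. -/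
theorem exists_add_head (s t : Term) : ∃ u v, AssocEq (add s t) (add u v) ∧
    (∀ a b, u ≠ add a b) ∧ (s.NoEOne → t.NoEOne → u.NoEOne ∧ v.NoEOne) ∧
    sizeOf (add s t) = sizeOf (add u v) := by
  induction s generalizing t with
  | add s₁ s₂ ih _ =>
    obtain ⟨u, v, h1, h2, h3, h4⟩ := ih (add s₂ t)
    refine ⟨u, v, (AssocEq.add_assoc _ _ _).trans h1, h2, fun h h' => h3 h.1 ⟨h.2, h'⟩, ?_⟩
    rw [← h4]; simp; omega
  | one => exact ⟨one, t, .refl _, by simp, fun h h' => ⟨h, h'⟩, rfl⟩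
  | mul a b => exact ⟨mul a b, t, .refl _, by simp, fun h h' => ⟨h, h'⟩, rfl⟩
  | E a => exact ⟨E a, t, .refl _, by simp, fun h h' => ⟨h, h'⟩, rfl⟩

theorem exists_mul_head (s t : Term) : ∃ u v, AssocEq (mul s t) (mul u v) ∧
    (∀ a b, u ≠ mul a b) ∧ (s.NoEOne → t.NoEOne → u.NoEOne ∧ v.NoEOne) ∧
    sizeOf (mul s t) = sizeOf (mul u v) := by
  induction s generalizing t with
  | mul s₁ s₂ ih _ =>
    obtain ⟨u, v, h1, h2, h3, h4⟩ := ih (mul s₂ t)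
    refine ⟨u, v, (AssocEq.mul_assoc _ _ _).trans h1, h2, fun h h' => h3 h.1 ⟨h.2, h'⟩, ?_⟩
    rw [← h4]; simp; omega
  | one => exact ⟨one, t, .refl _, by simp, fun h h' => ⟨h, h'⟩, rfl⟩
  | add a b => exact ⟨add a b, t, .refl _, by simp, fun h h' => ⟨h, h'⟩, rfl⟩
  | E a => exact ⟨E a, t, .refl _, by simp, fun h h' => ⟨h, h'⟩, rfl⟩

theorem endVal_eval_E {t : Term} (h : (E t).NoEOne) : 2 ≤ (E t).eval.endVal := by
  have h2 : 2 ≤ t.eval.card := by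
    have := card_pos (eval_ne_zero t)
    by_contra h'
    exact h.1 (eq_one_of_card h.2 (by omega))
  show 2 ≤ t.eval.exp.exp.endVal
  rw [endVal_exp (by simpa using h2), endVal_exp h2]
  omega

theorem two_le_card_E {t : Term} (h : (E t).NoEOne) : 2 ≤ (E t).eval.card := by
  have := card_pos (eval_ne_zero t)
  by_contra h'
  exact h.1 (eq_one_of_card h.2 (by simp [eval] at h'; omega))

theorem endVal_eval_add (s t : Term) : (add s t).eval.endVal = 0 :=
  endVal_glue 0 (eval_ne_zero s) (eval_ne_zero t)

theorem endVal_eval_mul (s t : Term) : (mul s t).eval.endVal = 1 :=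
  endVal_glue 1 (eval_ne_zero s) (eval_ne_zero t)

theorem eq_add_of_endVal {t : Term} (h : t.NoEOne) (h2 : 2 ≤ t.eval.card)
    (h0 : t.eval.endVal = 0) : ∃ a b, t = add a b := by
  cases t with
  | one => simp [eval] at h2
  | add a b => exact ⟨a, b, rfl⟩
  | mul a b => rw [endVal_eval_mul] at h0; omega
  | E a => have := endVal_eval_E h; omega

theorem eq_mul_of_endVal {t : Term} (h : t.NoEOne) (h2 : 2 ≤ t.eval.card)
    (h0 : t.eval.endVal = 1) : ∃ a b, t = mul a b := by
  cases t with
  | one => simp [eval] at h2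
  | mul a b => exact ⟨a, b, rfl⟩
  | add a b => rw [endVal_eval_add] at h0; omega
  | E a => have := endVal_eval_E h; omega

/-- The end value forces both terms to have the same outermost operation. For a sum or product,
expose the heads: if one head had a longer base than the other, its end value would make it a sum
(or product) too. So the heads have equal bases, and head and rest can be compared separately. -/
theorem assocEq_of_eval_eq (n : ℕ) : ∀ s t : Term, sizeOf s ≤ n → s.NoEOne → t.NoEOne →
    s.eval = t.eval → AssocEq s t := by
  induction n with
  | zero => intro s t h; cases s <;> simp at h
  | succ n ih =>
    intro s t hn hs ht he
    have hcard := congrArg card he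
    have hend := congrArg endVal he
    cases s with
    | one =>
      rw [eq_one_of_card ht hcard.symm]
      exact .refl _
    | E s =>
      have h2 := two_le_card_E hs
      have h2' := endVal_eval_E hs
      cases t with
      | one => rw [hcard] at h2; simp [eval] at h2
      | add a b => rw [endVal_eval_add] at hend; omega
      | mul a b => rw [endVal_eval_mul] at hend; omega
      | E t =>
        simp at hn
        exact .E (ih s t (by omega) hs.2 ht.2 (exp_injective (exp_injective he)))
    | add a b =>
      have h2 : 2 ≤ t.eval.card := hcard ▸ two_le_card_glue 0 (eval_ne_zero a) (eval_ne_zero b)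
      rw [endVal_eval_add] at hend
      obtain ⟨c, d, rfl⟩ := eq_add_of_endVal ht h2 hend.symm
      obtain ⟨u, v, h1, hu, hN, hsz⟩ := exists_add_head a b
      obtain ⟨u', v', h1', hu', hN', hsz'⟩ := exists_add_head c d
      obtain ⟨hNu, hNv⟩ := hN hs.1 hs.2
      obtain ⟨hNu', hNv'⟩ := hN' ht.1 ht.2
      have key : glue 0 u.eval v.eval = glue 0 u'.eval v'.eval :=
        (h1.eval_eq.symm.trans he).trans h1'.eval_eq
      -- Contrapositive of recognizing sums by the end value 0, applied to the longer of two heads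
      -- of different lengths.
      have aux : ∀ w : Term, w.NoEOne → (∀ a b, w ≠ add a b) → 2 ≤ w.eval.card →
          w.eval.endVal ≠ 0 := fun w hw hw' h2 h0 => by
        obtain ⟨a, b, rfl⟩ := eq_add_of_endVal hw h2 h0
        exact hw' _ _ rfl
      have p := card_pos (eval_ne_zero u)
      have p' := card_pos (eval_ne_zero u')
      rcases lt_trichotomy u.eval.card u'.eval.card with hlt | heq | hlt
      · exact absurd (endVal_le_of_glue_eq (eval_ne_zero u) key hlt)
          (aux u' hNu' hu' (by omega))
      · obtain ⟨e1, e2⟩ := glue_injective heq key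
        simp at hsz hn
        exact (h1.trans (.add (ih u u' (by omega) hNu hNu' e1)
          (ih v v' (by omega) hNv hNv' e2))).trans h1'.symm
      · exact absurd (endVal_le_of_glue_eq (eval_ne_zero u') key.symm hlt)
          (aux u hNu hu (by omega))
    | mul a b =>
      have h2 : 2 ≤ t.eval.card := hcard ▸ two_le_card_glue 1 (eval_ne_zero a) (eval_ne_zero b)
      rw [endVal_eval_mul] at hend
      obtain ⟨c, d, rfl⟩ := eq_mul_of_endVal ht h2 hend.symm
      obtain ⟨u, v, h1, hu, hN, hsz⟩ := exists_mul_head a b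
      obtain ⟨u', v', h1', hu', hN', hsz'⟩ := exists_mul_head c d
      obtain ⟨hNu, hNv⟩ := hN hs.1 hs.2
      obtain ⟨hNu', hNv'⟩ := hN' ht.1 ht.2
      have key : glue 1 u.eval v.eval = glue 1 u'.eval v'.eval :=
        (h1.eval_eq.symm.trans he).trans h1'.eval_eq
      have aux : ∀ w : Term, w.NoEOne → (∀ a b, w ≠ mul a b) → 2 ≤ w.eval.card →
          w.eval.endVal ≠ 1 := fun w hw hw' h2 h0 => by
        obtain ⟨a, b, rfl⟩ := eq_mul_of_endVal hw h2 h0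
        exact hw' _ _ rfl
      have p := card_pos (eval_ne_zero u)
      have p' := card_pos (eval_ne_zero u')
      rcases lt_trichotomy u.eval.card u'.eval.card with hlt | heq | hlt
      · exact absurd (endVal_le_of_glue_eq (eval_ne_zero u) key hlt)
          (aux u' hNu' hu' (by omega))
      · obtain ⟨e1, e2⟩ := glue_injective heq key
        simp at hsz hn
        exact (h1.trans (.mul (ih u u' (by omega) hNu hNu' e1)
          (ih v v' (by omega) hNv hNv' e2))).trans h1'.symm
      · exact absurd (endVal_le_of_glue_eq (eval_ne_zero u') key.symm hlt)
          (aux u hNu hu (by omega))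

end Term

/-- The operation `exp` is missing from terms, so the induction carries exp A along: exp of a sum is
a product, and exp of exp A is E(A). -/
theorem IsArith.exists_term {A : PairFun} (h : IsArith A) :
    (A = 0 ∨ ∃ t : Term, t.NoEOne ∧ t.eval = A) ∧
    (A = 0 ∨ ∃ t : Term, t.NoEOne ∧ t.eval = A.exp) := by
  induction h with
  | zero => exact ⟨Or.inl rfl, Or.inl rfl⟩
  | one => exact ⟨Or.inr ⟨.one, trivial, rfl⟩, Or.inr ⟨.one, trivial, by simp [Term.eval]⟩⟩
  | @add B C _ _ ihB ihC =>
    obtain ⟨h1, h1'⟩ := ihB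
    obtain ⟨h2, h2'⟩ := ihC
    rcases eq_or_ne B 0 with rfl | hB
    · rw [add_eq_glue, zero_glue]; exact ⟨h2, h2'⟩
    rcases eq_or_ne C 0 with rfl | hC
    · rw [add_eq_glue, glue_zero]; exact ⟨h1, h1'⟩
    obtain ⟨t, ht, rfl⟩ := h1.resolve_left hB
    obtain ⟨s, hs, rfl⟩ := h2.resolve_left hC
    obtain ⟨t', ht', et⟩ := h1'.resolve_left hB
    obtain ⟨s', hs', es⟩ := h2'.resolve_left hC
    exact ⟨Or.inr ⟨.add t s, ⟨ht, hs⟩, rfl⟩,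
      Or.inr ⟨.mul t' s', ⟨ht', hs'⟩, by rw [exp_add, ← et, ← es]; rfl⟩⟩
  | @exp A _ ih =>
    rcases eq_or_ne A 0 with rfl | hA
    · exact ⟨Or.inl exp_zero, Or.inl exp_zero⟩
    obtain ⟨t, ht, rfl⟩ := ih.1.resolve_left hA
    refine ⟨Or.inr (ih.2.resolve_left hA), Or.inr ?_⟩
    -- The term E(1) is not allowed, but its value is that of the constant 1.
    by_cases h1 : t = .one
    · subst h1
      exact ⟨.one, trivial, by simp [Term.eval]⟩
    · exact ⟨.E t, ⟨h1, ht⟩, rfl⟩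

/-! ### Orbitals of order automorphisms of the interval -/

/-- By the intermediate value theorem a change of direction would force a fixed point. -/
theorem lt_map_of_forall_ne (g : I ≃o I) {u v y z : I} (h : ∀ t, u < t → t < v → g t ≠ t)
    (hy : u < y ∧ y < v) (hz : u < z ∧ z < v) (hlt : y < g y) : z < g z := by
  by_contra hle
  have hle := not_lt.1 hle
  obtain ⟨c, hc, hc'⟩ := isPreconnected_Ioo.intermediate_value₂ (s := Set.Ioo u v)
    (f := id) (g := g) hy hz continuous_id.continuousOn g.continuous.continuousOn hlt.le hle
  exact h c hc.1 hc.2 hc'.symm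

theorem exists_isOrbital (g : I ≃o I) {y : I} (h : g y ≠ y) :
    ∃ u v, IsOrbital g u v ∧ u < y ∧ y < v := by
  have hcl : IsClosed {z : I | g z = z} := isClosed_eq g.continuous continuous_id
  have hA : IsCompact ({z : I | g z = z} ∩ Set.Iic y) := (hcl.inter isClosed_Iic).isCompact
  have hB : IsCompact ({z : I | g z = z} ∩ Set.Ici y) := (hcl.inter isClosed_Ici).isCompact
  have h0 : g ⊥ = ⊥ := g.map_bot
  have h1 : g ⊤ = ⊤ := g.map_top
  obtain ⟨u, ⟨hu, huy⟩, hu'⟩ := hA.exists_isGreatest ⟨⊥, h0, (bot_le : ⊥ ≤ y)⟩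
  obtain ⟨v, ⟨hv, hvy⟩, hv'⟩ := hB.exists_isLeast ⟨⊤, h1, (le_top : y ≤ ⊤)⟩
  have hu1 : u < y := lt_of_le_of_ne huy (by rintro rfl; exact h hu)
  have hv1 : y < v := lt_of_le_of_ne hvy (by rintro rfl; exact h hv)
  refine ⟨u, v, ⟨hu1.trans hv1, hu, hv, fun t ht ht' hfix => ?_⟩, hu1, hv1⟩
  rcases le_total t y with hty | hty
  · exact absurd (hu' ⟨hfix, hty⟩) (not_le.2 ht)
  · exact absurd (hv' ⟨hfix, hty⟩) (not_le.2 ht')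

theorem IsOrbital.pos_or_neg {g : I ≃o I} {u v : I} (h : IsOrbital g u v) :
    IsPosOrbital g u v ∨ IsNegOrbital g u v := by
  obtain ⟨y, hy⟩ := exists_between h.1
  rcases lt_or_gt_of_ne (h.2.2.2 y hy.1 hy.2) with hlt | hlt
  · refine Or.inr ⟨h, fun z hz hz' => lt_of_le_of_ne (not_lt.1 fun hz2 => ?_)
      (h.2.2.2 z hz hz')⟩
    exact (lt_map_of_forall_ne g h.2.2.2 ⟨hz, hz'⟩ hy hz2).not_gt hlt
  · exact Or.inl ⟨h, fun z hz hz' => lt_map_of_forall_ne g h.2.2.2 hy ⟨hz, hz'⟩ hlt⟩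

theorem IsPosOrbital.not_neg {g : I ≃o I} {u v : I} (h : IsPosOrbital g u v) :
    ¬ IsNegOrbital g u v := fun h' => by
  obtain ⟨y, hy⟩ := exists_between h.1.1
  exact (h.2 y hy.1 hy.2).not_gt (h'.2 y hy.1 hy.2)

theorem image_support_Ioo {g : I ≃o I} {u v : I} (h : ∀ t, u < t → t < v → g t ≠ t) :
    Set.Ioo (u : ℝ) v ⊆ (fun t : I => (t : ℝ)) '' {t | g t ≠ t} := by
  intro r hr
  exact ⟨⟨r, u.2.1.trans hr.1.le, hr.2.le.trans v.2.2⟩, h _ hr.1 hr.2, rfl⟩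

/-- Coordinates for a function whose orbitals form a finite chain of adjacent intervals, the first
half of which is negative. -/
structure Frame (f : MarkedFun) where
  m : ℕ
  x : ℕ → I
  s : ℕ → I
  t : ℕ → I
  m_pos : 0 < m
  x_lt_s : ∀ i < m, x i < s i
  s_lt_t : ∀ i < m, s i < t i
  t_lt_x : ∀ i < m, t i < x (i + 1)
  move : ∀ y, f.map y ≠ y ↔ ∃ i < m, x i < y ∧ y < x (i + 1)
  neg : ∀ i < m, i < m / 2 → f.map (t i) = s i
  pos : ∀ i < m, m / 2 ≤ i → f.map (s i) = t i
  marks : ∀ y, y ∈ f.marks ↔ ∃ i < m, y = s i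

namespace Frame

variable {f g : MarkedFun} (F : Frame f) (G : Frame g)

theorem x_lt_succ {i : ℕ} (hi : i < F.m) : F.x i < F.x (i + 1) :=
  (F.x_lt_s i hi).trans ((F.s_lt_t i hi).trans (F.t_lt_x i hi))

theorem x_lt {i j : ℕ} (hij : i < j) (hj : j ≤ F.m) : F.x i < F.x j := by
  induction j with
  | zero => omega
  | succ j ih =>
    rcases Nat.lt_succ_iff_lt_or_eq.1 hij with h | rfl
    · exact (ih h (by omega)).trans (F.x_lt_succ hj)
    · exact F.x_lt_succ hj

theorem x_le {i j : ℕ} (hij : i ≤ j) (hj : j ≤ F.m) : F.x i ≤ F.x j := by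
  rcases hij.eq_or_lt with rfl | h
  · exact le_rfl
  · exact (F.x_lt h hj).le

theorem lt_of_x_lt {i j : ℕ} (hi : i ≤ F.m) (h : F.x i < F.x j) : i < j := by
  by_contra h'
  exact (F.x_le (not_lt.1 h') hi).not_gt h

theorem index_unique {i j : ℕ} {y : I} (hi : i < F.m) (hj : j < F.m)
    (h : F.x i < y ∧ y < F.x (i + 1)) (h' : F.x j < y ∧ y < F.x (j + 1)) : i = j := by
  have h1 := F.lt_of_x_lt (by omega) (h.1.trans h'.2)
  have h2 := F.lt_of_x_lt (by omega) (h'.1.trans h.2)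
  omega

theorem map_x {i : ℕ} (hi : i ≤ F.m) : f.map (F.x i) = F.x i := by
  by_contra h
  obtain ⟨j, hj, h1, h2⟩ := (F.move _).1 h
  have h1 := F.lt_of_x_lt (by omega) h1
  have h2 := F.lt_of_x_lt hi h2
  omega

theorem map_ne {i : ℕ} (hi : i < F.m) {y : I} (h : F.x i < y) (h' : y < F.x (i + 1)) :
    f.map y ≠ y := (F.move y).2 ⟨i, hi, h, h'⟩

theorem isOrbital {i : ℕ} (hi : i < F.m) : IsOrbital f.map (F.x i) (F.x (i + 1)) :=
  ⟨F.x_lt_succ hi, F.map_x hi.le, F.map_x hi, fun _ h h' => F.map_ne hi h h'⟩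

theorem isOrbital_iff {u v : I} :
    IsOrbital f.map u v ↔ ∃ i < F.m, u = F.x i ∧ v = F.x (i + 1) := by
  constructor
  · intro h
    obtain ⟨y, hy⟩ := exists_between h.1
    obtain ⟨i, hi, h1, h2⟩ := (F.move y).1 (h.2.2.2 y hy.1 hy.2)
    refine ⟨i, hi, le_antisymm (not_lt.1 fun hlt => ?_) (not_lt.1 fun hlt => ?_),
      le_antisymm (not_lt.1 fun hlt => ?_) (not_lt.1 fun hlt => ?_)⟩
    · exact F.map_ne hi hlt (hy.1.trans h2) h.2.1
    · exact h.2.2.2 _ hlt (h1.trans hy.2) (F.map_x hi.le)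
    · exact h.2.2.2 _ (hy.1.trans h2) hlt (F.map_x hi)
    · exact F.map_ne hi (h1.trans hy.2) hlt h.2.2.1
  · rintro ⟨i, hi, rfl, rfl⟩
    exact F.isOrbital hi

theorem x_inj {i j : ℕ} (hi : i ≤ F.m) (hj : j ≤ F.m) (h : F.x i = F.x j) : i = j := by
  rcases lt_trichotomy i j with h' | h' | h'
  · exact absurd h (F.x_lt h' hj).ne
  · exact h'
  · exact absurd h (F.x_lt h' hi).ne'

theorem isPosOrbital {i : ℕ} (hi : i < F.m) (h : F.m / 2 ≤ i) :
    IsPosOrbital f.map (F.x i) (F.x (i + 1)) := by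
  refine ⟨F.isOrbital hi, fun y hy hy' => lt_map_of_forall_ne f.map (F.isOrbital hi).2.2.2
    ⟨F.x_lt_s i hi, (F.s_lt_t i hi).trans (F.t_lt_x i hi)⟩ ⟨hy, hy'⟩ ?_⟩
  rw [F.pos i hi h]
  exact F.s_lt_t i hi

theorem isNegOrbital {i : ℕ} (hi : i < F.m) (h : i < F.m / 2) :
    IsNegOrbital f.map (F.x i) (F.x (i + 1)) := by
  rcases (F.isOrbital hi).pos_or_neg with h' | h'
  · have := h'.2 _ ((F.x_lt_s i hi).trans (F.s_lt_t i hi)) (F.t_lt_x i hi)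
    rw [F.neg i hi h] at this
    exact absurd this (F.s_lt_t i hi).not_gt
  · exact h'

theorem isPosOrbital_iff {u v : I} :
    IsPosOrbital f.map u v ↔ ∃ i < F.m, F.m / 2 ≤ i ∧ u = F.x i ∧ v = F.x (i + 1) := by
  constructor
  · intro h
    obtain ⟨i, hi, rfl, rfl⟩ := F.isOrbital_iff.1 h.1
    exact ⟨i, hi, not_lt.1 fun h' => h.not_neg (F.isNegOrbital hi h'), rfl, rfl⟩
  · rintro ⟨i, hi, h, rfl, rfl⟩
    exact F.isPosOrbital hi h

theorem isNegOrbital_iff {u v : I} :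
    IsNegOrbital f.map u v ↔ ∃ i < F.m, i < F.m / 2 ∧ u = F.x i ∧ v = F.x (i + 1) := by
  constructor
  · intro h
    obtain ⟨i, hi, rfl, rfl⟩ := F.isOrbital_iff.1 h.1
    exact ⟨i, hi, not_le.1 fun h' => (F.isPosOrbital hi h').not_neg h, rfl, rfl⟩
  · rintro ⟨i, hi, h, rfl, rfl⟩
    exact F.isNegOrbital hi h

theorem isMinOrbital_iff {u v : I} : IsMinOrbital f.map u v ↔ u = F.x 0 ∧ v = F.x 1 := by
  constructor
  · rintro ⟨h, h'⟩
    obtain ⟨i, hi, rfl, rfl⟩ := F.isOrbital_iff.1 h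
    have := h' _ _ (F.isOrbital F.m_pos)
    have : i = 0 := by
      by_contra h0
      exact this.not_gt (F.x_lt (by omega) hi.le)
    subst this
    exact ⟨rfl, rfl⟩
  · rintro ⟨rfl, rfl⟩
    refine ⟨F.isOrbital F.m_pos, fun u v h => ?_⟩
    obtain ⟨i, hi, rfl, rfl⟩ := F.isOrbital_iff.1 h
    exact F.x_le (by omega) hi.le

theorem isMaxOrbital_iff {u v : I} :
    IsMaxOrbital f.map u v ↔ u = F.x (F.m - 1) ∧ v = F.x F.m := by
  have hm := F.m_pos
  have e : F.m - 1 + 1 = F.m := by omega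
  constructor
  · rintro ⟨h, h'⟩
    obtain ⟨i, hi, rfl, rfl⟩ := F.isOrbital_iff.1 h
    have := h' _ _ (F.isOrbital (i := F.m - 1) (by omega))
    have : i = F.m - 1 := by
      by_contra h0
      exact this.not_gt (F.x_lt (by omega) (by omega))
    subst this
    exact ⟨rfl, by rw [e]⟩
  · rintro ⟨rfl, rfl⟩
    have h := F.isOrbital (i := F.m - 1) (by omega)
    rw [e] at h
    refine ⟨h, fun u v h => ?_⟩
    obtain ⟨i, hi, rfl, rfl⟩ := F.isOrbital_iff.1 h
    exact F.x_le (by omega) (by omega)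

theorem ncard_image (p : ℕ → Prop) (N : ℕ) (hN : N ≤ F.m) (M : ℕ)
    (hp : ∀ i < F.m, p i ↔ M ≤ i ∧ i < N) :
    {q : I × I | ∃ i < F.m, p i ∧ q.1 = F.x i ∧ q.2 = F.x (i + 1)}.ncard = N - M := by
  have : {q : I × I | ∃ i < F.m, p i ∧ q.1 = F.x i ∧ q.2 = F.x (i + 1)} =
      (fun i => (F.x i, F.x (i + 1))) '' (Finset.Ico M N : Set ℕ) := by
    ext ⟨a, b⟩
    simp only [Set.mem_ofPred_eq, Finset.coe_Ico, Set.mem_image, Set.mem_Ico, Prod.mk.injEq]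
    constructor
    · rintro ⟨i, hi, h, rfl, rfl⟩
      exact ⟨i, (hp i hi).1 h, rfl, rfl⟩
    · rintro ⟨i, hi, rfl, rfl⟩
      exact ⟨i, by omega, (hp i (by omega)).2 hi, rfl, rfl⟩
  rw [this, Set.InjOn.ncard_image, Set.ncard_coe_finset, Nat.card_Ico]
  intro i hi j hj h
  simp only [Finset.coe_Ico, Set.mem_Ico] at hi hj
  exact F.x_inj (by omega) (by omega) (congrArg Prod.fst h)

theorem ncard_orbitals : (orbitals f.map).ncard = F.m := by
  have := F.ncard_image (fun _ => True) F.m le_rfl 0 (by simp)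
  simp only [true_and, Nat.sub_zero] at this
  rw [← this]
  congr 1
  ext ⟨a, b⟩
  exact F.isOrbital_iff

theorem exists_index_le {y : I} (h : F.x 0 ≤ y) (h' : y < F.x F.m) :
    ∃ i < F.m, F.x i ≤ y ∧ y < F.x (i + 1) := by
  classical
  have hex : ∃ i, y < F.x i := ⟨_, h'⟩
  have h0 : Nat.find hex ≠ 0 := fun h0 => by
    have := Nat.find_spec hex
    rw [h0] at this
    exact h.not_gt this
  have hle : Nat.find hex ≤ F.m := Nat.find_le h'
  refine ⟨Nat.find hex - 1, by omega, not_lt.1 (Nat.find_min hex (by omega)), ?_⟩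
  rw [Nat.sub_add_cancel (by omega)]
  exact Nat.find_spec hex

/-- Consecutive orbitals share an end point, so taking the closure fills the gaps. -/
theorem extSupport_eq : extSupport f.map = Set.Ioo (F.x 0 : ℝ) (F.x F.m) := by
  have hlt : (F.x 0 : ℝ) < F.x F.m := F.x_lt F.m_pos le_rfl
  have : closure ((fun t : I => (t : ℝ)) '' {t | f.map t ≠ t}) =
      Set.Icc (F.x 0 : ℝ) (F.x F.m) := by
    apply Set.Subset.antisymm
    · refine closure_minimal ?_ isClosed_Icc
      rintro _ ⟨y, hy, rfl⟩
      obtain ⟨i, hi, h1, h2⟩ := (F.move y).1 hy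
      exact ⟨(F.x_le (Nat.zero_le i) hi.le).trans h1.le, h2.le.trans (F.x_le hi le_rfl)⟩
    · rw [← closure_Ioo hlt.ne]
      refine closure_minimal ?_ isClosed_closure
      rintro r ⟨hr, hr'⟩
      obtain ⟨i, hi, h1, h2⟩ := F.exists_index_le
        (y := ⟨r, (F.x 0).2.1.trans hr.le, hr'.le.trans (F.x F.m).2.2⟩) hr.le hr'
      have hlt' : (F.x i : ℝ) < F.x (i + 1) := F.x_lt_succ hi
      refine closure_mono (image_support_Ioo (F.isOrbital hi).2.2.2) ?_
      rw [closure_Ioo hlt'.ne]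
      exact ⟨h1, h2.le⟩
  rw [extSupport, this, interior_Icc]

theorem leftOf_iff : LeftOf f g ↔ F.x F.m ≤ G.x 0 := by
  rw [LeftOf, F.extSupport_eq, G.extSupport_eq]
  have hF : (F.x 0 : ℝ) < F.x F.m := F.x_lt F.m_pos le_rfl
  have hG : (G.x 0 : ℝ) < G.x G.m := G.x_lt G.m_pos le_rfl
  constructor
  · rintro ⟨-, h⟩
    by_contra h'
    have h' : (G.x 0 : ℝ) < F.x F.m := not_le.1 h'
    obtain ⟨p, hp, hp'⟩ := exists_between (max_lt hF h')
    have h1 := h p ⟨(le_max_left _ _).trans_lt hp, hp'⟩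
    obtain ⟨q, hq, hq'⟩ := exists_between (lt_min ((le_max_right _ _).trans_lt hp) hG)
    have := h1 q ⟨hq, hq'.trans_le (min_le_right _ _)⟩
    exact this.not_gt (hq'.trans_le (min_le_left _ _))
  · intro h
    have h : (F.x F.m : ℝ) ≤ G.x 0 := h
    refine ⟨Set.disjoint_left.2 fun p hp hp' => ?_, fun p hp q hq => ?_⟩
    · exact (hp.2.trans_le h).not_gt hp'.1
    · exact (hp.2.trans_le h).trans hq.1

theorem inside_iff : Inside f g ↔ G.x 0 < F.x 0 ∧ F.x F.m < G.x G.m := by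
  rw [Inside, F.extSupport_eq, G.extSupport_eq]
  have hF : (F.x 0 : ℝ) < F.x F.m := F.x_lt F.m_pos le_rfl
  rw [closure_Ioo hF.ne]
  constructor
  · intro h
    exact ⟨(h (Set.left_mem_Icc.2 hF.le)).1, (h (Set.right_mem_Icc.2 hF.le)).2⟩
  · rintro ⟨h, h'⟩ r hr
    exact ⟨lt_of_lt_of_le h hr.1, lt_of_le_of_lt hr.2 h'⟩

theorem mem_marks_iff {i : ℕ} (hi : i < F.m) {r : I} :
    (r ∈ f.marks ∧ F.x i < r ∧ r < F.x (i + 1)) ↔ r = F.s i := by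
  constructor
  · rintro ⟨h, h1, h2⟩
    obtain ⟨j, hj, rfl⟩ := (F.marks r).1 h
    rw [F.index_unique hj hi ⟨F.x_lt_s j hj, (F.s_lt_t j hj).trans (F.t_lt_x j hj)⟩ ⟨h1, h2⟩]
  · rintro rfl
    exact ⟨(F.marks _).2 ⟨i, hi, rfl⟩, F.x_lt_s i hi, (F.s_lt_t i hi).trans (F.t_lt_x i hi)⟩

/-- The point `t i` is the image of the marker under f for positive and under f⁻¹ for negative
bumps, so both signs give feet of the same shape. -/
theorem mem_feet_iff {y : I} : y ∈ f.feet ↔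
    ∃ i < F.m, (F.x i < y ∧ y < F.s i) ∨ (F.t i ≤ y ∧ y < F.x (i + 1)) := by
  constructor
  · rintro ⟨u, v, r, hr, hr1, hr2, ⟨h, h'⟩ | ⟨h, h'⟩ | ⟨h, h'⟩⟩
    · obtain ⟨i, hi, rfl, rfl⟩ := F.isOrbital_iff.1 h
      rw [(F.mem_marks_iff hi).1 ⟨hr, hr1, hr2⟩] at h'
      exact ⟨i, hi, Or.inl h'⟩
    · obtain ⟨i, hi, hi', rfl, rfl⟩ := F.isPosOrbital_iff.1 h
      rw [(F.mem_marks_iff hi).1 ⟨hr, hr1, hr2⟩, F.pos i hi hi'] at h'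
      exact ⟨i, hi, Or.inr h'⟩
    · obtain ⟨i, hi, hi', rfl, rfl⟩ := F.isNegOrbital_iff.1 h
      rw [(F.mem_marks_iff hi).1 ⟨hr, hr1, hr2⟩, ← F.neg i hi hi',
        OrderIso.symm_apply_apply] at h'
      exact ⟨i, hi, Or.inr h'⟩
  · rintro ⟨i, hi, h⟩
    obtain ⟨h1, h2, h3⟩ := (F.mem_marks_iff hi).2 rfl
    refine ⟨F.x i, F.x (i + 1), F.s i, h1, h2, h3, ?_⟩
    rcases h with h | h
    · exact Or.inl ⟨F.isOrbital hi, h⟩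
    · by_cases hi' : i < F.m / 2
      · refine Or.inr (Or.inr ⟨F.isNegOrbital hi hi', ?_⟩)
        rw [← F.neg i hi hi', OrderIso.symm_apply_apply]
        exact h
      · refine Or.inr (Or.inl ⟨F.isPosOrbital hi (by omega), ?_⟩)
        rw [F.pos i hi (by omega)]
        exact h

theorem isStandard {f : MarkedFun} (F : Frame f) : IsStandard f where
  finite := by
    refine Set.Finite.subset ((Finset.range F.m).finite_toSet.image
      fun i => (F.x i, F.x (i + 1))) ?_
    rintro ⟨u, v⟩ h
    obtain ⟨i, hi, rfl, rfl⟩ := F.isOrbital_iff.1 h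
    exact ⟨i, by simpa using hi, rfl⟩
  nonempty := by
    rw [F.extSupport_eq, Set.nonempty_Ioo]
    exact F.x_lt F.m_pos le_rfl
  interval := by rw [F.extSupport_eq]; exact Set.ordConnected_Ioo
  neg_pos u v u' v' h h' := by
    obtain ⟨i, hi, hi', rfl, rfl⟩ := F.isNegOrbital_iff.1 h
    obtain ⟨j, hj, hj', rfl, rfl⟩ := F.isPosOrbital_iff.1 h'
    exact F.x_le (by omega) hj.le
  neg_le_pos := by
    have h1 := F.ncard_image (fun i => i < F.m / 2) (F.m / 2) (by omega) 0 (by simp)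
    have h2 := F.ncard_image (fun i => F.m / 2 ≤ i) F.m le_rfl (F.m / 2) (by simp; omega)
    simp only [F.isNegOrbital_iff, F.isPosOrbital_iff, h1, h2]
    omega
  pos_le_neg_add_one := by
    have h1 := F.ncard_image (fun i => i < F.m / 2) (F.m / 2) (by omega) 0 (by simp)
    have h2 := F.ncard_image (fun i => F.m / 2 ≤ i) F.m le_rfl (F.m / 2) (by simp; omega)
    simp only [F.isNegOrbital_iff, F.isPosOrbital_iff, h1, h2]
    omega

end Frame

/-! ### Every standard function has a frame -/

theorem exists_threshold (p : ℕ → Prop) (m : ℕ)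
    (h : ∀ i j, i < j → j < m → p j → p i) : ∃ N ≤ m, ∀ i < m, p i ↔ i < N := by
  classical
  by_cases hex : ∃ i, i < m ∧ ¬ p i
  · refine ⟨Nat.find hex, (Nat.find_spec hex).1.le, fun i hi => ⟨fun hp => ?_, fun hlt => ?_⟩⟩
    · by_contra h'
      have hs := Nat.find_spec hex
      rcases (not_lt.1 h').eq_or_lt with e | e
      · exact hs.2 (e ▸ hp)
      · exact hs.2 (h _ _ e hi hp)
    · have := Nat.find_min hex hlt
      push Not at this
      exact this hi
  · push Not at hex
    exact ⟨m, le_rfl, fun i hi => ⟨fun _ => hi, fun _ => hex i hi⟩⟩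

/-- Sort the finitely many transition points. Connectedness of the extended support makes every
interval between neighbours an orbital, the order condition puts the negative ones first, and the
counting condition fixes their number. -/
theorem IsStandard.nonempty_frame {f : MarkedFun} (hf : IsStandard f) : Nonempty (Frame f) := by
  classical
  set T : Finset I := (hf.finite.image Prod.fst).toFinset ∪ (hf.finite.image Prod.snd).toFinset
    with hT
  have memT : ∀ z, z ∈ T ↔ ∃ u v, IsOrbital f.map u v ∧ (z = u ∨ z = v) := by
    intro z
    simp only [hT, Finset.mem_union, Set.Finite.mem_toFinset, Set.mem_image, orbitals,
      Set.mem_ofPred_eq, Prod.exists]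
    constructor
    · rintro (⟨u, v, h, rfl⟩ | ⟨u, v, h, rfl⟩)
      · exact ⟨u, v, h, Or.inl rfl⟩
      · exact ⟨u, v, h, Or.inr rfl⟩
    · rintro ⟨u, v, h, rfl | rfl⟩
      · exact Or.inl ⟨z, v, h, rfl⟩
      · exact Or.inr ⟨u, z, h, rfl⟩
  have fixT : ∀ z ∈ T, f.map z = z := by
    intro z hz
    obtain ⟨u, v, h, rfl | rfl⟩ := (memT z).1 hz
    · exact h.2.1
    · exact h.2.2.1
  have hne : ∃ y, f.map y ≠ y := by
    by_contra h
    push Not at h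
    obtain ⟨r, hr⟩ := hf.nonempty
    have : {t : I | f.map t ≠ t} = ∅ := by ext t; simp [h t]
    rw [extSupport, this] at hr
    simp at hr
  obtain ⟨y₀, hy₀⟩ := hne
  obtain ⟨u₀, v₀, ho₀, -, -⟩ := exists_isOrbital f.map hy₀
  have hcard : 2 ≤ T.card := by
    have : ({u₀, v₀} : Finset I) ⊆ T := by
      intro z hz
      simp only [Finset.mem_insert, Finset.mem_singleton] at hz
      exact (memT z).2 ⟨_, _, ho₀, hz⟩
    have h2 := Finset.card_le_card this
    rwa [Finset.card_pair ho₀.1.ne] at h2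
  set e := T.orderEmbOfFin rfl with he
  -- The value 1 beyond the list is an irrelevant default.
  set x : ℕ → I := fun i => if h : i < T.card then e ⟨i, h⟩ else 1 with hx
  have xe : ∀ i (h : i < T.card), x i = e ⟨i, h⟩ := fun i h => by simp [hx, h]
  have xT : ∀ i, i < T.card → x i ∈ T := fun i h => by
    rw [xe i h]; exact Finset.orderEmbOfFin_mem _ _ _
  have xlt : ∀ i j, j < T.card → (x i < x j ↔ i < j) ∨ T.card ≤ i := fun i j hj => by
    by_cases hi : i < T.card
    · left; rw [xe i hi, xe j hj]; simp
    · right; omega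
  have surT : ∀ z ∈ T, ∃ i < T.card, z = x i := fun z hz => by
    have : z ∈ Set.range e := by rw [he, Finset.range_orderEmbOfFin]; exact hz
    obtain ⟨i, rfl⟩ := this
    exact ⟨i, i.2, (xe i i.2).symm⟩
  set m := T.card - 1 with hm
  have xlt' : ∀ i j, i ≤ m → j ≤ m → (x i < x j ↔ i < j) := fun i j hi hj =>
    (xlt i j (by omega)).resolve_right (by omega)
  have xle' : ∀ i j, i ≤ m → j ≤ m → (x i ≤ x j ↔ i ≤ j) := fun i j hi hj => by
    rw [← not_lt, ← not_lt, xlt' j i hj hi]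
  have gapT : ∀ i < m, ∀ z ∈ T, z ≤ x i ∨ x (i + 1) ≤ z := by
    intro i hi z hz
    obtain ⟨j, hj, rfl⟩ := surT z hz
    rw [xle' j i (by omega) (by omega), xle' (i + 1) j (by omega) (by omega)]
    omega
  have orb : ∀ i < m, IsOrbital f.map (x i) (x (i + 1)) := by
    intro i hi
    have hlt : x i < x (i + 1) := (xlt' _ _ (by omega) (by omega)).2 (by omega)
    refine ⟨hlt, fixT _ (xT i (by omega)), fixT _ (xT (i + 1) (by omega)), fun y hy hy' => ?_⟩
    have sub : ∀ u v, IsOrbital f.map u v → Set.Ioo (u : ℝ) v ⊆ extSupport f.map := by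
      intro u v h
      exact interior_maximal ((image_support_Ioo h.2.2.2).trans subset_closure) isOpen_Ioo
    have low : ∃ r ∈ extSupport f.map, r < (y : ℝ) := by
      obtain ⟨u, v, h, h'⟩ := (memT _).1 (xT i (by omega))
      have hu : u < y := by
        rcases h' with rfl | rfl
        · exact hy
        · exact h.1.trans hy
      obtain ⟨r, hr⟩ := exists_between (lt_min (show (u : ℝ) < v from h.1) hu)
      exact ⟨r, sub u v h ⟨hr.1, hr.2.trans_le (min_le_left _ _)⟩,
        hr.2.trans_le (min_le_right _ _)⟩
    have high : ∃ r ∈ extSupport f.map, (y : ℝ) < r := by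
      obtain ⟨u, v, h, h'⟩ := (memT _).1 (xT (i + 1) (by omega))
      have hu : y < v := by
        rcases h' with rfl | rfl
        · exact hy'.trans h.1
        · exact hy'
      obtain ⟨r, hr⟩ := exists_between (max_lt (show (u : ℝ) < v from h.1) hu)
      exact ⟨r, sub u v h ⟨(le_max_left _ _).trans_lt hr.1, hr.2⟩,
        (le_max_right _ _).trans_lt hr.1⟩
    obtain ⟨p, hp, hpy⟩ := low
    obtain ⟨q, hq, hqy⟩ := high
    -- As the extended support is an interval with points on both sides of y, some moved point lies
    -- in the same gap between transition points as y. The ends of its orbital are transition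
    -- points, so that orbital covers the whole gap.
    have hmem := interior_subset (hf.interval.out hp hq ⟨hpy.le, hqy.le⟩)
    rw [mem_closure_iff] at hmem
    obtain ⟨_, ⟨hz1, hz2⟩, z, hz, rfl⟩ := hmem (Set.Ioo (x i : ℝ) (x (i + 1))) isOpen_Ioo ⟨hy, hy'⟩
    obtain ⟨u, v, ho, hu, hv⟩ := exists_isOrbital f.map hz
    have hu' : u ≤ x i := (gapT i hi u ((memT u).2 ⟨u, v, ho, Or.inl rfl⟩)).resolve_right
      fun h => (hu.trans (show z < x (i + 1) from hz2)).not_ge h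
    have hv' : x (i + 1) ≤ v := (gapT i hi v ((memT v).2 ⟨u, v, ho, Or.inr rfl⟩)).resolve_left
      fun h => ((show x i < z from hz1).trans hv).not_ge h
    exact ho.2.2.2 y (hu'.trans_lt hy) (hy'.trans_le hv')
  have move : ∀ y, f.map y ≠ y ↔ ∃ i < m, x i < y ∧ y < x (i + 1) := by
    intro y
    constructor
    · intro h
      obtain ⟨u, v, ho, hu, hv⟩ := exists_isOrbital f.map h
      obtain ⟨i, hi, rfl⟩ := surT u ((memT u).2 ⟨u, v, ho, Or.inl rfl⟩)
      obtain ⟨j, hj, rfl⟩ := surT v ((memT v).2 ⟨_, v, ho, Or.inr rfl⟩)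
      have hij : i < j := (xlt' i j (by omega) (by omega)).1 ho.1
      refine ⟨i, by omega, hu, ?_⟩
      by_contra hle
      have hlt : x (i + 1) < x j := (not_lt.1 hle).trans_lt hv
      exact ho.2.2.2 _ ((xlt' i (i + 1) (by omega) (by omega)).2 (by omega)) hlt (fixT _ (xT (i + 1) (by omega)))
    · rintro ⟨i, hi, h, h'⟩
      exact (orb i hi).2.2.2 y h h'
  have dc : ∀ i j, i < j → j < m → IsNegOrbital f.map (x j) (x (j + 1)) →
      IsNegOrbital f.map (x i) (x (i + 1)) := by
    intro i j hij hj h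
    refine (orb i (by omega)).pos_or_neg.resolve_left fun h' => ?_
    have := hf.neg_pos _ _ _ _ h h'
    rw [xle' (j + 1) i (by omega) (by omega)] at this
    omega
  obtain ⟨N, hN, hthr⟩ := exists_threshold
    (fun i => IsNegOrbital f.map (x i) (x (i + 1))) m dc
  have hs : ∀ i, ∃ r, i < m → r ∈ f.marks ∧ x i < r ∧ r < x (i + 1) := by
    intro i
    by_cases hi : i < m
    · obtain ⟨r, hr, -⟩ := f.existsUnique_mark _ _ (orb i hi)
      exact ⟨r, fun _ => hr⟩
    · exact ⟨0, fun h => absurd h hi⟩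
  choose s hs using hs
  have hpos : ∀ i < m, N ≤ i → IsPosOrbital f.map (x i) (x (i + 1)) := fun i hi h =>
    (orb i hi).pos_or_neg.resolve_right fun h' => by
      have := (hthr i hi).1 h'; omega
  have orbiff : ∀ u v, IsOrbital f.map u v ↔ ∃ i < m, u = x i ∧ v = x (i + 1) := by
    intro u v
    constructor
    · intro ho
      obtain ⟨i, hi, rfl⟩ := surT u ((memT u).2 ⟨u, v, ho, Or.inl rfl⟩)
      obtain ⟨j, hj, rfl⟩ := surT v ((memT v).2 ⟨_, v, ho, Or.inr rfl⟩)
      have hij : i < j := (xlt' i j (by omega) (by omega)).1 ho.1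
      refine ⟨i, by omega, rfl, ?_⟩
      rcases (show i + 1 ≤ j from hij).eq_or_lt with h | h
      · rw [h]
      · exact absurd (fixT _ (xT (i + 1) (by omega)))
          (ho.2.2.2 _ ((xlt' i (i + 1) (by omega) (by omega)).2 (by omega))
            ((xlt' (i + 1) j (by omega) (by omega)).2 h))
    · rintro ⟨i, hi, rfl, rfl⟩
      exact orb i hi
  have cnt : ∀ (A B : ℕ), B ≤ m → ((fun i => (x i, x (i + 1))) ''
      (Finset.Ico A B : Set ℕ)).ncard = B - A := by
    intro A B hB
    rw [Set.InjOn.ncard_image, Set.ncard_coe_finset, Nat.card_Ico]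
    intro i hi j hj h
    simp only [Finset.coe_Ico, Set.mem_Ico] at hi hj
    have h1 : x i = x j := congrArg Prod.fst h
    have h2 := (xle' i j (by omega) (by omega)).1 h1.le
    have h3 := (xle' j i (by omega) (by omega)).1 h1.ge
    omega
  have hNeg : {p : I × I | IsNegOrbital f.map p.1 p.2} =
      (fun i => (x i, x (i + 1))) '' (Finset.Ico 0 N : Set ℕ) := by
    ext ⟨u, v⟩
    simp only [Set.mem_ofPred_eq, Finset.coe_Ico, Set.mem_image, Set.mem_Ico, Prod.mk.injEq]
    constructor
    · intro h
      obtain ⟨i, hi, rfl, rfl⟩ := (orbiff u v).1 h.1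
      exact ⟨i, ⟨by omega, (hthr i hi).1 h⟩, rfl, rfl⟩
    · rintro ⟨i, hi, rfl, rfl⟩
      exact (hthr i (by omega)).2 hi.2
  have hPos : {p : I × I | IsPosOrbital f.map p.1 p.2} =
      (fun i => (x i, x (i + 1))) '' (Finset.Ico N m : Set ℕ) := by
    ext ⟨u, v⟩
    simp only [Set.mem_ofPred_eq, Finset.coe_Ico, Set.mem_image, Set.mem_Ico, Prod.mk.injEq]
    constructor
    · intro h
      obtain ⟨i, hi, rfl, rfl⟩ := (orbiff u v).1 h.1
      exact ⟨i, ⟨not_lt.1 fun h' => h.not_neg ((hthr i hi).2 h'), hi⟩, rfl, rfl⟩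
    · rintro ⟨i, hi, rfl, rfl⟩
      exact hpos i hi.2 hi.1
  -- From N ≤ P ≤ N + 1 and N + P = m.
  have hN2 : N = m / 2 := by
    have h1 := hf.neg_le_pos
    have h2 := hf.pos_le_neg_add_one
    rw [hNeg, hPos, cnt 0 N hN, cnt N m le_rfl] at h1 h2
    omega
  refine ⟨⟨m, x, s, fun i => if i < m / 2 then f.map.symm (s i) else f.map (s i), by omega,
    fun i hi => (hs i hi).2.1, fun i hi => ?_, fun i hi => ?_, move, fun i hi h => ?_,
    fun i hi h => ?_, fun y => ⟨fun hy => ?_, ?_⟩⟩⟩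
  · split_ifs with h
    · have := ((hthr i hi).2 (by omega)).2 (s i) (hs i hi).2.1 (hs i hi).2.2
      rw [← f.map.lt_iff_lt]
      simpa using this
    · exact (hpos i hi (by omega)).2 (s i) (hs i hi).2.1 (hs i hi).2.2
  · have hfx : f.map (x (i + 1)) = x (i + 1) := fixT _ (xT (i + 1) (by omega))
    show (if i < m / 2 then f.map.symm (s i) else f.map (s i)) < x (i + 1)
    split_ifs with h
    · rw [← f.map.lt_iff_lt, hfx]
      simpa using (hs i hi).2.2
    · rw [← hfx, f.map.lt_iff_lt]
      exact (hs i hi).2.2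
  · show f.map (if i < m / 2 then f.map.symm (s i) else f.map (s i)) = s i
    rw [if_pos h]; simp
  · show f.map (s i) = if i < m / 2 then f.map.symm (s i) else f.map (s i)
    rw [if_neg (by omega)]
  · obtain ⟨i, hi, h1, h2⟩ := (move y).1 (f.marks_subset y hy)
    exact ⟨i, hi, (f.existsUnique_mark _ _ (orb i hi)).unique ⟨hy, h1, h2⟩ (hs i hi)⟩
  · rintro ⟨i, hi, rfl⟩
    exact (hs i hi).1

namespace Frame

variable {f g : MarkedFun} (F : Frame f) (G : Frame g)

/-! ### Levels and feet -/

open Classical in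
/-- The level of a point: orbitals are counted from the outside, starting with `1`; the fixed
points have level `0`. -/
def level (y : I) : ℕ :=
  if h : ∃ i < F.m, F.x i < y ∧ y < F.x (i + 1) then min (h.choose + 1) (F.m - h.choose) else 0

theorem level_eq {i : ℕ} (hi : i < F.m) {y : I} (h : F.x i < y) (h' : y < F.x (i + 1)) :
    F.level y = min (i + 1) (F.m - i) := by
  have hex : ∃ i < F.m, F.x i < y ∧ y < F.x (i + 1) := ⟨i, hi, h, h'⟩
  have := F.index_unique hex.choose_spec.1 hi hex.choose_spec.2 ⟨h, h'⟩
  rw [level, dif_pos hex, this]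

theorem level_eq_zero_iff {y : I} : F.level y = 0 ↔ f.map y = y := by
  constructor
  · intro h
    by_contra hne
    obtain ⟨i, hi, h1, h2⟩ := (F.move y).1 hne
    rw [F.level_eq hi h1 h2] at h
    omega
  · intro h
    rw [level, dif_neg]
    rw [← F.move]
    simpa using h

theorem level_eq_zero_of_le {y : I} (h : y ≤ F.x 0) : F.level y = 0 := by
  rw [level, dif_neg]
  rintro ⟨i, hi, h1, -⟩
  exact (h.trans (F.x_le (Nat.zero_le i) hi.le)).not_gt h1

theorem level_eq_zero_of_ge {y : I} (h : F.x F.m ≤ y) : F.level y = 0 := by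
  rw [level, dif_neg]
  rintro ⟨i, hi, -, h2⟩
  exact (h2.trans_le (F.x_le hi le_rfl)).not_ge h

theorem level_congr {y y' : I} (h : ∀ l < F.m, F.x l < y ↔ F.x l < y')
    (h' : ∀ l < F.m, y < F.x (l + 1) ↔ y' < F.x (l + 1)) : F.level y = F.level y' := by
  by_cases hex : ∃ i < F.m, F.x i < y ∧ y < F.x (i + 1)
  · obtain ⟨i, hi, h1, h2⟩ := hex
    rw [F.level_eq hi h1 h2, F.level_eq hi ((h i hi).1 h1) ((h' i hi).1 h2)]
  · rw [level, dif_neg hex, level, dif_neg]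
    rintro ⟨i, hi, h1, h2⟩
    exact hex ⟨i, hi, (h i hi).2 h1, (h' i hi).2 h2⟩

/-- The union of the outer feet: the left feet of the negative bumps and the right feet of the
positive ones. -/
def outer : Set I := {y | ∃ i < F.m, (i < F.m / 2 ∧ F.x i < y ∧ y < F.s i) ∨
  (F.m / 2 ≤ i ∧ F.t i ≤ y ∧ y < F.x (i + 1))}

/-- The union of the inner feet: the right feet of the negative bumps and the left feet of the
positive ones. -/
def inner : Set I := {y | ∃ i < F.m, (i < F.m / 2 ∧ F.t i ≤ y ∧ y < F.x (i + 1)) ∨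
  (F.m / 2 ≤ i ∧ F.x i < y ∧ y < F.s i)}

theorem outer_union_inner : F.outer ∪ F.inner = f.feet := by
  ext y
  rw [F.mem_feet_iff]
  constructor
  · rintro (⟨i, hi, h | h⟩ | ⟨i, hi, h | h⟩)
    · exact ⟨i, hi, Or.inl h.2⟩
    · exact ⟨i, hi, Or.inr h.2⟩
    · exact ⟨i, hi, Or.inr h.2⟩
    · exact ⟨i, hi, Or.inl h.2⟩
  · rintro ⟨i, hi, h | h⟩ <;> rcases lt_or_ge i (F.m / 2) with h' | h'
    · exact Or.inl ⟨i, hi, Or.inl ⟨h', h⟩⟩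
    · exact Or.inr ⟨i, hi, Or.inr ⟨h', h⟩⟩
    · exact Or.inr ⟨i, hi, Or.inl ⟨h', h⟩⟩
    · exact Or.inl ⟨i, hi, Or.inr ⟨h', h⟩⟩

theorem outer_subset : F.outer ⊆ f.feet := F.outer_union_inner ▸ Set.subset_union_left
theorem inner_subset : F.inner ⊆ f.feet := F.outer_union_inner ▸ Set.subset_union_right

theorem left_foot_subset {i : ℕ} (hi : i < F.m) {y : I} (h : F.x i < y) (h' : y < F.s i) :
    y ∈ f.feet := F.mem_feet_iff.2 ⟨i, hi, Or.inl ⟨h, h'⟩⟩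

theorem right_foot_subset {i : ℕ} (hi : i < F.m) {y : I} (h : F.t i ≤ y)
    (h' : y < F.x (i + 1)) : y ∈ f.feet := F.mem_feet_iff.2 ⟨i, hi, Or.inr ⟨h, h'⟩⟩

theorem x_lt_t {i : ℕ} (hi : i < F.m) : F.x i < F.t i := (F.x_lt_s i hi).trans (F.s_lt_t i hi)

theorem s_lt_x {i : ℕ} (hi : i < F.m) : F.s i < F.x (i + 1) :=
  (F.s_lt_t i hi).trans (F.t_lt_x i hi)

/-- A point of a foot lies in an orbital. -/
theorem mem_orbital_of_mem_feet {y : I} (h : y ∈ f.feet) :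
    ∃ i < F.m, F.x i < y ∧ y < F.x (i + 1) := by
  obtain ⟨i, hi, h | h⟩ := F.mem_feet_iff.1 h
  · exact ⟨i, hi, h.1, h.2.trans (F.s_lt_x hi)⟩
  · exact ⟨i, hi, (F.x_lt_t hi).trans_le h.1, h.2⟩

theorem one_le_level_of_mem_feet {y : I} (h : y ∈ f.feet) : 1 ≤ F.level y := by
  obtain ⟨i, hi, h1, h2⟩ := F.mem_orbital_of_mem_feet h
  rw [F.level_eq hi h1 h2]
  omega

theorem x_zero_lt_of_mem_feet {y : I} (h : y ∈ f.feet) : F.x 0 < y := by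
  obtain ⟨i, hi, h1, -⟩ := F.mem_orbital_of_mem_feet h
  exact (F.x_le (Nat.zero_le i) hi.le).trans_lt h1

theorem lt_x_of_mem_feet {y : I} (h : y ∈ f.feet) : y < F.x F.m := by
  obtain ⟨i, hi, -, h2⟩ := F.mem_orbital_of_mem_feet h
  exact h2.trans_le (F.x_le hi le_rfl)

theorem exists_right_nhd_of_mem_feet {f : MarkedFun} (F : Frame f) {y : I} (h : y ∈ f.feet) :
    ∃ q, y < q ∧ ∀ z, y < z → z < q → z ∈ f.feet := by
  obtain ⟨i, hi, h | h⟩ := F.mem_feet_iff.1 h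
  · exact ⟨_, h.2, fun z hz hz' => F.left_foot_subset hi (h.1.trans hz) hz'⟩
  · exact ⟨_, h.2, fun z hz hz' => F.right_foot_subset hi (h.1.trans hz.le) hz'⟩

/-- Every transition point of f that could change the level between y and y' has a foot of f next to
it inside the interval, and such a foot would meet the dense feet of g. -/
theorem level_eq_of_dense (hfg : Fast f g) {y y' : I} (hle : y ≤ y')
    (hd : ∀ p q, y ≤ p → p < q → q ≤ y' → ∃ z, p < z ∧ z < q ∧ z ∈ g.feet) :
    F.level y = F.level y' := by
  have no : ∀ p q, y ≤ p → p < q → q ≤ y' → ¬ ∀ z, p < z → z < q → z ∈ f.feet := by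
    intro p q h1 h2 h3 h
    obtain ⟨z, hz, hz', hz2⟩ := hd p q h1 h2 h3
    exact Set.disjoint_left.1 hfg (h z hz hz') hz2
  refine F.level_congr (fun l hl => ⟨fun h => h.trans_le hle, fun h => ?_⟩)
    (fun l hl => ⟨fun h => ?_, fun h => hle.trans_lt h⟩)
  · by_contra h'
    refine no (F.x l) (min (F.s l) y') (not_lt.1 h') (lt_min (F.x_lt_s l hl) h)
      (min_le_right _ _) fun z hz hz' => F.left_foot_subset hl hz (hz'.trans_le (min_le_left _ _))
  · by_contra h'
    refine no (max (F.t l) y) (F.x (l + 1)) (le_max_right _ _) (max_lt (F.t_lt_x l hl) h)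
      (not_lt.1 h') fun z hz hz' => F.right_foot_subset hl ((le_max_left _ _).trans hz.le) hz'

/-- The right foot of one orbital of g and the left foot of the next are separated by a single
point, so together they are dense enough to exclude transition points of f. -/
theorem level_eq_across (hfg : Fast f g) {i : ℕ} (hi : i + 1 < G.m) {y y' : I}
    (hy : G.t i ≤ y) (hyx : y < G.x (i + 1)) (hyx' : G.x (i + 1) < y') (hy' : y' < G.s (i + 1)) :
    F.level y = F.level y' := by
  refine F.level_eq_of_dense hfg (hyx.trans hyx').le fun p q hp hpq hq => ?_
  rcases lt_or_ge p (G.x (i + 1)) with h | h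
  · obtain ⟨z, hz, hz'⟩ := exists_between (lt_min hpq h)
    exact ⟨z, hz, hz'.trans_le (min_le_left _ _), G.right_foot_subset (by omega)
      (hy.trans (hp.trans hz.le)) (hz'.trans_le (min_le_right _ _))⟩
  · obtain ⟨z, hz, hz'⟩ := exists_between hpq
    exact ⟨z, hz, hz', G.left_foot_subset hi (h.trans_lt hz) ((hz'.trans_le hq).trans hy')⟩

theorem level_eq_of_left_foot (hfg : Fast f g) {i : ℕ} (hi : i < G.m) {y y' : I}
    (hle : y ≤ y') (hy : G.x i ≤ y) (hy' : y' < G.s i) : F.level y = F.level y' := by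
  refine F.level_eq_of_dense hfg hle fun p q hp hpq hq => ?_
  obtain ⟨z, hz, hz'⟩ := exists_between hpq
  exact ⟨z, hz, hz', G.left_foot_subset hi ((hy.trans hp).trans_lt hz)
    ((hz'.trans_le hq).trans hy')⟩

theorem level_eq_of_right_foot (hfg : Fast f g) {i : ℕ} (hi : i < G.m) {y y' : I}
    (hle : y ≤ y') (hy : G.t i ≤ y) (hy' : y' ≤ G.x (i + 1)) : F.level y = F.level y' := by
  refine F.level_eq_of_dense hfg hle fun p q hp hpq hq => ?_
  obtain ⟨z, hz, hz'⟩ := exists_between hpq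
  exact ⟨z, hz, hz', G.right_foot_subset hi ((hy.trans hp).trans hz.le)
    ((hz'.trans_le hq).trans_le hy')⟩

/-- Between the extreme transition points of g only transition points have level 0. Such a point has
a foot of g on its right, while a foot of f contains a right neighbourhood of each of its points. -/
theorem one_le_level_of_inside {f g : MarkedFun} (F : Frame f) (G : Frame g) (hfg : Fast f g) (hin : Inside f g) {y : I} (hy : y ∈ f.feet) :
    1 ≤ G.level y := by
  rw [F.inside_iff G] at hin
  have h1 := hin.1.trans (F.x_zero_lt_of_mem_feet hy)
  have h2 := (F.lt_x_of_mem_feet hy).trans hin.2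
  obtain ⟨i, hi, h3, h4⟩ := G.exists_index_le h1.le h2
  rcases h3.eq_or_lt with h3 | h3
  · exfalso
    obtain ⟨q, hq, hq'⟩ := F.exists_right_nhd_of_mem_feet hy
    obtain ⟨z, hz, hz'⟩ := exists_between (lt_min hq (h3 ▸ G.x_lt_s i hi))
    exact Set.disjoint_left.1 hfg (hq' z hz (hz'.trans_le (min_le_left _ _)))
      (G.left_foot_subset hi (h3 ▸ hz) (hz'.trans_le (min_le_right _ _)))
  · rw [G.level_eq hi h3 h4]
    omega

/-! ### Frames of reducts -/

theorem mem_innerOrbitals_iff {y : I} : y ∈ innerOrbitals f.map ↔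
    ∃ i, 0 < i ∧ i + 1 < F.m ∧ F.x i < y ∧ y < F.x (i + 1) := by
  constructor
  · rintro ⟨u, v, h, h1, h2, h3, h4⟩
    obtain ⟨i, hi, rfl, rfl⟩ := F.isOrbital_iff.1 h
    rw [F.isMinOrbital_iff] at h1
    rw [F.isMaxOrbital_iff] at h2
    refine ⟨i, Nat.pos_of_ne_zero ?_, ?_, h3, h4⟩
    · rintro rfl
      exact h1 ⟨rfl, rfl⟩
    · by_contra hlt
      have e : i = F.m - 1 := by omega
      exact h2 ⟨by rw [e], by rw [show i + 1 = F.m by omega]⟩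
  · rintro ⟨i, h0, hi, h1, h2⟩
    refine ⟨_, _, F.isOrbital (i := i) (by omega), ?_, ?_, h1, h2⟩
    · rw [F.isMinOrbital_iff]
      rintro ⟨h, -⟩
      have := F.x_inj (by omega) (by omega) h
      omega
    · rw [F.isMaxOrbital_iff]
      rintro ⟨h, -⟩
      have := F.x_inj (by omega) (by omega) h
      omega

/-- Indices shift by one, and (m - 2) / 2 = m / 2 - 1 keeps the signs in place. -/
theorem exists_frame_of_isReduct {f' : MarkedFun} (h : IsReduct f f') (hm : 2 < F.m) :
    ∃ F' : Frame f', F'.m = F.m - 2 ∧ (∀ i, F'.x i = F.x (i + 1)) ∧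
      (∀ i, F'.s i = F.s (i + 1)) ∧ (∀ i, F'.t i = F.t (i + 1)) := by
  rcases h with ⟨-, h1, h2, h3⟩ | ⟨h, -⟩
  swap
  · rw [F.ncard_orbitals] at h; omega
  have hin : ∀ i < F.m - 2, ∀ y, F.x (i + 1) < y → y < F.x (i + 1 + 1) → f'.map y = f.map y :=
    fun i hi y hy hy' => h1 y (F.mem_innerOrbitals_iff.2 ⟨i + 1, by omega, by omega, hy, hy'⟩)
  refine ⟨⟨F.m - 2, fun i => F.x (i + 1), fun i => F.s (i + 1), fun i => F.t (i + 1), by omega,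
    fun i hi => F.x_lt_s _ (by omega), fun i hi => F.s_lt_t _ (by omega),
    fun i hi => F.t_lt_x _ (by omega), fun y => ⟨fun hy => ?_, ?_⟩, fun i hi hi' => ?_,
    fun i hi hi' => ?_, fun y => ?_⟩, rfl, fun _ => rfl, fun _ => rfl, fun _ => rfl⟩
  · have : y ∈ innerOrbitals f.map := by
      by_contra hn
      exact hy (h2 y hn)
    obtain ⟨i, h0, hi, h4, h5⟩ := F.mem_innerOrbitals_iff.1 this
    obtain ⟨i, rfl⟩ : ∃ j, i = j + 1 := ⟨i - 1, by omega⟩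
    exact ⟨i, by omega, h4, h5⟩
  · rintro ⟨i, hi, hy, hy'⟩
    rw [hin i hi y hy hy']
    exact F.map_ne (by omega) hy hy'
  · rw [hin i hi _ (F.x_lt_t (by omega)) (F.t_lt_x _ (by omega))]
    exact F.neg _ (by omega) (by omega)
  · rw [hin i hi _ (F.x_lt_s _ (by omega)) (F.s_lt_x (by omega))]
    exact F.pos _ (by omega) (by omega)
  · rw [h3, Set.mem_inter_iff, F.marks, F.mem_innerOrbitals_iff]
    constructor
    · rintro ⟨⟨i, hi, rfl⟩, j, hj0, hj, hj1, hj2⟩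
      have := F.index_unique hi (by omega) ⟨F.x_lt_s i hi, F.s_lt_x hi⟩ ⟨hj1, hj2⟩
      subst this
      exact ⟨i - 1, by omega, by rw [Nat.sub_add_cancel hj0]⟩
    · rintro ⟨i, hi, rfl⟩
      exact ⟨⟨i + 1, by omega, rfl⟩, i + 1, by omega, by omega, F.x_lt_s _ (by omega),
        F.s_lt_x (by omega)⟩

/-- With at most two orbitals the positive one is the last, and its left foot ends at its marker. -/
theorem exists_frame_of_isReduct_small {f' : MarkedFun} (h : IsReduct f f') (hm : F.m ≤ 2) :
    ∃ F' : Frame f', F'.m = 1 ∧ F'.x 0 = F.x (F.m - 1) ∧ F'.x 1 = F.s (F.m - 1) := by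
  rcases h with ⟨h, -⟩ | ⟨-, r, v, s', hpos, hs, hrs, hsv, hmove, hpos'⟩
  · rw [F.ncard_orbitals] at h; omega
  obtain ⟨i, hi, hi', rfl, rfl⟩ := F.isPosOrbital_iff.1 hpos
  obtain rfl : i = F.m - 1 := by have := F.m_pos; omega
  obtain rfl := (F.mem_marks_iff hi).1 ⟨hs, hrs, hsv⟩
  obtain ⟨p, ⟨hp, hp1, hp2⟩, huniq⟩ := f'.existsUnique_mark _ _ hpos'.1
  refine ⟨⟨1, fun j => if j = 0 then F.x (F.m - 1) else F.s (F.m - 1), fun _ => p,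
    fun _ => f'.map p, Nat.one_pos, fun j hj => ?_, fun j _ => hpos'.2 p hp1 hp2, fun j hj => ?_,
    fun y => ?_, fun j hj hj' => ?_, fun _ _ _ => rfl, fun y => ?_⟩, rfl, rfl, rfl⟩
  · obtain rfl : j = 0 := by omega
    exact hp1
  · obtain rfl : j = 0 := by omega
    have := (f'.map.lt_iff_lt).2 hp2
    rw [hpos'.1.2.2.1] at this
    simpa using this
  · rw [hmove]
    constructor
    · exact fun h => ⟨0, Nat.one_pos, by simpa using h⟩
    · rintro ⟨j, hj, h⟩
      obtain rfl : j = 0 := by omega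
      simpa using h
  · omega
  · constructor
    · intro hy
      have := (hmove y).1 (f'.marks_subset y hy)
      exact ⟨0, Nat.one_pos, huniq y ⟨hy, this⟩⟩
    · rintro ⟨j, hj, rfl⟩
      exact hp

section Reduct

variable {F} {f' : MarkedFun} {F' : Frame f'} (hm : 2 < F.m) (h1 : F'.m = F.m - 2)
  (h2 : ∀ i, F'.x i = F.x (i + 1)) (h3 : ∀ i, F'.s i = F.s (i + 1))
  (h4 : ∀ i, F'.t i = F.t (i + 1))
include hm h1 h2

theorem level_reduct (y : I) : F'.level y = F.level y - 1 := by
  by_cases hex : ∃ i < F.m, F.x i < y ∧ y < F.x (i + 1)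
  · obtain ⟨i, hi, hy, hy'⟩ := hex
    rw [F.level_eq hi hy hy']
    by_cases h : 0 < i ∧ i + 1 < F.m
    · obtain ⟨i, rfl⟩ : ∃ j, i = j + 1 := ⟨i - 1, by omega⟩
      rw [F'.level_eq (i := i) (by omega) (by rwa [h2]) (by rwa [h2]), h1]
      omega
    · rcases Nat.eq_zero_or_pos i with rfl | h0
      · rw [F'.level_eq_zero_of_le (by rw [h2]; exact hy'.le)]
        omega
      · rw [F'.level_eq_zero_of_ge]
        · omega
        · rw [h2, h1, show F.m - 2 + 1 = i by omega]
          exact hy.le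
  · have e : F.level y = 0 := by rw [level, dif_neg hex]
    rw [e, level, dif_neg]
    rintro ⟨i, hi, hy, hy'⟩
    rw [h2] at hy hy'
    exact hex ⟨i + 1, by omega, hy, hy'⟩

include h3 h4

theorem mem_outer_reduct {y : I} (hy : y ∈ F.outer) (hl : 2 ≤ F.level y) : y ∈ F'.outer := by
  obtain ⟨i, hi, h⟩ := hy
  have hb : F.x i < y ∧ y < F.x (i + 1) := by
    rcases h with h | h
    · exact ⟨h.2.1, h.2.2.trans (F.s_lt_x hi)⟩
    · exact ⟨(F.x_lt_t hi).trans_le h.2.1, h.2.2⟩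
  rw [F.level_eq hi hb.1 hb.2] at hl
  obtain ⟨i, rfl⟩ : ∃ j, i = j + 1 := ⟨i - 1, by omega⟩
  refine ⟨i, by omega, ?_⟩
  rw [h2, h2, h3, h4, h1]
  refine h.imp (And.imp_left fun _ => by omega) (And.imp_left fun _ => by omega)

theorem mem_inner_reduct {y : I} (hy : y ∈ F.inner) (hl : 2 ≤ F.level y) : y ∈ F'.inner := by
  obtain ⟨i, hi, h⟩ := hy
  have hb : F.x i < y ∧ y < F.x (i + 1) := by
    rcases h with h | h
    · exact ⟨(F.x_lt_t hi).trans_le h.2.1, h.2.2⟩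
    · exact ⟨h.2.1, h.2.2.trans (F.s_lt_x hi)⟩
  rw [F.level_eq hi hb.1 hb.2] at hl
  obtain ⟨i, rfl⟩ : ∃ j, i = j + 1 := ⟨i - 1, by omega⟩
  refine ⟨i, by omega, ?_⟩
  rw [h2, h2, h3, h4, h1]
  refine h.imp (And.imp_left fun _ => by omega) (And.imp_left fun _ => by omega)

end Reduct

end Frame

/-! ### Standard pairs -/

/-- Standard pairs, with the number of nested inclusions recorded. -/
inductive StandardPairDepth : ℕ → MarkedFun → MarkedFun → Prop
  | left {f g : MarkedFun} : Fast f g → LeftOf f g → StandardPairDepth 0 f g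
  | inside {k : ℕ} {f g g' : MarkedFun} : Fast f g → Inside f g → IsReduct g g' →
      StandardPairDepth k g' f → StandardPairDepth (k + 1) f g

theorem StandardPair.exists_depth {f g : MarkedFun} (h : StandardPair f g) :
    ∃ k, StandardPairDepth k f g := by
  induction h with
  | left h1 h2 => exact ⟨0, .left h1 h2⟩
  | inside h1 h2 h3 _ ih =>
    obtain ⟨k, hk⟩ := ih
    exact ⟨k + 1, .inside h1 h2 h3 hk⟩

theorem StandardPairDepth.standardPair {k : ℕ} {f g : MarkedFun} (h : StandardPairDepth k f g) :
    StandardPair f g := by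
  induction h with
  | left h1 h2 => exact .left h1 h2
  | inside h1 h2 h3 _ ih => exact .inside h1 h2 h3 ih

/-- The relative position of two functions which form a standard pair of depth `k`. -/
structure Interlaced {f g : MarkedFun} (F : Frame f) (G : Frame g) (k : ℕ) : Prop where
  outer_right : ∀ y ∈ G.outer, F.level y = min (G.level y - 1) (k / 2)
  inner_right : ∀ y ∈ G.inner, F.level y = min (G.level y) (k / 2)
  outer_left : ∀ y ∈ F.outer, G.level y = min (F.level y) ((k + 1) / 2)
  inner_left : ∀ y ∈ F.inner, G.level y = min (F.level y + 1) ((k + 1) / 2)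
  le_right : k ≤ G.m
  le_left : k ≤ F.m + 1

namespace Frame

variable {f g : MarkedFun} (F : Frame f) (G : Frame g)

/-- The two extreme feet of g begin outside f, and the level with respect to f is constant along a
foot of g. -/
theorem level_eq_zero_of_outermost (hfg : Fast f g) (hin : Inside f g) {y : I}
    (hy : (G.x 0 < y ∧ y < G.s 0) ∨ (G.t (G.m - 1) ≤ y ∧ y < G.x G.m)) : F.level y = 0 := by
  have hm := G.m_pos
  rw [F.inside_iff G] at hin
  rcases hy with ⟨h, h'⟩ | ⟨h, h'⟩
  · rcases le_total y (F.x 0) with hle | hle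
    · exact F.level_eq_zero_of_le hle
    · rw [← F.level_eq_zero_of_le le_rfl]
      exact (F.level_eq_of_left_foot G hfg hm hle hin.1.le h').symm
  · rcases le_total (F.x F.m) y with hle | hle
    · exact F.level_eq_zero_of_ge hle
    · rw [← F.level_eq_zero_of_ge le_rfl]
      refine F.level_eq_of_right_foot G hfg (i := G.m - 1) (by omega) hle h ?_
      rw [Nat.sub_add_cancel hm]
      exact hin.2.le

end Frame

/-- Induction along the recursive definition: (g°, f) has depth one less, and passing to g° lowers
positive levels by one and swaps the roles of the two functions. This covers the feet of f and the
feet of g of level at least 2. An outer foot of g of level 1 has level 0 for f. An inner one is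
joined, across a transition point, to a foot of level 2, along which the level for f stays the same.
If g has at most two orbitals, all its positive levels are 1, and g° is a bump on a single foot of
g. -/
theorem StandardPairDepth.interlaced {k : ℕ} {f g : MarkedFun} (h : StandardPairDepth k f g) :
    ∀ (F : Frame f) (G : Frame g), Interlaced F G k := by
  induction h with
  | @left f g hfast hleft =>
    intro F G
    rw [F.leftOf_iff G] at hleft
    have hF : ∀ y ∈ g.feet, F.level y = 0 := fun y hy =>
      F.level_eq_zero_of_ge (hleft.trans (G.x_zero_lt_of_mem_feet hy).le)
    have hG : ∀ y ∈ f.feet, G.level y = 0 := fun y hy =>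
      G.level_eq_zero_of_le ((F.lt_x_of_mem_feet hy).le.trans hleft)
    exact ⟨fun y hy => by rw [hF y (G.outer_subset hy)]; simp,
      fun y hy => by rw [hF y (G.inner_subset hy)]; simp,
      fun y hy => by rw [hG y (F.outer_subset hy)]; simp,
      fun y hy => by rw [hG y (F.inner_subset hy)]; simp, Nat.zero_le _, Nat.zero_le _⟩
  | @inside k f g g' hfast hin hred hpair ih =>
    intro F G
    have hin' := (F.inside_iff G).1 hin
    have hGm := G.m_pos
    have houter1 : ∀ y ∈ G.outer, G.level y = 1 → F.level y = 0 := by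
      rintro y ⟨i, hi, h⟩ hl
      apply F.level_eq_zero_of_outermost G hfast hin
      rcases h with ⟨h1, h2, h3⟩ | ⟨h1, h2, h3⟩
      · rw [G.level_eq hi h2 (h3.trans (G.s_lt_x hi))] at hl
        obtain rfl : i = 0 := by omega
        exact Or.inl ⟨h2, h3⟩
      · rw [G.level_eq hi ((G.x_lt_t hi).trans_le h2) h3] at hl
        obtain rfl : i = G.m - 1 := by omega
        rw [Nat.sub_add_cancel hGm] at h3
        exact Or.inr ⟨h2, h3⟩
    by_cases hm : 2 < G.m
    · obtain ⟨G', e1, e2, e3, e4⟩ := G.exists_frame_of_isReduct hred hm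
      have H := ih G' F
      have hlev := Frame.level_reduct hm e1 e2
      refine ⟨fun y hy => ?_, fun y hy => ?_, fun y hy => ?_, fun y hy => ?_, ?_, ?_⟩
      · have h1 := G.one_le_level_of_mem_feet (G.outer_subset hy)
        rcases h1.eq_or_lt with h1 | h1
        · rw [houter1 y hy h1.symm, ← h1]; simp
        · have := H.outer_left y (Frame.mem_outer_reduct hm e1 e2 e3 e4 hy h1)
          rw [this, hlev]
      · have h1 := G.one_le_level_of_mem_feet (G.inner_subset hy)
        rcases h1.eq_or_lt with h1 | h1
        · have hbd := H.le_right
          have hbd' := H.le_left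
          obtain ⟨i, hi, ⟨h2, h3, h4⟩ | ⟨h2, h3, h4⟩⟩ := hy
          · rw [G.level_eq hi ((G.x_lt_t hi).trans_le h3) h4] at h1 ⊢
            obtain rfl : i = 0 := by omega
            obtain ⟨y', hy1, hy2⟩ := exists_between (G.x_lt_s 1 (by omega))
            have hy3 := hy2.trans (G.s_lt_x (i := 1) (by omega))
            have hlv : G'.level y' = 1 := by
              rw [hlev, G.level_eq (i := 1) (by omega) hy1 hy3]
              omega
            rw [F.level_eq_across G hfast (i := 0) (by omega) h3 h4 hy1 hy2]
            by_cases h5 : 1 < G.m / 2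
            · have hmem : y' ∈ G'.outer :=
                ⟨0, by omega, Or.inl ⟨by omega, by rwa [e2], by rwa [e3]⟩⟩
              rw [H.outer_left y' hmem, hlv]
              omega
            -- Here g has three orbitals and the neighbouring foot belongs to the middle one, which
            -- is positive. The two formulas agree because k is at most 2.
            · have hmem : y' ∈ G'.inner :=
                ⟨0, by omega, Or.inr ⟨by omega, by rwa [e2], by rwa [e3]⟩⟩
              rw [H.inner_left y' hmem, hlv]
              omega
          · rw [G.level_eq hi h3 (h4.trans (G.s_lt_x hi))] at h1 ⊢
            obtain ⟨i, rfl⟩ : ∃ j, i = j + 1 + 1 := ⟨i - 2, by omega⟩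
            obtain ⟨y', hy1, hy2⟩ := exists_between (G.t_lt_x (i + 1) (by omega))
            have hy3 := (G.x_lt_t (i := i + 1) (by omega)).trans hy1
            have hlv : G'.level y' = 1 := by
              rw [hlev, G.level_eq (i := i + 1) (by omega) hy3 hy2]
              omega
            rw [← F.level_eq_across G hfast (i := i + 1) hi hy1.le hy2 h3 h4]
            have hmem : y' ∈ G'.outer :=
              ⟨i, by omega, Or.inr ⟨by omega, by rw [e4]; exact hy1.le, by rwa [e2]⟩⟩
            rw [H.outer_left y' hmem, hlv]
            omega
        · have := H.inner_left y (Frame.mem_inner_reduct hm e1 e2 e3 e4 hy h1)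
          rw [this, hlev]
          omega
      · have h1 := F.one_le_level_of_inside G hfast hin (F.outer_subset hy)
        have h2 := F.one_le_level_of_mem_feet (F.outer_subset hy)
        have := H.outer_right y hy
        rw [hlev] at this
        omega
      · have h1 := F.one_le_level_of_inside G hfast hin (F.inner_subset hy)
        have := H.inner_right y hy
        rw [hlev] at this
        omega
      · have := H.le_left; omega
      · exact Nat.succ_le_succ H.le_right
    · obtain ⟨G', e1, e2, e3⟩ := G.exists_frame_of_isReduct_small hred (by omega)
      have H := ih G' F
      have hsub : ∀ y, G'.level y ≠ 0 → y ∈ g.feet := by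
        intro y hy
        rw [Ne, G'.level_eq_zero_iff] at hy
        obtain ⟨j, hj, h1, h2⟩ := (G'.move y).1 hy
        obtain rfl : j = 0 := by omega
        rw [e2] at h1
        rw [zero_add, e3] at h2
        exact G.left_foot_subset (by omega) h1 h2
      -- The support of g° is a foot of g and misses the feet of f; for k ≥ 2 the inductive formula
      -- would place the inner feet of f in it.
      have hk : k ≤ 1 := by
        by_contra hk
        have hmem : ∃ y, y ∈ F.inner := by
          by_cases h : 0 < F.m / 2
          · exact ⟨F.t 0, 0, F.m_pos, Or.inl ⟨h, le_rfl, F.t_lt_x 0 F.m_pos⟩⟩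
          · obtain ⟨y, hy⟩ := exists_between (F.x_lt_s 0 F.m_pos)
            exact ⟨y, 0, F.m_pos, Or.inr ⟨by omega, hy⟩⟩
        obtain ⟨y, hy⟩ := hmem
        have h1 := H.inner_right y hy
        have h2 := F.one_le_level_of_mem_feet (F.inner_subset hy)
        exact Set.disjoint_left.1 hfast (F.inner_subset hy) (hsub y (by omega))
      have hlevG : ∀ y, 1 ≤ G.level y → G.level y = 1 := by
        intro y hy
        have hne : g.map y ≠ y := fun h => by rw [G.level_eq_zero_iff.2 h] at hy; omega
        obtain ⟨i, hi, h1, h2⟩ := (G.move y).1 hne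
        rw [G.level_eq hi h1 h2]
        omega
      -- If g has one orbital, g° starts at the left end of g, hence to the left of f, and cannot
      -- lie inside f.
      have hkm : k + 1 ≤ G.m := by
        by_contra hlt
        have hm1 : G.m = 1 := by omega
        obtain rfl : k = 1 := by omega
        cases hpair with
        | inside _ hin2 _ _ =>
          have := (G'.inside_iff F).1 hin2
          rw [e2, hm1] at this
          exact this.1.not_gt hin'.1
      have hF' : k ≤ F.m := H.le_right
      refine ⟨fun y hy => ?_, fun y hy => ?_, fun y hy => ?_, fun y hy => ?_, hkm, by omega⟩
      · have h1 := hlevG y (G.one_le_level_of_mem_feet (G.outer_subset hy))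
        rw [houter1 y hy h1, h1]; simp
      · rw [hlevG y (G.one_le_level_of_mem_feet (G.inner_subset hy))]
        obtain ⟨y', hy1, hy2⟩ := exists_between (G'.x_lt_s 0 (by omega))
        have hmem : y' ∈ G'.inner := ⟨0, by omega, Or.inr ⟨by omega, hy1, hy2⟩⟩
        have hl' := H.inner_left y' hmem
        have hy3 : y' < G.s (G.m - 1) := by
          rw [← e3]; exact hy2.trans (G'.s_lt_x (i := 0) (by omega))
        rw [e2] at hy1
        rw [G'.level_eq (i := 0) (by omega) (by rwa [e2])
          (hy2.trans (G'.s_lt_x (i := 0) (by omega)))] at hl'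
        obtain ⟨i, hi, ⟨h2, h3, h4⟩ | ⟨h2, h3, h4⟩⟩ := hy
        · obtain rfl : i = 0 := by omega
          have e : G.m - 1 = 0 + 1 := by omega
          rw [e] at hy1 hy3
          rw [F.level_eq_across G hfast (i := 0) (by omega) h3 h4 hy1 hy3, hl']
          omega
        · obtain rfl : i = G.m - 1 := by omega
          have : F.level y = F.level y' := by
            rcases le_total y y' with hle | hle
            · exact F.level_eq_of_left_foot G hfast hi hle h3.le hy3
            · exact (F.level_eq_of_left_foot G hfast hi hle hy1.le h4).symm
          rw [this, hl']
          omega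
      · rw [hlevG y (F.one_le_level_of_inside G hfast hin (F.outer_subset hy))]
        have := F.one_le_level_of_mem_feet (F.outer_subset hy)
        omega
      · rw [hlevG y (F.one_le_level_of_inside G hfast hin (F.inner_subset hy))]
        omega

/-! ### The oscillation of a standard pair -/

open Classical in
/-- The indices of the orbitals of `g` that contain a transition point of `f`. -/
def oscIndices {f g : MarkedFun} (F : Frame f) (G : Frame g) : Finset ℕ :=
  (Finset.range G.m).filter fun i => ∃ l ≤ F.m, G.x i < F.x l ∧ F.x l < G.x (i + 1)

theorem mem_oscIndices {f g : MarkedFun} {F : Frame f} {G : Frame g} {i : ℕ} :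
    i ∈ oscIndices F G ↔ i < G.m ∧ ∃ l ≤ F.m, G.x i < F.x l ∧ F.x l < G.x (i + 1) := by
  simp [oscIndices]

theorem Frame.isTransitionPoint_iff {f : MarkedFun} (F : Frame f) {y : I} :
    IsTransitionPoint f.map y ↔ ∃ l ≤ F.m, y = F.x l := by
  constructor
  · rintro ⟨u, v, h, h'⟩
    obtain ⟨i, hi, rfl, rfl⟩ := F.isOrbital_iff.1 h
    rcases h' with rfl | rfl
    · exact ⟨i, hi.le, rfl⟩
    · exact ⟨i + 1, hi, rfl⟩
  · rintro ⟨l, hl, rfl⟩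
    rcases hl.eq_or_lt with rfl | hl
    · refine ⟨_, _, F.isOrbital (i := F.m - 1) (by have := F.m_pos; omega), Or.inr ?_⟩
      rw [Nat.sub_add_cancel F.m_pos]
    · exact ⟨_, _, F.isOrbital hl, Or.inl rfl⟩

theorem osc_eq_card {f g : MarkedFun} (F : Frame f) (G : Frame g) :
    osc f g = (oscIndices F G).card := by
  rw [osc, ← Set.ncard_coe_finset]
  have : {p : I × I | IsOrbital g.map p.1 p.2 ∧
      ∃ x, IsTransitionPoint f.map x ∧ p.1 < x ∧ x < p.2} =
      (fun i => (G.x i, G.x (i + 1))) '' (oscIndices F G : Set ℕ) := by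
    ext ⟨u, v⟩
    simp only [Set.mem_ofPred_eq, Set.mem_image, Finset.mem_coe, mem_oscIndices, Prod.mk.injEq,
      G.isOrbital_iff, F.isTransitionPoint_iff]
    constructor
    · rintro ⟨⟨i, hi, rfl, rfl⟩, _, ⟨l, hl, rfl⟩, h⟩
      exact ⟨i, ⟨hi, l, hl, h⟩, rfl, rfl⟩
    · rintro ⟨i, ⟨hi, l, hl, h⟩, rfl, rfl⟩
      exact ⟨⟨i, hi, rfl, rfl⟩, _, ⟨l, hl, rfl⟩, h⟩
  rw [this, Set.InjOn.ncard_image]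
  intro i hi j hj h
  rw [Finset.mem_coe, mem_oscIndices] at hi hj
  exact G.x_inj hi.1.le hj.1.le (congrArg Prod.fst h)

theorem card_oscIndices_zero {f g : MarkedFun} (F : Frame f) (G : Frame g)
    (h : F.x F.m ≤ G.x 0) : (oscIndices F G).card = 0 := by
  rw [Finset.card_eq_zero, Finset.eq_empty_iff_forall_notMem]
  intro i hi
  obtain ⟨hi, l, hl, h1, -⟩ := mem_oscIndices.1 hi
  exact h1.not_ge ((F.x_le hl le_rfl).trans (h.trans (G.x_le (Nat.zero_le i) hi.le)))

theorem card_oscIndices_one {f g : MarkedFun} (F : Frame f) (G : Frame g)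
    (h : G.x (G.m - 1) < F.x 0) (h' : F.x F.m < G.x G.m) : (oscIndices F G).card = 1 := by
  have hm := G.m_pos
  rw [Finset.card_eq_one]
  refine ⟨G.m - 1, ?_⟩
  ext i
  rw [mem_oscIndices, Finset.mem_singleton]
  constructor
  · rintro ⟨hi, l, hl, -, h2⟩
    by_contra hne
    exact h2.not_ge ((G.x_le (by omega) (by omega)).trans
      (h.le.trans (F.x_le (Nat.zero_le l) hl)))
  · rintro rfl
    refine ⟨by omega, 0, Nat.zero_le _, h, ?_⟩
    rw [Nat.sub_add_cancel hm]
    exact (F.x_le (Nat.zero_le _) le_rfl).trans_lt h'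

theorem card_oscIndices_two {f g : MarkedFun} (F : Frame f) (G : Frame g) (hm : G.m = 2)
    (h0 : G.x 0 < F.x 0) (h1 : F.x 0 < G.x 1) (h2 : G.x 1 < F.x F.m) (h3 : F.x F.m < G.x 2) :
    (oscIndices F G).card = 2 := by
  have : oscIndices F G = Finset.range 2 := by
    ext i
    rw [mem_oscIndices, Finset.mem_range, hm]
    refine ⟨fun h => h.1, fun h => ⟨h, ?_⟩⟩
    obtain rfl | rfl : i = 0 ∨ i = 1 := by omega
    · exact ⟨0, Nat.zero_le _, h0, h1⟩
    · exact ⟨F.m, le_rfl, h2, h3⟩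
  rw [this, Finset.card_range]

/-- The first orbital of g contains the left end of f and the last one its right end. Every other
orbital of g is an orbital of g°, where only the inner transition points of f matter. -/
theorem card_oscIndices_add_two {f g f' g' : MarkedFun} (F : Frame f) (G : Frame g)
    (F' : Frame f') (G' : Frame g') (hfast : Fast f g) (hm : 2 < G.m) (e1 : G'.m = G.m - 2)
    (e2 : ∀ i, G'.x i = G.x (i + 1)) (h0 : G.x 0 < F.x 0) (h1 : F.x 0 < G'.x 0)
    (h2 : G'.x G'.m < F.x F.m) (h3 : F.x F.m < G.x G.m)
    (hF' : (2 < F.m ∧ F'.m = F.m - 2 ∧ ∀ i, F'.x i = F.x (i + 1)) ∨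
      (F.m ≤ 2 ∧ F'.m = 1 ∧ F'.x 0 = F.x (F.m - 1) ∧ F'.x 1 = F.s (F.m - 1))) :
    (oscIndices F G).card = (oscIndices F' G').card + 2 := by
  rw [e2] at h1 h2
  rw [e1, show G.m - 2 + 1 = G.m - 1 by omega] at h2
  have hFm := F.m_pos
  have key : oscIndices F G =
      insert 0 (insert (G.m - 1) ((oscIndices F' G').image (· + 1))) := by
    ext i
    simp only [mem_oscIndices, Finset.mem_insert, Finset.mem_image]
    constructor
    · rintro ⟨hi, l, hl, h4, h5⟩
      by_cases hi0 : i = 0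
      · exact Or.inl hi0
      by_cases hi1 : i = G.m - 1
      · exact Or.inr (Or.inl hi1)
      refine Or.inr (Or.inr ⟨i - 1, ⟨by omega, ?_⟩, by omega⟩)
      rw [e2, e2, Nat.sub_add_cancel (by omega)]
      have hl0 : l ≠ 0 := by
        rintro rfl
        exact h4.not_ge (h1.le.trans (G.x_le (by omega) hi.le))
      have hlm : l ≠ F.m := by
        rintro rfl
        exact h5.not_ge ((G.x_le (by omega) (by omega)).trans h2.le)
      rcases hF' with ⟨-, e5, e6⟩ | ⟨h6, e5, e6, -⟩
      · refine ⟨l - 1, by omega, ?_⟩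
        rw [e6, Nat.sub_add_cancel (by omega)]
        exact ⟨h4, h5⟩
      · refine ⟨0, by omega, ?_⟩
        rw [e6, show F.m - 1 = l by omega]
        exact ⟨h4, h5⟩
    · rintro (rfl | rfl | ⟨i, ⟨hi, l, hl, h4, h5⟩, rfl⟩)
      · exact ⟨by omega, 0, Nat.zero_le _, h0, h1⟩
      · refine ⟨by omega, F.m, le_rfl, h2, ?_⟩
        rwa [Nat.sub_add_cancel (by omega)]
      · rw [e2] at h4 h5
        refine ⟨by omega, ?_⟩
        rcases hF' with ⟨h6, e5, e6⟩ | ⟨h6, e5, e6, e7⟩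
        · rw [e6] at h4 h5
          exact ⟨l + 1, by omega, h4, h5⟩
        · refine ⟨F.m - 1, by omega, ?_⟩
          obtain rfl | rfl : l = 0 ∨ l = 1 := by omega
          · rw [e6] at h4 h5
            exact ⟨h4, h5⟩
          · rw [e7] at h4 h5
            -- The right end of f° is a marker of f and not a transition point. If the transition
            -- point to its left were not in the same orbital of g, that orbital would begin within
            -- the left foot of f, and two left feet would overlap.
            refine ⟨?_, (F.x_lt_s _ (by omega)).trans h5⟩
            by_contra hle
            obtain ⟨z, hz, hz'⟩ := exists_between (lt_min h4 (G.x_lt_s (i + 1) (by omega)))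
            exact Set.disjoint_left.1 hfast
              (F.left_foot_subset (i := F.m - 1) (by omega) ((not_lt.1 hle).trans_lt hz)
                (hz'.trans_le (min_le_left _ _)))
              (G.left_foot_subset (by omega) hz (hz'.trans_le (min_le_right _ _)))
  rw [key, Finset.card_insert_of_notMem, Finset.card_insert_of_notMem, Finset.card_image_of_injective]
  · exact add_left_injective 1
  · simp only [Finset.mem_image, mem_oscIndices, not_exists, not_and]
    intro i hi
    omega
  · simp only [Finset.mem_insert, Finset.mem_image, not_or, not_exists, not_and]
    exact ⟨by omega, fun i _ => by omega⟩

/-- At depth one g° lies to the left of f, which leaves only the last orbital of g. Disjointness of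
feet excludes a common left end. -/
theorem StandardPairDepth.x_lt_of_one {f g : MarkedFun} (h : StandardPairDepth 1 f g)
    (F : Frame f) (G : Frame g) : G.x (G.m - 1) < F.x 0 ∧ F.x F.m < G.x G.m := by
  have hm := G.m_pos
  cases h with
  | inside hfast hin hred hpair =>
    refine ⟨?_, ((F.inside_iff G).1 hin).2⟩
    cases hpair with
    | left hfast' h =>
      by_cases h2 : 2 < G.m
      · obtain ⟨G', e1, e2, -, -⟩ := G.exists_frame_of_isReduct hred h2
        have h := (G'.leftOf_iff F).1 h
        rw [e2, e1, show G.m - 2 + 1 = G.m - 1 by omega] at h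
        refine lt_of_le_of_ne h fun heq => ?_
        obtain ⟨z, hz, hz'⟩ := exists_between
          (lt_min (F.x_lt_s 0 F.m_pos) (heq ▸ G.x_lt_s (G.m - 1) (by omega)))
        exact Set.disjoint_left.1 hfast
          (F.left_foot_subset F.m_pos hz (hz'.trans_le (min_le_left _ _)))
          (G.left_foot_subset (i := G.m - 1) (by omega) (heq ▸ hz)
            (hz'.trans_le (min_le_right _ _)))
      · obtain ⟨G', e1, e2, e3⟩ := G.exists_frame_of_isReduct_small hred (by omega)
        have h := (G'.leftOf_iff F).1 h
        rw [e1, e3] at h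
        exact (G.x_lt_s _ (by omega)).trans_le h

/-- Induction in steps of two: two unfoldings of the definition strip a layer from g and a layer
from f and account for two orbitals. -/
theorem StandardPairDepth.card_oscIndices (k : ℕ) : ∀ {f g : MarkedFun},
    StandardPairDepth k f g → ∀ (F : Frame f) (G : Frame g), (oscIndices F G).card = k := by
  induction k using Nat.strong_induction_on with
  | _ k ih =>
    intro f g h F G
    have hle := (h.interlaced F G).le_right
    have hm := G.m_pos
    cases h with
    | left _ h => exact card_oscIndices_zero F G ((F.leftOf_iff G).1 h)
    | @inside k _ _ g' hfast hin hred hpair =>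
      have hin' := (F.inside_iff G).1 hin
      cases hpair with
      | left hfast' h =>
        exact card_oscIndices_one F G
          (StandardPairDepth.x_lt_of_one (.inside hfast hin hred (.left hfast' h)) F G).1 hin'.2
      | @inside k _ _ f' hfast' hinGF hredF hpair' =>
        by_cases h2 : 2 < G.m
        · obtain ⟨G', e1, e2, -, -⟩ := G.exists_frame_of_isReduct hred h2
          have hin2 := (G'.inside_iff F).1 hinGF
          have hfin : ∃ F' : Frame f', (2 < F.m ∧ F'.m = F.m - 2 ∧ ∀ i, F'.x i = F.x (i + 1)) ∨
              (F.m ≤ 2 ∧ F'.m = 1 ∧ F'.x 0 = F.x (F.m - 1) ∧ F'.x 1 = F.s (F.m - 1)) := by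
            by_cases h3 : 2 < F.m
            · obtain ⟨F', e3, e4, -, -⟩ := F.exists_frame_of_isReduct hredF h3
              exact ⟨F', Or.inl ⟨h3, e3, e4⟩⟩
            · obtain ⟨F', e3, e4, e5⟩ := F.exists_frame_of_isReduct_small hredF (by omega)
              exact ⟨F', Or.inr ⟨by omega, e3, e4, e5⟩⟩
          obtain ⟨F', hF'⟩ := hfin
          rw [card_oscIndices_add_two F G F' G' hfast h2 e1 e2 hin'.1 hin2.1 hin2.2 hin'.2 hF',
            ih k (by omega) hpair' F' G']
        · obtain ⟨G', e1, e2, e3⟩ := G.exists_frame_of_isReduct_small hred (by omega)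
          have hin2 := (G'.inside_iff F).1 hinGF
          have hm2 : G.m = 2 := by omega
          obtain rfl : k = 0 := by omega
          rw [e1, e2, e3, hm2] at hin2
          rw [hm2] at hin'
          exact card_oscIndices_two F G hm2 hin'.1 hin2.1
            ((G.x_lt_s 1 (by omega)).trans hin2.2) hin'.2

theorem StandardPairDepth.osc_eq {k : ℕ} {f g : MarkedFun} (h : StandardPairDepth k f g)
    (F : Frame f) (G : Frame g) : osc f g = k := by
  rw [osc_eq_card F G, h.card_oscIndices]

/-- This makes the level formulas depend on the signature only. -/
theorem StandardPair.interlaced {f g : MarkedFun} (h : StandardPair f g) (F : Frame f)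
    (G : Frame g) : Interlaced F G (osc f g) := by
  obtain ⟨k, hk⟩ := h.exists_depth
  rw [hk.osc_eq F G]
  exact hk.interlaced F G

theorem StandardPair.fast {f g : MarkedFun} (h : StandardPair f g) : Fast f g := by
  cases h <;> assumption

/-! ### Words and the symbolic dynamics of a signature -/

/-- A generator (`true`) or the inverse of a generator (`false`). -/
abbrev Letter (n : ℕ) := Fin n × Bool

namespace Letter

variable {n : ℕ}

/-- The inverse letter. -/
def inv (l : Letter n) : Letter n := (l.1, !l.2)

@[simp] theorem inv_fst (l : Letter n) : l.inv.1 = l.1 := rfl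
@[simp] theorem inv_inv (l : Letter n) : l.inv.inv = l := by simp [inv]
theorem inv_ne (l : Letter n) : l.inv ≠ l := fun h => by
  have := congrArg Prod.snd h
  simp [inv] at this

theorem eq_or_eq_inv {a b : Letter n} (h : a.1 = b.1) : a = b ∨ a = b.inv := by
  obtain ⟨i, x⟩ := a
  obtain ⟨j, y⟩ := b
  obtain rfl : i = j := h
  cases x <;> cases y <;> simp [inv]

end Letter

/-- The depth of a foot (outer or inner) of an orbital of level `m`. -/
def depth (e : Bool) (m : ℕ) : ℕ := if e then m - 1 else m

/-- The level, with respect to the `i`-th function, of the feet of depth `d` of the `j`-th one. -/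
def crossLevel (A : ℕ → ℕ → ℕ) (j d i : ℕ) : ℕ :=
  if i < j then min d (A i j / 2) else min (d + 1) ((A j i + 1) / 2)

/-- The levels of the points of the feet of type `l` in the orbitals of level `m`. -/
def footLevels {n : ℕ} (A : ℕ → ℕ → ℕ) (l : Letter n) (m : ℕ) (i : Fin n) : ℕ :=
  if i = l.1 then m else crossLevel A l.1 (depth l.2 m) i

@[simp] theorem footLevels_self {n : ℕ} (A : ℕ → ℕ → ℕ) (l : Letter n) (m : ℕ) :
    footLevels A l m l.1 = m := if_pos rfl

/-- A starting point of symbolic histories: the levels of a point and the type of the foot which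
contains it. -/
structure SymBase (n : ℕ) where
  vec : Fin n → ℕ
  last : Option (Letter n)

/-- The starting point given by a foot. -/
def footBase {n : ℕ} (A : ℕ → ℕ → ℕ) (l : Letter n) (m : ℕ) : SymBase n :=
  ⟨footLevels A l m, some l⟩

namespace SymBase

variable {n : ℕ} (A : ℕ → ℕ → ℕ) (b : SymBase n)

/-- The levels of the point with history `u`. -/
def topVec : List (Letter n) → Fin n → ℕ
  | [] => b.vec
  | l :: u => footLevels A l (topVec u l.1)

/-- The type of the foot containing the point with history `u`. -/
def top : List (Letter n) → Option (Letter n)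
  | [] => b.last
  | l :: _ => some l

/-- Possible histories. -/
def Valid : List (Letter n) → Prop
  | [] => True
  | l :: u => Valid u ∧ b.topVec A u l.1 ≠ 0 ∧ b.top u ≠ some l.inv

open Classical in
/-- The action of a letter on histories. -/
def step (l : Letter n) (u : List (Letter n)) : List (Letter n) :=
  if b.top u = some l.inv then u.tail else if b.topVec A u l.1 = 0 then u else l :: u

/-- The action of a word on histories. -/
def run (w u : List (Letter n)) : List (Letter n) := w.foldr (b.step A) u

theorem length_step_le (l : Letter n) (u : List (Letter n)) :
    u.length ≤ (b.step A l u).length + 1 := by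
  unfold step
  split_ifs <;> simp <;> omega

theorem length_run_le (w u : List (Letter n)) :
    u.length ≤ (b.run A w u).length + w.length := by
  induction w with
  | nil => simp [run]
  | cons l w ih =>
    have := b.length_step_le A l (b.run A w u)
    simp only [run, List.foldr_cons, List.length_cons] at *
    omega

end SymBase

/-! ### Ping-pong systems -/

/-- The dynamics of a standard generating set, in terms of the levels of points and of the feet;
`(j, true)` stands for the feet into which the `j`-th function moves the points of its support,
`(j, false)` for those into which its inverse does. -/
structure PingPong (n : ℕ) (A : ℕ → ℕ → ℕ) (X : Type*) [LinearOrder X] where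
  gen : Fin n → X ≃o X
  level : Fin n → X → ℕ
  foot : Letter n → Set X
  disjoint : ∀ l l', l ≠ l' → Disjoint (foot l) (foot l')
  level_eq_zero : ∀ j x, level j x = 0 → gen j x = x
  level_ne_zero : ∀ l : Letter n, ∀ x ∈ foot l, level l.1 x ≠ 0
  push : ∀ (l : Letter n) (x : X), level l.1 x ≠ 0 → x ∉ foot (Letter.inv l) →
    (if l.2 then gen l.1 else (gen l.1)⁻¹) x ∈ foot l
  pop : ∀ (l : Letter n) (x : X), x ∈ foot (Letter.inv l) →
    (if l.2 then gen l.1 else (gen l.1)⁻¹) x ∉ foot l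
  level_map : ∀ (l : Letter n) (x : X), level l.1 ((if l.2 then gen l.1 else (gen l.1)⁻¹) x) = level l.1 x
  level_foot : ∀ l : Letter n, ∀ x ∈ foot l, ∀ i, level i x = footLevels A l (level l.1 x) i

namespace PingPong

variable {n : ℕ} {A : ℕ → ℕ → ℕ} {X : Type*} [LinearOrder X] (S : PingPong n A X)

/-- The map given by a letter. -/
def letter (l : Letter n) : X ≃o X := if l.2 then S.gen l.1 else (S.gen l.1)⁻¹

theorem letter_inv (l : Letter n) : S.letter l.inv = (S.letter l)⁻¹ := by
  obtain ⟨i, e⟩ := l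
  cases e <;> simp [letter, Letter.inv]

theorem letter_inv_apply (l : Letter n) (x : X) : S.letter l (S.letter l.inv x) = x := by
  rw [letter_inv]; simp [← RelIso.mul_apply]

theorem letter_apply_of_level {l : Letter n} {x : X} (h : S.level l.1 x = 0) :
    S.letter l x = x := by
  have h := S.level_eq_zero _ _ h
  unfold letter
  split_ifs
  · exact h
  · exact (S.gen l.1).injective (by rw [h]; simp [← RelIso.mul_apply])

/-- The map given by a word. -/
def ev (w : List (Letter n)) : X ≃o X := (w.map S.letter).prod

@[simp] theorem ev_nil (x : X) : S.ev [] x = x := rfl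
@[simp] theorem ev_cons (l : Letter n) (w : List (Letter n)) (x : X) :
    S.ev (l :: w) x = S.letter l (S.ev w x) := by simp [ev, RelIso.mul_apply]
theorem ev_append (w w' : List (Letter n)) (x : X) : S.ev (w ++ w') x = S.ev w (S.ev w' x) := by
  simp [ev, RelIso.mul_apply]

/-- `u` is a history of the point `S.ev u y`, starting from the point `y`. -/
def Good : List (Letter n) → X → Prop
  | [], _ => True
  | l :: u, y => Good u y ∧ S.level l.1 (S.ev u y) ≠ 0 ∧ S.ev u y ∉ S.foot l.inv

theorem Good.mem_foot {l : Letter n} {u : List (Letter n)} {y : X} (h : S.Good (l :: u) y) :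
    S.ev (l :: u) y ∈ S.foot l := by
  rw [ev_cons]
  exact S.push l _ h.2.1 h.2.2

theorem good_append {u v : List (Letter n)} {y : X} :
    S.Good (u ++ v) y ↔ S.Good v y ∧ S.Good u (S.ev v y) := by
  induction u with
  | nil => simp [Good]
  | cons l u ih => simp only [List.cons_append, Good, ih, ev_append, and_assoc]

/-- Feet of different types are disjoint, so the newest letter can be read off from the point and
undone; a point outside all feet ends the process. -/
theorem good_injective {y : X} (hy : ∀ l, y ∉ S.foot l) : ∀ {u u' : List (Letter n)},
    S.Good u y → S.Good u' y → S.ev u y = S.ev u' y → u = u'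
  | [], [], _, _, _ => rfl
  | [], l :: u, _, h', h => absurd (Good.mem_foot S h') (by rw [← h]; exact hy l)
  | l :: u, [], h', _, h => absurd (Good.mem_foot S h') (by rw [h]; exact hy l)
  | l :: u, l' :: u', hu, hu', h => by
    have hl : l = l' := by
      by_contra hne
      exact Set.disjoint_left.1 (S.disjoint _ _ hne) (Good.mem_foot S hu)
        (h ▸ Good.mem_foot S hu')
    subst hl
    rw [ev_cons, ev_cons] at h
    rw [good_injective hy hu.1 hu'.1 ((S.letter l).injective h)]

/-- The point `z` realizes the starting point `b`. -/
structure Realizes (b : SymBase n) (z : X) : Prop where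
  level : ∀ i, S.level i z = b.vec i
  foot : ∀ l, z ∈ S.foot l ↔ b.last = some l

theorem realizes_footBase {l : Letter n} {z : X} (hz : z ∈ S.foot l) :
    S.Realizes (footBase A l (S.level l.1 z)) z := by
  refine ⟨S.level_foot l z hz, fun l' => ⟨fun h => ?_, fun h => ?_⟩⟩
  · by_contra hne
    exact Set.disjoint_left.1 (S.disjoint l l' fun e => hne (e ▸ rfl)) hz h
  · obtain rfl : l = l' := Option.some.inj h
    exact hz

theorem realizes_free {z : X} (hz : ∀ l, z ∉ S.foot l) :
    S.Realizes ⟨fun i => S.level i z, none⟩ z :=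
  ⟨fun _ => rfl, fun l => by simp [hz l]⟩

variable {S}

/-- The newest letter determines the levels from the level at the moment of the push, which that
letter leaves unchanged. -/
theorem Realizes.ev {b : SymBase n} {z : X} (hb : S.Realizes b z) {u : List (Letter n)}
    (hu : S.Good u z) : (∀ i, S.level i (S.ev u z) = b.topVec A u i) ∧
      ∀ l, S.ev u z ∈ S.foot l ↔ b.top u = some l := by
  induction u with
  | nil => exact ⟨hb.level, hb.foot⟩
  | cons l u ih =>
    obtain ⟨ih1, -⟩ := ih hu.1
    have hmem := Good.mem_foot S hu
    refine ⟨fun i => ?_, fun l' => ⟨fun h => ?_, fun h => ?_⟩⟩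
    · rw [S.level_foot l _ hmem, ev_cons]
      have := S.level_map l (S.ev u z)
      rw [letter, this, ih1]
      rfl
    · by_contra hne
      exact Set.disjoint_left.1 (S.disjoint l l' fun e => hne (e ▸ rfl)) hmem h
    · obtain rfl : l = l' := Option.some.inj h
      exact hmem

theorem Realizes.good_iff {b : SymBase n} {z : X} (hb : S.Realizes b z) (u : List (Letter n)) :
    S.Good u z ↔ b.Valid A u := by
  induction u with
  | nil => exact Iff.rfl
  | cons l u ih =>
    simp only [Good, SymBase.Valid, ih]
    refine and_congr_right fun h => ?_
    obtain ⟨h1, h2⟩ := hb.ev (ih.2 h)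
    rw [h1, h2]

/-- A cancellation at an empty history would need letters older than the starting point, where the
symbolic step returns a default. The hypothesis `hne` excludes this. -/
theorem Realizes.step {b : SymBase n} {z : X} (hb : S.Realizes b z) {u : List (Letter n)}
    (hu : S.Good u z) (l : Letter n) (hne : u ≠ [] ∨ b.last = none) :
    S.Good (b.step A l u) z ∧ S.ev (b.step A l u) z = S.letter l (S.ev u z) := by
  obtain ⟨h1, h2⟩ := hb.ev hu
  unfold SymBase.step
  split_ifs with h3 h4
  · cases u with
    | nil =>
      rcases hne with hne | hne
      · exact absurd rfl hne
      · rw [SymBase.top, hne] at h3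
        cases h3
    | cons l' u =>
      obtain rfl : l' = l.inv := Option.some.inj h3
      exact ⟨hu.1, by rw [List.tail_cons, ev_cons, letter_inv_apply]⟩
  · exact ⟨hu, by rw [S.letter_apply_of_level (by rw [h1, h4])]⟩
  · exact ⟨⟨hu, by rwa [h1], by rwa [h2]⟩, ev_cons _ _ _ _⟩

/-- A letter shortens a history by at most one, so a history as long as the word is never exhausted
before the last step. -/
theorem Realizes.run {b : SymBase n} {z : X} (hb : S.Realizes b z) {u : List (Letter n)}
    (hu : S.Good u z) (w : List (Letter n)) (hne : w.length ≤ u.length ∨ b.last = none) :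
    S.Good (b.run A w u) z ∧ S.ev (b.run A w u) z = S.ev w (S.ev u z) := by
  induction w with
  | nil => exact ⟨hu, rfl⟩
  | cons l w ih =>
    obtain ⟨h1, h2⟩ := ih (hne.imp_left fun h => by simp at h; omega)
    have := hb.step h1 l (hne.imp_left fun h h' => by
      have := b.length_run_le A w u
      rw [h'] at this
      simp at h this
      omega)
    exact ⟨this.1, by rw [ev_cons, ← h2]; exact this.2⟩

variable (S)

/-- Undo the letter of the foot containing the point, repeatedly, until N letters are found or a
point outside all feet is reached. -/
theorem exists_history (N : ℕ) (x : X) : ∃ u y, S.Good u y ∧ S.ev u y = x ∧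
    (u.length = N ∨ ∀ l, y ∉ S.foot l) := by
  induction N generalizing x with
  | zero => exact ⟨[], x, trivial, rfl, Or.inl rfl⟩
  | succ N ih =>
    by_cases hx : ∃ l, x ∈ S.foot l
    · obtain ⟨l, hl⟩ := hx
      obtain ⟨u, y, hu, hy, h⟩ := ih (S.letter l.inv x)
      refine ⟨l :: u, y, ⟨hu, ?_, ?_⟩, ?_, h.imp_left fun h => by simp [h]⟩
      · rw [hy]
        have := S.level_map l.inv x
        rw [letter]
        rw [Letter.inv_fst] at this
        rw [Letter.inv_fst, this]
        exact S.level_ne_zero l x hl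
      · rw [hy]
        exact S.pop l.inv x (by rwa [Letter.inv_inv])
      · rw [ev_cons, hy, letter_inv_apply]
    · push Not at hx
      exact ⟨[], x, trivial, rfl, Or.inr hx⟩

end PingPong

/-- The word `w` moves a symbolic history which is at least as long as `w`. -/
def SymMoves {n : ℕ} (A : ℕ → ℕ → ℕ) (w : List (Letter n)) (l : Letter n) (m : ℕ) : Prop :=
  ∃ u, (footBase A l m).Valid A u ∧ w.length ≤ u.length ∧ (footBase A l m).run A w u ≠ u

namespace PingPong

variable {n : ℕ} {A : ℕ → ℕ → ℕ} {X : Type*} [LinearOrder X] (S : PingPong n A X)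

/-- The oldest letter is spent on a foot as starting point; the remaining history is still as long
as the word. -/
theorem symMoves_of_good {w u : List (Letter n)} {y : X} (hu : S.Good u y)
    (hlen : w.length + 1 ≤ u.length) (hmove : S.ev w (S.ev u y) ≠ S.ev u y) :
    ∃ l m, m ≠ 0 ∧ SymMoves A w l m := by
  obtain ⟨v, q, rfl⟩ := List.eq_nil_or_concat' u |>.resolve_left (by rintro rfl; simp at hlen)
  rw [good_append] at hu
  have hq := Good.mem_foot S hu.1
  have hb := S.realizes_footBase hq
  refine ⟨q, S.level q.1 (S.ev [q] y), S.level_ne_zero _ _ hq, v, (hb.good_iff v).1 hu.2,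
    by simp at hlen; omega, fun h => hmove ?_⟩
  have := (hb.run hu.2 w (Or.inl (by simp at hlen; omega))).2
  rw [ev_append, ← this, h]

theorem iterate_injective {x : X} {h : X ≃o X} (hx : h x ≠ x) :
    Function.Injective fun k : ℕ => h^[k] x := by
  rcases lt_or_gt_of_ne hx with hlt | hlt
  · exact (h.strictMono.strictAnti_iterate_of_map_lt hlt).injective
  · exact (h.strictMono.strictMono_iterate_of_lt_map hlt).injective

/-- If the history of x can be traced far enough, it is moved itself. Otherwise x comes from a point
outside all feet. Its iterates under w are distinct by monotonicity, hence so are their histories,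
and only finitely many histories are short. Some iterate therefore has a long history, and w moves
it as it moves x. -/
theorem exists_symMoves {w : List (Letter n)} {x : X} (hx : S.ev w x ≠ x) :
    ∃ l m, m ≠ 0 ∧ SymMoves A w l m := by
  obtain ⟨u, y, hu, rfl, hlen | hy⟩ := S.exists_history (w.length + 1) x
  · exact S.symMoves_of_good hu hlen.ge hx
  · set b : SymBase n := ⟨fun i => S.level i y, none⟩ with hb
    have hr := S.realizes_free hy
    set U : ℕ → List (Letter n) := fun k => (b.run A w)^[k] u with hU
    have key : ∀ k, S.Good (U k) y ∧ S.ev (U k) y = (S.ev w)^[k] (S.ev u y) := by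
      intro k
      induction k with
      | zero => exact ⟨hu, rfl⟩
      | succ k ih =>
        have := hr.run ih.1 w (Or.inr rfl)
        rw [Function.iterate_succ_apply', ← ih.2]
        have e : U (k + 1) = b.run A w (U k) := Function.iterate_succ_apply' _ _ _
        rw [e]
        exact this
    have hinj : Function.Injective U := fun k k' h => by
      refine iterate_injective hx ?_
      simp only
      rw [← (key k).2, ← (key k').2, h]
    have hfin : (Set.univ : Set ℕ).Infinite := Set.infinite_univ
    obtain ⟨k, hk⟩ : ∃ k, w.length + 1 ≤ (U k).length := by
      by_contra hcon
      push Not at hcon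
      refine Set.infinite_range_of_injective hinj
        ((List.finite_length_lt (Letter n) (w.length + 1)).subset ?_)
      rintro _ ⟨k, rfl⟩
      exact hcon k
    refine S.symMoves_of_good (key k).1 hk ?_
    rw [(key k).2, ← Function.iterate_succ_apply' (S.ev w), Function.iterate_succ_apply]
    exact fun h => hx (((S.ev w).injective.iterate k) h)

/-- Points with a finite history in a foot of type `l` and level `m`. -/
def HasFinitePoint (l : Letter n) (m : ℕ) : Prop :=
  ∃ v y, S.Good (l :: v) y ∧ (∀ l', y ∉ S.foot l') ∧ S.level l.1 (S.ev (l :: v) y) = m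

/-- Continue the finite history of the foot by the symbolic one. Histories from a point outside all
feet are determined by the point reached, so a change of history is a change of point. -/
theorem ev_ne_one_of_symMoves {w : List (Letter n)} {l : Letter n} {m : ℕ}
    (h : SymMoves A w l m) (hf : S.HasFinitePoint l m) : S.ev w ≠ 1 := by
  obtain ⟨v, y, hv, hy, hm⟩ := hf
  obtain ⟨u, hu, hlen, hne⟩ := h
  have hb := S.realizes_footBase (Good.mem_foot S hv)
  rw [hm] at hb
  have hu' := (hb.good_iff u).2 hu
  obtain ⟨h1, h2⟩ := hb.run hu' w (Or.inl hlen)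
  intro h
  rw [h, RelIso.one_apply, ← ev_append, ← ev_append] at h2
  exact hne (List.append_cancel_right
    (S.good_injective hy (S.good_append.2 ⟨hv, h1⟩) (S.good_append.2 ⟨hv, hu'⟩) h2))

end PingPong

/-! ### Feet of large depth -/

section Translate

variable {n : ℕ} {A : ℕ → ℕ → ℕ}

/-- The last entry of `v` does not belong to the `j`-th function. -/
def EndsOff (j : Fin n) (v : List (Letter n)) : Prop := ∀ a ∈ v.getLast?, a.1 ≠ j

theorem endsOff_nil (j : Fin n) : EndsOff j [] := by simp [EndsOff]

theorem endsOff_singleton {j : Fin n} {a : Letter n} (h : a.1 ≠ j) : EndsOff j [a] := by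
  simpa [EndsOff] using h

theorem endsOff_cons_cons {j : Fin n} {a a' : Letter n} {v : List (Letter n)} :
    EndsOff j (a :: a' :: v) ↔ EndsOff j (a' :: v) := by
  simp [EndsOff]

theorem append_replicate_injective {q : Letter n} : ∀ {r r' : ℕ} {v v' : List (Letter n)},
    EndsOff q.1 v → EndsOff q.1 v' →
    v ++ List.replicate r q = v' ++ List.replicate r' q → v = v' ∧ r = r'
  | 0, 0, v, v', _, _, h => by simpa using h
  | 0, r' + 1, v, v', hv, _, h => by
    rw [List.replicate_succ', ← List.append_assoc] at h
    simp only [List.replicate_zero, List.append_nil] at h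
    exact absurd rfl (hv q (by rw [h]; simp))
  | r + 1, 0, v, v', _, hv, h => by
    rw [List.replicate_succ', ← List.append_assoc] at h
    simp only [List.replicate_zero, List.append_nil] at h
    exact absurd rfl (hv q (by rw [← h]; simp))
  | r + 1, r' + 1, v, v', hv, hv', h => by
    rw [List.replicate_succ', List.replicate_succ', ← List.append_assoc, ← List.append_assoc] at h
    obtain ⟨h1, h2⟩ := append_replicate_injective hv hv' (List.append_cancel_right h)
    exact ⟨h1, by rw [h2]⟩

theorem topVec_replicate (l : Letter n) (m r : ℕ) :
    (footBase A l m).topVec A (List.replicate r l) = footLevels A l m := by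
  induction r with
  | zero => rfl
  | succ r ih => simp only [List.replicate_succ, SymBase.topVec, ih, footLevels_self]

theorem top_replicate (l : Letter n) (m r : ℕ) :
    (footBase A l m).top (List.replicate r l) = some l := by
  cases r <;> rfl

theorem valid_replicate {l : Letter n} {m : ℕ} (hm : m ≠ 0) (r : ℕ) :
    (footBase A l m).Valid A (List.replicate r l) := by
  induction r with
  | zero => trivial
  | succ r ih =>
    refine ⟨ih, ?_, ?_⟩
    · rw [topVec_replicate, footLevels_self]; exact hm
    · rw [top_replicate]
      exact fun h => l.inv_ne (Option.some.inj h).symm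

theorem exists_append_replicate {l : Letter n} {m : ℕ} : ∀ {u : List (Letter n)},
    (footBase A l m).Valid A u → ∃ v r, u = v ++ List.replicate r l ∧ EndsOff l.1 v
  | [], _ => ⟨[], 0, rfl, endsOff_nil _⟩
  | a :: u, h => by
    obtain ⟨v, r, rfl, hv⟩ := exists_append_replicate h.1
    cases v with
    | nil =>
      by_cases ha : a.1 = l.1
      · rcases Letter.eq_or_eq_inv ha with rfl | rfl
        · exact ⟨[], r + 1, rfl, hv⟩
        · refine absurd ?_ h.2.2
          rw [List.nil_append, top_replicate, Letter.inv_inv]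
      · exact ⟨[a], r, rfl, endsOff_singleton ha⟩
    | cons a' v => exact ⟨a :: a' :: v, r, rfl, endsOff_cons_cons.2 hv⟩

variable {j : Fin n} {e : Bool} {m M : ℕ}

/-- The exponent of the inverse of the `j`-th function that corresponds to the `r`-th power of
the letter `(j, e)`, after translation by `L`. -/
def shiftExp (e : Bool) (L r : ℕ) : ℕ := if e then L - r else L + r

/-- The first letter above the block of letters of j belongs to another function, whose level is the
same in both feet. From there on the levels do not depend on the block. -/
theorem topVec_translate (hcap : ∀ i, i ≠ j → footLevels A (j, e) m i = footLevels A (j, false) M i)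
    (r c : ℕ) : ∀ {v : List (Letter n)}, EndsOff j v → v ≠ [] →
      (footBase A (j, e) m).topVec A (v ++ List.replicate r (j, e)) =
      (footBase A (j, false) M).topVec A (v ++ List.replicate c (j, false))
  | [], _, h => absurd rfl h
  | [a], hv, _ => by
    have ha : a.1 ≠ j := hv a (by simp)
    simp only [List.cons_append, List.nil_append, SymBase.topVec, topVec_replicate]
    rw [hcap _ ha]
  | a :: a' :: v, hv, _ => by
    have := topVec_translate hcap r c (endsOff_cons_cons.1 hv) (by simp)
    rw [List.cons_append, List.cons_append (bs := List.replicate c _), SymBase.topVec,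
      SymBase.topVec, this]

theorem valid_translate (hcap : ∀ i, i ≠ j → footLevels A (j, e) m i = footLevels A (j, false) M i)
    (hM : M ≠ 0) (r c : ℕ) : ∀ {v : List (Letter n)}, EndsOff j v →
      (footBase A (j, e) m).Valid A (v ++ List.replicate r (j, e)) →
      (footBase A (j, false) M).Valid A (v ++ List.replicate c (j, false))
  | [], _, _ => valid_replicate hM c
  | [a], hv, h => by
    have ha : a.1 ≠ j := hv a (by simp)
    refine ⟨valid_replicate hM c, ?_, ?_⟩
    · have := h.2.1
      simp only [List.append_eq, List.nil_append, topVec_replicate] at this ⊢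
      rwa [← hcap _ ha]
    · simp only [List.append_eq, List.nil_append, top_replicate]
      intro h
      exact ha (congrArg Prod.fst (Option.some.inj h)).symm
  | a :: a' :: v, hv, h => by
    have hv' := endsOff_cons_cons.1 hv
    refine ⟨valid_translate hcap hM r c hv' h.1, ?_, h.2.2⟩
    have := h.2.1
    simp only [List.append_eq] at this ⊢
    rwa [← topVec_translate hcap r c hv' (by simp)]

/-- Letters above the block act alike in both systems. In the block, pushing (j, true) on one side
corresponds to cancelling (j, false) on the other, so the exponents move together; `hr` keeps the
translated block nonempty. -/
theorem step_translate (hcap : ∀ i, i ≠ j → footLevels A (j, e) m i = footLevels A (j, false) M i)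
    (hm : m ≠ 0) (hM : M ≠ 0) {L r : ℕ} (hr : r + 1 < L) {v : List (Letter n)}
    (hv : EndsOff j v) (a : Letter n) (hne : v ++ List.replicate r (j, e) ≠ []) :
    ∃ v' r', EndsOff j v' ∧ r' ≤ r + 1 ∧
      (footBase A (j, e) m).step A a (v ++ List.replicate r (j, e)) =
        v' ++ List.replicate r' (j, e) ∧
      (footBase A (j, false) M).step A a (v ++ List.replicate (shiftExp e L r) (j, false)) =
        v' ++ List.replicate (shiftExp e L r') (j, false) := by
  cases v with
  | nil =>
    obtain ⟨r, rfl⟩ : ∃ r', r = r' + 1 := ⟨r - 1, by cases r <;> simp at hne ⊢⟩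
    obtain ⟨c, hc⟩ : ∃ c, shiftExp e L (r + 1) = c + 1 :=
      ⟨shiftExp e L (r + 1) - 1, by unfold shiftExp; split_ifs <;> omega⟩
    simp only [List.nil_append, SymBase.step, top_replicate, topVec_replicate]
    by_cases ha : a.1 = j
    · have e1 : footLevels A (j, e) m a.1 = m := by rw [ha]; exact footLevels_self A (j, e) m
      have e2 : footLevels A (j, false) M a.1 = M := by
        rw [ha]; exact footLevels_self A (j, false) M
      rw [e1, e2, if_neg hm, if_neg hM, hc]
      obtain ⟨i, d⟩ := a
      obtain rfl : i = j := ha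
      cases e <;> cases d
      · exact ⟨[], r + 2, endsOff_nil _, by omega, by simp [Letter.inv, List.replicate_succ],
          by simp only [Letter.inv, shiftExp] at *; simp [← List.replicate_succ] at *; omega⟩
      · exact ⟨[], r, endsOff_nil _, by omega, by simp [Letter.inv, List.replicate_succ],
          by simp only [Letter.inv, shiftExp] at *; simp at *; omega⟩
      · exact ⟨[], r, endsOff_nil _, by omega, by simp [Letter.inv, List.replicate_succ],
          by simp only [Letter.inv, shiftExp] at *; simp [← List.replicate_succ] at *; omega⟩
      · exact ⟨[], r + 2, endsOff_nil _, by omega, by simp [Letter.inv, List.replicate_succ],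
          by simp only [Letter.inv, shiftExp] at *; simp at *; omega⟩
    · rw [hcap _ ha, if_neg fun h => ha (congrArg Prod.fst (Option.some.inj h)).symm,
        if_neg fun h => ha (congrArg Prod.fst (Option.some.inj h)).symm]
      split_ifs
      · exact ⟨[], r + 1, endsOff_nil _, by omega, rfl, rfl⟩
      · exact ⟨[a], r + 1, endsOff_singleton ha, by omega, rfl, rfl⟩
  | cons a' v =>
    have ht := topVec_translate hcap r (shiftExp e L r) hv (by simp)
    simp only [SymBase.step, ht]
    simp only [List.cons_append, SymBase.top, List.tail_cons]
    split_ifs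
    · refine ⟨v, r, ?_, by omega, rfl, rfl⟩
      cases v with
      | nil => exact endsOff_nil _
      | cons _ _ => exact endsOff_cons_cons.1 hv
    · exact ⟨a' :: v, r, hv, by omega, rfl, rfl⟩
    · exact ⟨a :: a' :: v, r, endsOff_cons_cons.2 hv, by omega, rfl, rfl⟩

theorem run_translate (hcap : ∀ i, i ≠ j → footLevels A (j, e) m i = footLevels A (j, false) M i)
    (hm : m ≠ 0) (hM : M ≠ 0) {L r : ℕ} {v : List (Letter n)} (hv : EndsOff j v)
    (w : List (Letter n)) (hr : r + w.length < L)
    (hlen : w.length ≤ (v ++ List.replicate r (j, e)).length) :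
    ∃ v' r', EndsOff j v' ∧ r' ≤ r + w.length ∧
      (footBase A (j, e) m).run A w (v ++ List.replicate r (j, e)) =
        v' ++ List.replicate r' (j, e) ∧
      (footBase A (j, false) M).run A w (v ++ List.replicate (shiftExp e L r) (j, false)) =
        v' ++ List.replicate (shiftExp e L r') (j, false) := by
  induction w with
  | nil => exact ⟨v, r, hv, le_rfl, rfl, rfl⟩
  | cons a w ih =>
    rw [List.length_cons] at hr hlen
    obtain ⟨v', r', h1, h2, h3, h4⟩ := ih (by omega) (by omega)
    have hne : v' ++ List.replicate r' (j, e) ≠ [] := by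
      intro h
      have := (footBase A (j, e) m).length_run_le A w (v ++ List.replicate r (j, e))
      rw [h3, h] at this
      simp only [List.length_nil] at this
      omega
    obtain ⟨v'', r'', h5, h6, h7, h8⟩ := step_translate hcap hm hM (L := L) (by omega) h1 a hne
    refine ⟨v'', r'', h5, by rw [List.length_cons]; omega, ?_, ?_⟩
    · rw [SymBase.run, List.foldr_cons]
      rw [SymBase.run] at h3
      rw [h3, h7]
    · rw [SymBase.run, List.foldr_cons]
      rw [SymBase.run] at h4
      rw [h4, h8]

/-- A foot enters the dynamics only through the levels of the other functions and through its own
level being nonzero. Two feet of the j-th function that agree in these respects can replace each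
other, if the powers of that function are shifted by a constant, with a sign when the types differ.
-/
theorem SymMoves.translate {w : List (Letter n)}
    (hcap : ∀ i, i ≠ j → footLevels A (j, e) m i = footLevels A (j, false) M i)
    (hm : m ≠ 0) (hM : M ≠ 0) (h : SymMoves A w (j, e) m) : SymMoves A w (j, false) M := by
  obtain ⟨u, hu, hlen, hne⟩ := h
  obtain ⟨v, r, rfl, hv⟩ := exists_append_replicate hu
  -- Large enough that L minus an exponent stays positive throughout the run.
  set L := r + w.length + 1 with hL
  obtain ⟨v', r', h1, h2, h3, h4⟩ := run_translate hcap hm hM (L := L) hv w (by omega) hlen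
  refine ⟨v ++ List.replicate (shiftExp e L r) (j, false), valid_translate hcap hM r _ hv hu,
    ?_, fun h => hne ?_⟩
  · simp only [List.length_append, List.length_replicate, shiftExp]
    split_ifs <;> omega
  · rw [h4] at h
    obtain ⟨rfl, h5⟩ := append_replicate_injective (q := (j, false)) h1 hv h
    rw [h3]
    have : r' = r := by
      unfold shiftExp at h5
      split_ifs at h5 <;> omega
    rw [this]

end Translate

namespace PingPong

variable {n : ℕ} {A : ℕ → ℕ → ℕ} {X X' : Type*} [LinearOrder X] [LinearOrder X']

/-- There are feet of all small levels, and these determine the levels of all other feet. -/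
def Rich (S : PingPong n A X) : Prop := ∀ j : Fin n, ∃ K : ℕ,
  (∀ i : Fin n, i < j → A i j / 2 ≤ K) ∧ (∀ i : Fin n, j < i → (A j i + 1) / 2 ≤ K + 1) ∧
  ∀ m, 1 ≤ m → m ≤ max K 1 → ∀ e, S.HasFinitePoint (j, e) m

/-- Feet of depth less than K are available in the system itself. At depth K the levels of all other
functions have become constant, so any deeper foot can be translated to an available one. -/
theorem Rich.ev_ne_one {S : PingPong n A X} (hS : S.Rich) {w : List (Letter n)} {l : Letter n}
    {m : ℕ} (hm : m ≠ 0) (h : SymMoves A w l m) : S.ev w ≠ 1 := by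
  obtain ⟨j, e⟩ := l
  obtain ⟨K, h1, h2, h3⟩ := hS j
  by_cases hd : depth e m < K
  · refine S.ev_ne_one_of_symMoves h (h3 m (by omega) ?_ e)
    unfold depth at hd
    split_ifs at hd <;> omega
  -- An outer foot of depth K has level K + 1, which need not be available; an inner foot of level
  -- max K 1 has depth at least K and is.
  · refine S.ev_ne_one_of_symMoves (h.translate (M := max K 1) (fun i hi => ?_) hm (by omega))
      (h3 _ (by omega) le_rfl false)
    simp only [footLevels, if_neg hi, crossLevel]
    rcases lt_or_gt_of_ne hi with hlt | hlt
    · have := h1 i hlt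
      have hlt' : (i : ℕ) < j := hlt
      rw [if_pos hlt', if_pos hlt']
      simp only [depth, Bool.false_eq_true, if_false] at hd ⊢
      omega
    · have := h2 i hlt
      have hlt' : ¬ (i : ℕ) < j := not_lt.2 (le_of_lt hlt)
      rw [if_neg hlt', if_neg hlt']
      simp only [depth, Bool.false_eq_true, if_false] at hd ⊢
      omega

/-- The relations between the generators are determined by the signature. -/
theorem ev_eq_one_iff {S : PingPong n A X} {S' : PingPong n A X'} (hS : S.Rich) (hS' : S'.Rich)
    (w : List (Letter n)) : S.ev w = 1 ↔ S'.ev w = 1 := by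
  constructor <;> intro h <;> by_contra hne
  · obtain ⟨x, hx⟩ : ∃ x, S'.ev w x ≠ x := by
      by_contra hcon
      push Not at hcon
      exact hne (by ext x; exact hcon x)
    obtain ⟨l, m, hm, hmv⟩ := S'.exists_symMoves hx
    exact hS.ev_ne_one hm hmv h
  · obtain ⟨x, hx⟩ : ∃ x, S.ev w x ≠ x := by
      by_contra hcon
      push Not at hcon
      exact hne (by ext x; exact hcon x)
    obtain ⟨l, m, hm, hmv⟩ := S.exists_symMoves hx
    exact hS'.ev_ne_one hm hmv h

/-- The symbolic orbit of the empty history depends on the levels of the point only, and a nonempty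
history ends in a foot. -/
theorem Realizes.free_dichotomy {S : PingPong n A X} {vec : Fin n → ℕ} {z : X}
    (hb : S.Realizes ⟨vec, none⟩ z) (w : List (Letter n)) :
    ((SymBase.mk vec none).run A w [] = [] → S.ev w z = z) ∧
    ((SymBase.mk vec none).run A w [] ≠ [] → ∃ l, S.ev w z ∈ S.foot l) := by
  obtain ⟨h1, h2⟩ := hb.run (u := []) trivial w (Or.inr rfl)
  rw [ev_nil] at h2
  rw [← h2]
  refine ⟨fun h => by rw [h]; rfl, fun h => ?_⟩
  cases hr : (SymBase.mk vec none).run A w [] with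
  | nil => exact absurd hr h
  | cons l u =>
    rw [hr] at h1
    exact ⟨l, Good.mem_foot S h1⟩

end PingPong

/-! ### Action of a standard function on its outer and inner feet -/

namespace Frame

variable {f : MarkedFun} (F : Frame f)

theorem mem_outer_iff {i : ℕ} (hi : i < F.m) {y : I} (h : F.x i < y) (h' : y < F.x (i + 1)) :
    y ∈ F.outer ↔ (i < F.m / 2 ∧ y < F.s i) ∨ (F.m / 2 ≤ i ∧ F.t i ≤ y) := by
  constructor
  · rintro ⟨j, hj, h2 | h2⟩
    · obtain rfl := F.index_unique hj hi ⟨h2.2.1, h2.2.2.trans (F.s_lt_x hj)⟩ ⟨h, h'⟩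
      exact Or.inl ⟨h2.1, h2.2.2⟩
    · obtain rfl := F.index_unique hj hi ⟨(F.x_lt_t hj).trans_le h2.2.1, h2.2.2⟩ ⟨h, h'⟩
      exact Or.inr ⟨h2.1, h2.2.1⟩
  · rintro (h2 | h2)
    · exact ⟨i, hi, Or.inl ⟨h2.1, h, h2.2⟩⟩
    · exact ⟨i, hi, Or.inr ⟨h2.1, h2.2, h'⟩⟩

theorem mem_inner_iff {i : ℕ} (hi : i < F.m) {y : I} (h : F.x i < y) (h' : y < F.x (i + 1)) :
    y ∈ F.inner ↔ (i < F.m / 2 ∧ F.t i ≤ y) ∨ (F.m / 2 ≤ i ∧ y < F.s i) := by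
  constructor
  · rintro ⟨j, hj, h2 | h2⟩
    · obtain rfl := F.index_unique hj hi ⟨(F.x_lt_t hj).trans_le h2.2.1, h2.2.2⟩ ⟨h, h'⟩
      exact Or.inl ⟨h2.1, h2.2.1⟩
    · obtain rfl := F.index_unique hj hi ⟨h2.2.1, h2.2.2.trans (F.s_lt_x hj)⟩ ⟨h, h'⟩
      exact Or.inr ⟨h2.1, h2.2.2⟩
  · rintro (h2 | h2)
    · exact ⟨i, hi, Or.inl ⟨h2.1, h2.2, h'⟩⟩
    · exact ⟨i, hi, Or.inr ⟨h2.1, h, h2.2⟩⟩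

theorem disjoint_outer_inner : Disjoint F.outer F.inner := by
  refine Set.disjoint_left.2 fun y hy hy' => ?_
  obtain ⟨i, hi, h, h'⟩ := F.mem_orbital_of_mem_feet (F.outer_subset hy)
  rw [F.mem_outer_iff hi h h'] at hy
  rw [F.mem_inner_iff hi h h'] at hy'
  have := F.s_lt_t i hi
  rcases hy with hy | hy <;> rcases hy' with hy' | hy'
  · exact absurd (hy.2.trans this) (not_lt.2 hy'.2)
  · omega
  · omega
  · exact absurd (hy'.2.trans this) (not_lt.2 hy.2)

theorem map_mem_orbital {i : ℕ} (hi : i < F.m) {y : I} :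
    (F.x i < f.map y ∧ f.map y < F.x (i + 1)) ↔ (F.x i < y ∧ y < F.x (i + 1)) := by
  have h1 : F.x i < f.map y ↔ F.x i < y := by
    conv_lhs => rw [← F.map_x hi.le]
    exact f.map.lt_iff_lt
  have h2 : f.map y < F.x (i + 1) ↔ y < F.x (i + 1) := by
    conv_lhs => rw [← F.map_x hi]
    exact f.map.lt_iff_lt
  rw [h1, h2]

theorem symm_mem_orbital {i : ℕ} (hi : i < F.m) {y : I} :
    (F.x i < f.map.symm y ∧ f.map.symm y < F.x (i + 1)) ↔ (F.x i < y ∧ y < F.x (i + 1)) := by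
  rw [← F.map_mem_orbital hi, OrderIso.apply_symm_apply]

theorem level_map (y : I) : F.level (f.map y) = F.level y := by
  by_cases hy : ∃ i < F.m, F.x i < y ∧ y < F.x (i + 1)
  · obtain ⟨i, hi, h, h'⟩ := hy
    have := (F.map_mem_orbital hi).2 ⟨h, h'⟩
    rw [F.level_eq hi h h', F.level_eq hi this.1 this.2]
  · rw [← F.move] at hy
    rw [not_not.1 hy]

theorem level_symm (y : I) : F.level (f.map.symm y) = F.level y := by
  rw [← F.level_map, OrderIso.apply_symm_apply]

theorem exists_orbital_of_level {y : I} (h : F.level y ≠ 0) :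
    ∃ i < F.m, F.x i < y ∧ y < F.x (i + 1) := by
  rwa [Ne, F.level_eq_zero_iff, ← Ne, F.move] at h

/-- The complement of the inner foot in an orbital is bounded by `t i` for a negative and by `s i`
for a positive bump, and f carries this bound to that of the outer foot. -/
theorem map_mem_outer {y : I} (h : F.level y ≠ 0) (h' : y ∉ F.inner) : f.map y ∈ F.outer := by
  obtain ⟨i, hi, h1, h2⟩ := F.exists_orbital_of_level h
  have h3 := (F.map_mem_orbital hi).2 ⟨h1, h2⟩
  rw [F.mem_inner_iff hi h1 h2] at h'
  rw [F.mem_outer_iff hi h3.1 h3.2]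
  rcases lt_or_ge i (F.m / 2) with hlt | hge
  · refine Or.inl ⟨hlt, ?_⟩
    rw [← F.neg i hi hlt, f.map.lt_iff_lt]
    exact not_le.1 fun h => h' (Or.inl ⟨hlt, h⟩)
  · refine Or.inr ⟨hge, ?_⟩
    rw [← F.pos i hi hge, f.map.le_iff_le]
    exact not_lt.1 fun h => h' (Or.inr ⟨hge, h⟩)

theorem symm_mem_inner {y : I} (h : F.level y ≠ 0) (h' : y ∉ F.outer) :
    f.map.symm y ∈ F.inner := by
  obtain ⟨i, hi, h1, h2⟩ := F.exists_orbital_of_level h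
  have h3 := (F.symm_mem_orbital hi).2 ⟨h1, h2⟩
  rw [F.mem_outer_iff hi h1 h2] at h'
  rw [F.mem_inner_iff hi h3.1 h3.2]
  rcases lt_or_ge i (F.m / 2) with hlt | hge
  · refine Or.inl ⟨hlt, ?_⟩
    rw [OrderIso.le_symm_apply, F.neg i hi hlt]
    exact not_lt.1 fun h => h' (Or.inl ⟨hlt, h⟩)
  · refine Or.inr ⟨hge, ?_⟩
    rw [OrderIso.symm_apply_lt, F.pos i hi hge]
    exact not_le.1 fun h => h' (Or.inr ⟨hge, h⟩)

theorem symm_notMem_inner {y : I} (h : y ∈ F.outer) : f.map.symm y ∉ F.inner := by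
  obtain ⟨i, hi, h1, h2⟩ := F.mem_orbital_of_mem_feet (F.outer_subset h)
  have h3 := (F.symm_mem_orbital hi).2 ⟨h1, h2⟩
  rw [F.mem_inner_iff hi h3.1 h3.2]
  rw [F.mem_outer_iff hi h1 h2] at h
  rintro (⟨h4, h5⟩ | ⟨h4, h5⟩)
  · rw [OrderIso.le_symm_apply, F.neg i hi h4] at h5
    rcases h with h | h
    · exact h.2.not_ge h5
    · omega
  · rw [OrderIso.symm_apply_lt, F.pos i hi h4] at h5
    rcases h with h | h
    · omega
    · exact h5.not_ge h.2

theorem map_notMem_outer {y : I} (h : y ∈ F.inner) : f.map y ∉ F.outer := fun h' => by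
  have := F.symm_notMem_inner h'
  rw [OrderIso.symm_apply_apply] at this
  exact this h

theorem s_notMem_feet {i : ℕ} (hi : i < F.m) : F.s i ∉ f.feet := by
  rw [F.mem_feet_iff]
  rintro ⟨j, hj, h | h⟩
  · obtain rfl := F.index_unique hj hi ⟨h.1, h.2.trans (F.s_lt_x hj)⟩ ⟨F.x_lt_s i hi, F.s_lt_x hi⟩
    exact h.2.ne rfl
  · obtain rfl := F.index_unique hj hi ⟨(F.x_lt_t hj).trans_le h.1, h.2⟩
      ⟨F.x_lt_s i hi, F.s_lt_x hi⟩
    exact h.1.not_gt (F.s_lt_t _ hj)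

end Frame

/-! ### The ping-pong system of a standard generating set -/

namespace HasSignature

variable {A : PairFun} {a : Fin A.card → MarkedFun} (h : HasSignature A a)

/-- A frame of the `j`-th function. -/
def frame (j : Fin A.card) : Frame (a j) := (h.genSet.standard j).nonempty_frame.some

theorem interlaced {i j : Fin A.card} (hij : i < j) :
    Interlaced (h.frame i) (h.frame j) (A.val i j) := by
  rw [← h.osc_eq i j hij]
  exact (h.genSet.pair i j hij).interlaced _ _

theorem fast {A : PairFun} {a : Fin A.card → MarkedFun} (h : HasSignature A a) {i j : Fin A.card} (hij : i ≠ j) : Fast (a i) (a j) := by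
  rcases lt_or_gt_of_ne hij with h' | h'
  · exact (h.genSet.pair i j h').fast
  · exact (h.genSet.pair j i h').fast.symm

/-- The feet of one of the two types. -/
def foot (l : Letter A.card) : Set I := if l.2 then (h.frame l.1).outer else (h.frame l.1).inner

theorem foot_subset (l : Letter A.card) : h.foot l ⊆ (a l.1).feet := by
  unfold foot
  split_ifs
  · exact (h.frame l.1).outer_subset
  · exact (h.frame l.1).inner_subset

/-- The ping-pong dynamics of a standard generating set. -/
def pingPong : PingPong A.card A.val I where
  gen j := (a j).map
  level j := (h.frame j).level
  foot := h.foot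
  disjoint := by
    intro l l' hne
    by_cases h1 : l.1 = l'.1
    · obtain ⟨i, e⟩ := l
      obtain ⟨j, e'⟩ := l'
      obtain rfl : i = j := h1
      have := (h.frame i).disjoint_outer_inner
      cases e <;> cases e'
      · exact absurd rfl hne
      · exact this.symm
      · exact this
      · exact absurd rfl hne
    · exact (h.fast h1).mono (h.foot_subset l) (h.foot_subset l')
  level_eq_zero j x := (h.frame j).level_eq_zero_iff.1
  level_ne_zero l x hx := by
    have := (h.frame l.1).one_le_level_of_mem_feet (h.foot_subset l hx)
    omega
  push := by
    rintro ⟨i, e⟩ x hx hx'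
    cases e
    · exact (h.frame i).symm_mem_inner hx hx'
    · exact (h.frame i).map_mem_outer hx hx'
  pop := by
    rintro ⟨i, e⟩ x hx
    cases e
    · exact (h.frame i).symm_notMem_inner hx
    · exact (h.frame i).map_notMem_outer hx
  level_map := by
    rintro ⟨i, e⟩ x
    cases e
    · exact (h.frame i).level_symm x
    · exact (h.frame i).level_map x
  level_foot := by
    rintro ⟨j, e⟩ x hx i
    have hpos := (h.frame j).one_le_level_of_mem_feet (h.foot_subset _ hx)
    simp only [footLevels]
    split_ifs with hij
    · rw [hij]
    rw [crossLevel]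
    rcases lt_or_gt_of_ne hij with hlt | hlt
    · rw [if_pos (by exact hlt)]
      have H := h.interlaced hlt
      cases e
      · exact H.inner_right x hx
      · exact H.outer_right x hx
    · have hlt' : ¬ (i : ℕ) < j := not_lt.2 (le_of_lt hlt)
      rw [if_neg hlt']
      have H := h.interlaced hlt
      cases e
      · exact H.inner_left x hx
      · rw [H.outer_left x hx]
        simp only [depth, if_true]
        congr 1
        omega

/-- To the left of a marker there is a foot of its own function, so a foot of another function can
contain the marker only as its left end. The half-open right feet are the only ones that contain
their left end. -/
theorem eq_t_of_s_mem_feet {j j' : Fin A.card} {i : ℕ} (hi : i < (h.frame j).m)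
    (hmem : (h.frame j).s i ∈ (a j').feet) :
    ∃ i' < (h.frame j').m, (h.frame j).s i = (h.frame j').t i' := by
  have hne : j ≠ j' := by
    rintro rfl
    exact (h.frame j).s_notMem_feet hi hmem
  have hfast := h.fast hne
  obtain ⟨i', hi', h1 | h1⟩ := (h.frame j').mem_feet_iff.1 hmem
  · exfalso
    obtain ⟨z, hz, hz'⟩ := exists_between (max_lt ((h.frame j).x_lt_s i hi) h1.1)
    exact Set.disjoint_left.1 hfast
      ((h.frame j).left_foot_subset hi ((le_max_left _ _).trans_lt hz) hz')
      ((h.frame j').left_foot_subset hi' ((le_max_right _ _).trans_lt hz) (hz'.trans h1.2))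
  · refine ⟨i', hi', (h1.1.eq_or_lt.resolve_right fun hlt => ?_).symm⟩
    obtain ⟨z, hz, hz'⟩ := exists_between (max_lt ((h.frame j).x_lt_s i hi) hlt)
    exact Set.disjoint_left.1 hfast
      ((h.frame j).left_foot_subset hi ((le_max_left _ _).trans_lt hz) hz')
      ((h.frame j').right_foot_subset hi' ((le_max_right _ _).trans hz.le) (hz'.trans h1.2))

theorem level_s {j : Fin A.card} {i : ℕ} (hi : i < (h.frame j).m) :
    (h.frame j).level ((h.frame j).s i) = min (i + 1) ((h.frame j).m - i) :=
  (h.frame j).level_eq hi ((h.frame j).x_lt_s i hi) ((h.frame j).s_lt_x hi)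

theorem good_cons_of_ev_eq_s {j : Fin A.card} {i : ℕ} (hi : i < (h.frame j).m)
    {v : List (Letter A.card)} {y : I} (hv : h.pingPong.Good v y)
    (he : h.pingPong.ev v y = (h.frame j).s i) (e : Bool) : h.pingPong.Good ((j, e) :: v) y := by
  refine ⟨hv, ?_, ?_⟩
  · rw [he]
    show (h.frame j).level _ ≠ 0
    rw [h.level_s hi]
    omega
  · rw [he]
    exact fun hmem => (h.frame j).s_notMem_feet hi (h.foot_subset _ hmem)

/-- A marker inside a foot is the image of a smaller marker under a letter. There are finitely many
markers, so going down ends at a marker outside all feet. -/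
theorem exists_history_s : ∀ {j : Fin A.card} {i : ℕ}, i < (h.frame j).m →
    ∃ v y, h.pingPong.Good v y ∧ (∀ l, y ∉ h.pingPong.foot l) ∧
      h.pingPong.ev v y = (h.frame j).s i := by
  set M : Set I := ⋃ j, (h.frame j).s '' (Finset.range (h.frame j).m : Set ℕ) with hM
  have hfin : M.Finite := Set.finite_iUnion fun j => (Finset.finite_toSet _).image _
  have : Finite M := hfin
  suffices H : ∀ r : M, ∀ {j : Fin A.card} {i : ℕ}, i < (h.frame j).m →
      (r : I) = (h.frame j).s i → ∃ v y, h.pingPong.Good v y ∧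
      (∀ l, y ∉ h.pingPong.foot l) ∧ h.pingPong.ev v y = (h.frame j).s i by
    intro j i hi
    exact H ⟨_, Set.mem_iUnion.2 ⟨j, i, by simpa using hi, rfl⟩⟩ hi rfl
  intro r
  induction r using WellFoundedLT.induction with
  | ind r ih =>
    intro j i hi hr
    by_cases hfoot : ∃ l, (h.frame j).s i ∈ h.pingPong.foot l
    · obtain ⟨l, hl⟩ := hfoot
      obtain ⟨i', hi', he⟩ := h.eq_t_of_s_mem_feet hi (h.foot_subset l hl)
      have hlt := (h.frame l.1).s_lt_t i' hi'
      obtain ⟨v, y, hv, hy, hev⟩ := ih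
        ⟨(h.frame l.1).s i', Set.mem_iUnion.2 ⟨l.1, i', by simpa using hi', rfl⟩⟩
        (by rw [← Subtype.coe_lt_coe, hr, he]; exact hlt) hi' rfl
      by_cases hn : i' < (h.frame l.1).m / 2
      · refine ⟨(l.1, false) :: v, y, h.good_cons_of_ev_eq_s hi' hv hev _, hy, ?_⟩
        rw [PingPong.ev_cons, hev, he]
        show (a l.1).map.symm _ = _
        rw [← (h.frame l.1).neg i' hi' hn, OrderIso.symm_apply_apply]
      · refine ⟨(l.1, true) :: v, y, h.good_cons_of_ev_eq_s hi' hv hev _, hy, ?_⟩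
        rw [PingPong.ev_cons, hev, he]
        exact (h.frame l.1).pos i' hi' (not_lt.1 hn)
    · push Not at hfoot
      exact ⟨[], _, trivial, hfoot, rfl⟩

/-- Applying f or f⁻¹ to the marker of an orbital gives a point with finite history in the foot of
the required type. The bounds on A come from `le_right` and `le_left`. -/
theorem pingPong_rich : h.pingPong.Rich := by
  intro j
  refine ⟨(h.frame j).m / 2, fun i hi => ?_, fun i hi => ?_, fun m h1 h2 e => ?_⟩
  · have := (h.interlaced hi).le_right
    omega
  · have := (h.interlaced hi).le_left
    omega
  · have hm := (h.frame j).m_pos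
    have hi : (h.frame j).m - m < (h.frame j).m := by omega
    obtain ⟨v, y, hv, hy, hev⟩ := h.exists_history_s hi
    refine ⟨v, y, h.good_cons_of_ev_eq_s hi hv hev e, hy, ?_⟩
    have := h.pingPong.level_map (j, e) (h.pingPong.ev v y)
    rw [PingPong.ev_cons, PingPong.letter, this, hev]
    show (h.frame j).level _ = m
    rw [h.level_s hi]
    omega

end HasSignature

/-! ### The marked group is determined by the signature -/

/-- Both groups are the quotient of the free group by the same kernel. -/
theorem exists_mulEquiv_of_ker {ι G H : Type*} [Group G] [Group H] (g : ι → G) (h : ι → H)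
    (hg : Subgroup.closure (Set.range g) = ⊤) (hh : Subgroup.closure (Set.range h) = ⊤)
    (hker : ∀ x : FreeGroup ι, FreeGroup.lift g x = 1 ↔ FreeGroup.lift h x = 1) :
    ∃ φ : G ≃* H, ∀ x, φ (FreeGroup.lift g x) = FreeGroup.lift h x := by
  have sg : Function.Surjective (FreeGroup.lift g) := by
    rw [← MonoidHom.range_eq_top, FreeGroup.range_lift_eq_closure, hg]
  have sh : Function.Surjective (FreeGroup.lift h) := by
    rw [← MonoidHom.range_eq_top, FreeGroup.range_lift_eq_closure, hh]
  have hk : (FreeGroup.lift g).ker = (FreeGroup.lift h).ker := by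
    ext x
    exact hker x
  refine ⟨(QuotientGroup.quotientKerEquivOfSurjective _ sg).symm.trans
    ((QuotientGroup.quotientMulEquivOfEq hk).trans
      (QuotientGroup.quotientKerEquivOfSurjective _ sh)), fun x => ?_⟩
  have : (QuotientGroup.quotientKerEquivOfSurjective _ sg).symm (FreeGroup.lift g x) =
      QuotientGroup.mk x := by
    rw [MulEquiv.symm_apply_eq]
    rfl
  simp only [MulEquiv.trans_apply, this]
  rfl

theorem closure_range_gen {n : ℕ} (a : Fin n → MarkedFun) :
    Subgroup.closure (Set.range (gen a)) = ⊤ := by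
  have : Set.range (gen a) = ((↑) : grp a → I ≃o I) ⁻¹' Set.range fun i => (a i).map := by
    ext ⟨x, hx⟩
    simp [gen, Subtype.ext_iff]
  rw [this]
  exact Subgroup.closure_closure_coe_preimage

namespace HasSignature

variable {A : PairFun} {a a' : Fin A.card → MarkedFun}

theorem coe_lift_gen (h : HasSignature A a) (w : List (Letter A.card)) :
    ((FreeGroup.lift (gen a) (FreeGroup.mk w) : grp a) : I ≃o I) = h.pingPong.ev w := by
  rw [FreeGroup.lift_mk, Subgroup.val_list_prod, List.map_map]
  congr 1
  refine List.map_congr_left fun l _ => ?_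
  obtain ⟨i, e⟩ := l
  cases e <;> rfl

/-- Rightmost orbitals have level 1, so all gaps give the same symbolic starting point. -/
theorem realizes_of_isGap (h : HasSignature A a) {p q : I} (hJ : IsGap a p q) {z : I}
    (hz : z ∈ Set.Ioo p q) : h.pingPong.Realizes ⟨fun _ => 1, none⟩ z := by
  refine ⟨fun j => ?_, fun l => ⟨fun hl => ?_, fun hl => by cases hl⟩⟩
  · obtain ⟨⟨u, v, hmax, hu, hv⟩, -⟩ := hJ.2 j
    obtain ⟨rfl, rfl⟩ := (h.frame j).isMaxOrbital_iff.1 hmax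
    have hm := (h.frame j).m_pos
    show (h.frame j).level z = 1
    rw [(h.frame j).level_eq (i := (h.frame j).m - 1) (by omega) (hu.trans_lt hz.1)]
    · omega
    · rw [Nat.sub_add_cancel hm]
      exact hz.2.trans_le hv
  · exact absurd (h.foot_subset l hl) (Set.disjoint_left.1 (hJ.2 l.1).2 hz)

theorem gap_dichotomy (h : HasSignature A a) {p q : I} (hJ : IsGap a p q)
    (w : List (Letter A.card)) :
    ((SymBase.mk (fun _ => 1) none).run A.val w [] = [] →
      ∀ z ∈ Set.Ioo p q, h.pingPong.ev w z = z) ∧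
    ((SymBase.mk (fun _ => 1) none).run A.val w [] ≠ [] →
      ∀ z ∈ Set.Ioo p q, h.pingPong.ev w z ∉ Set.Ioo p q) := by
  refine ⟨fun hr z hz => ((h.realizes_of_isGap hJ hz).free_dichotomy w).1 hr,
    fun hr z hz hz' => ?_⟩
  obtain ⟨l, hl⟩ := ((h.realizes_of_isGap hJ hz).free_dichotomy w).2 hr
  have := ((h.realizes_of_isGap hJ hz').foot l).1 hl
  cases this

theorem exists_lift_mk (g : grp a) : ∃ w : List (Letter A.card),
    FreeGroup.lift (gen a) (FreeGroup.mk w) = g := by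
  have : Function.Surjective (FreeGroup.lift (gen a)) := by
    rw [← MonoidHom.range_eq_top, FreeGroup.range_lift_eq_closure, closure_range_gen]
  obtain ⟨x, rfl⟩ := this g
  exact ⟨x.toWord, by rw [FreeGroup.mk_toWord]⟩

/-- An element of the group either fixes a gap pointwise or moves it off itself. -/
theorem fixes_or_moves_gap (h : HasSignature A a) {p q : I} (hJ : IsGap a p q) (g : grp a) :
    (∀ z ∈ Set.Ioo p q, g • z = z) ∨ ∀ z ∈ Set.Ioo p q, g • z ∉ Set.Ioo p q := by
  obtain ⟨w, rfl⟩ := exists_lift_mk g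
  have e : ∀ z : I, (FreeGroup.lift (gen a) (FreeGroup.mk w)) • z = h.pingPong.ev w z := fun z => by
    rw [← h.coe_lift_gen w]; rfl
  simp only [e]
  by_cases hr : (SymBase.mk (fun _ => 1) none).run A.val w [] = []
  · exact Or.inl ((h.gap_dichotomy hJ w).1 hr)
  · exact Or.inr ((h.gap_dichotomy hJ w).2 hr)

/-- The relations, and the words that fix a gap pointwise, are both read off from the symbolic
dynamics. The second clause serves to identify stabilizers in two realizations of the same
signature. -/
theorem exists_mulEquiv (h : HasSignature A a) (h' : HasSignature A a') :
    ∃ φ : grp a ≃* grp a', (∀ i, φ (gen a i) = gen a' i) ∧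
      ∀ p q p' q', IsGap a p q → IsGap a' p' q' → ∀ g : grp a,
        (∀ z ∈ Set.Ioo p q, g • z = z) ↔ ∀ z ∈ Set.Ioo p' q', φ g • z = z := by
  obtain ⟨φ, hφ⟩ := exists_mulEquiv_of_ker (gen a) (gen a') (closure_range_gen a)
    (closure_range_gen a') (fun x => by
      rw [← FreeGroup.mk_toWord (x := x), Subtype.ext_iff, Subtype.ext_iff, h.coe_lift_gen,
        h'.coe_lift_gen]
      exact PingPong.ev_eq_one_iff h.pingPong_rich h'.pingPong_rich _)
  refine ⟨φ, fun i => by simpa using hφ (FreeGroup.of i), ?_⟩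
  intro p q p' q' hJ hJ' g
  obtain ⟨w, rfl⟩ := exists_lift_mk g
  rw [hφ]
  have e : ∀ z : I, (FreeGroup.lift (gen a) (FreeGroup.mk w)) • z = h.pingPong.ev w z := fun z => by
    rw [← h.coe_lift_gen w]; rfl
  have e' : ∀ z : I, (FreeGroup.lift (gen a') (FreeGroup.mk w)) • z = h'.pingPong.ev w z :=
    fun z => by rw [← h'.coe_lift_gen w]; rfl
  simp only [e, e']
  by_cases hr : (SymBase.mk (fun _ => 1) none).run A.val w [] = []
  · exact iff_of_true ((h.gap_dichotomy hJ w).1 hr) ((h'.gap_dichotomy hJ' w).1 hr)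
  · obtain ⟨z, hz⟩ := exists_between hJ.1
    obtain ⟨z', hz'⟩ := exists_between hJ'.1
    refine iff_of_false (fun hcon => ?_) (fun hcon => ?_)
    · exact (h.gap_dichotomy hJ w).2 hr z hz (by rw [hcon z hz]; exact hz)
    · exact (h'.gap_dichotomy hJ' w).2 hr z' hz' (by rw [hcon z' hz']; exact hz')

end HasSignature

/-! ### Permutation wreath products inside a group of transformations -/

section Wreath

variable {G H Y : Type*} [Group G] [Group H] [MulAction H Y]

theorem single_mul (y : Y) (g g' : G) : single y (g * g') = single y g * single y g' := by
  classical
  ext z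
  show Pi.mulSingle (M := fun _ => G) y (g * g') z =
    Pi.mulSingle (M := fun _ => G) y g z * Pi.mulSingle (M := fun _ => G) y g' z
  rw [Pi.mulSingle_mul]
  rfl

theorem directSumAction_single (h : H) (y : Y) (g : G) :
    directSumAction G H Y h (single y g) = single (h • y) g := by
  classical
  ext z
  show Pi.mulSingle (M := fun _ => G) y g (h⁻¹ • z) = Pi.mulSingle (M := fun _ => G) (h • y) g z
  simp only [Pi.mulSingle_apply, inv_smul_eq_iff]

/-- The generators of a wreath product given by a coordinate `y` and the acting group. -/
def wreathGen (G H : Type*) [Group G] [Group H] [MulAction H Y] (y : Y) : G ⊕ H → PermWreath G H Y :=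
  Sum.elim (fun g => SemidirectProduct.inl (single y g)) SemidirectProduct.inr

/-- Conjugating by the acting group moves the coordinate y to every other one, and a finitely
supported function is a product of one-coordinate functions. -/
theorem closure_wreathGen (y : Y) (hy : ∀ z : Y, ∃ h : H, h • y = z) :
    Subgroup.closure (Set.range (wreathGen G H y)) = ⊤ := by
  classical
  set S := Subgroup.closure (Set.range (wreathGen G H y)) with hS
  have hr : ∀ h : H, (SemidirectProduct.inr h : PermWreath G H Y) ∈ S := fun h =>
    Subgroup.subset_closure ⟨Sum.inr h, rfl⟩
  have hsingle : ∀ z (g : G), (SemidirectProduct.inl (single z g) : PermWreath G H Y) ∈ S := by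
    intro z g
    obtain ⟨h, rfl⟩ := hy z
    rw [← directSumAction_single, SemidirectProduct.inl_aut]
    exact S.mul_mem (S.mul_mem (hr h) (Subgroup.subset_closure ⟨Sum.inl g, rfl⟩)) (hr _)
  have hl : ∀ (s : Finset Y) (φ : directSum G Y), Function.mulSupport φ.1 ⊆ s →
      (SemidirectProduct.inl φ : PermWreath G H Y) ∈ S := by
    intro s
    induction s using Finset.induction_on with
    | empty =>
      intro φ hφ
      have : φ = 1 := by
        ext z
        by_contra hz
        simpa using hφ hz
      rw [this, map_one]
      exact S.one_mem
    | insert z s hz ih =>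
      intro φ hφ
      have : φ = single z (φ.1 z) * ((single z (φ.1 z))⁻¹ * φ) := by group
      rw [this, map_mul]
      refine S.mul_mem (hsingle _ _) (ih _ fun z' hz' => ?_)
      have hval : ((single z (φ.1 z))⁻¹ * φ).1 z' =
          (Pi.mulSingle (M := fun _ => G) z (φ.1 z) z')⁻¹ * φ.1 z' := rfl
      rw [Function.mem_mulSupport, hval] at hz'
      by_cases he : z' = z
      · subst he
        simp at hz'
      · rw [Pi.mulSingle_eq_of_ne he] at hz'
        have := hφ (show z' ∈ Function.mulSupport φ.1 by simpa using hz')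
        simpa [he] using this
  rw [eq_top_iff]
  intro ω _
  rw [← SemidirectProduct.inl_left_mul_inr_right ω]
  exact S.mul_mem (hl _ _ (Set.Finite.coe_toFinset ω.left.2).ge) (hr _)

variable {Γ X : Type*} [Group Γ] [MulAction Γ X] (θ : G →* Γ) (η : H →* Γ) (J : Set X) (y : Y)

/-- `γ` acts as the element `ω` of a wreath product, of which the coordinates act on the
translates of `J`. -/
def ActsAs (ω : PermWreath G H Y) (γ : Γ) : Prop :=
  (∀ h, ∀ x ∈ J, γ • η h • x = η ω.right • η h • θ (ω.left.1 ((ω.right * h) • y)) • x) ∧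
    ∀ x, (∀ h, ∀ z ∈ J, x ≠ η h • z) → γ • x = η ω.right • x

variable {θ η J y}

/-- Both factors are evaluated along the orbit of one translate of J; invariance of J under θ keeps
the intermediate point in a translate. -/
theorem ActsAs.mul (hJ : ∀ g, ∀ x ∈ J, θ g • x ∈ J) {ω ω' : PermWreath G H Y} {γ γ' : Γ}
    (h : ActsAs θ η J y ω γ) (h' : ActsAs θ η J y ω' γ') :
    ActsAs θ η J y (ω * ω') (γ * γ') := by
  constructor
  · intro k x hx
    have e : (ω * ω').left.1 (((ω * ω').right * k) • y) =
        ω.left.1 ((ω.right * (ω'.right * k)) • y) * ω'.left.1 ((ω'.right * k) • y) := by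
      show ω.left.1 _ * ω'.left.1 (ω.right⁻¹ • _) = _
      rw [SemidirectProduct.mul_right, mul_assoc, mul_smul ω.right, inv_smul_smul]
    rw [mul_smul, h'.1 k x hx, ← mul_smul (η _) (η k), ← map_mul,
      h.1 _ _ (hJ _ _ hx), e, SemidirectProduct.mul_right]
    simp only [map_mul, mul_smul]
  · intro x hx
    rw [mul_smul, h'.2 x hx, h.2, SemidirectProduct.mul_right, map_mul, mul_smul]
    intro k z hz he
    refine hx (ω'.right⁻¹ * k) z hz ?_
    rw [map_mul, mul_smul, ← he, map_inv, inv_smul_smul]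

/-- Translates of J are equal with pointwise the same identification, or disjoint, so the formula in
`ActsAs` can be followed along words in the generators. An element acts trivially exactly if its
wreath coordinates are trivial, hence both groups satisfy the same relations. -/
theorem exists_mulEquiv_permWreath [FaithfulSMul Γ X] (hθ : Function.Injective θ)
    (hη : Function.Injective η) (hfix : ∀ g, ∀ x ∉ J, θ g • x = x)
    (hmove : ∀ h, (∀ x ∈ J, η h • x = x) ∨ ∀ x ∈ J, η h • x ∉ J)
    (htrans : ∀ z : Y, ∃ h : H, h • y = z)
    (hstab : ∀ h : H, h • y = y ↔ ∀ x ∈ J, η h • x = x)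
    {Δ : Subgroup Γ} (hΔ : θ.range ⊔ η.range = Δ) :
    ∃ φ : Δ ≃* PermWreath G H Y,
      (∀ (g : G) (hg : θ g ∈ Δ), φ ⟨θ g, hg⟩ = SemidirectProduct.inl (single y g)) ∧
      ∀ (h : H) (hh : η h ∈ Δ), φ ⟨η h, hh⟩ = SemidirectProduct.inr h := by
  classical
  have hJ : ∀ g, ∀ x ∈ J, θ g • x ∈ J := by
    intro g x hx
    by_contra hcon
    have := hfix g⁻¹ _ hcon
    rw [← mul_smul, ← map_mul, inv_mul_cancel, map_one, one_smul] at this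
    exact hcon (this ▸ hx)
  have hK : ∀ g, θ g ∈ Δ := fun g => hΔ ▸ Subgroup.mem_sup_left ⟨g, rfl⟩
  have hH : ∀ h, η h ∈ Δ := fun h => hΔ ▸ Subgroup.mem_sup_right ⟨h, rfl⟩
  let δ : G ⊕ H → Δ := Sum.elim (fun g => ⟨θ g, hK g⟩) fun h => ⟨η h, hH h⟩
  have hδ : Subgroup.closure (Set.range δ) = ⊤ := by
    have hcomap : Set.range δ = ((↑) : Δ → Γ) ⁻¹' ((θ.range : Set Γ) ∪ η.range) := by
      ext ⟨x, hx⟩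
      simp only [Set.mem_range, Set.mem_preimage, Set.mem_union, SetLike.mem_coe,
        MonoidHom.mem_range, Sum.exists, δ, Sum.elim_inl, Sum.elim_inr, Subtype.mk.injEq]
    have hcl : Δ = Subgroup.closure ((θ.range : Set Γ) ∪ η.range) := by
      rw [Subgroup.closure_union, Subgroup.closure_eq, Subgroup.closure_eq, hΔ]
    subst hcl
    rw [hcomap]
    exact Subgroup.closure_closure_coe_preimage
  have hl : ∀ g, ActsAs θ η J y (SemidirectProduct.inl (single y g)) (θ g) := by
    intro g
    constructor
    · intro h x hx
      have e : (SemidirectProduct.inl (single y g) : PermWreath G H Y).left.1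
          (((SemidirectProduct.inl (single y g) : PermWreath G H Y).right * h) • y) =
          Pi.mulSingle (M := fun _ => G) y g (h • y) := by
        rw [SemidirectProduct.right_inl, one_mul]
        rfl
      rw [e, SemidirectProduct.right_inl, map_one, one_smul]
      by_cases hy : h • y = y
      · rw [hy, Pi.mulSingle_eq_same, (hstab h).1 hy x hx, (hstab h).1 hy _ (hJ g x hx)]
      · rw [Pi.mulSingle_eq_of_ne hy, map_one, one_smul]
        exact hfix g _ ((hmove h).resolve_left (fun hcon => hy ((hstab h).2 hcon)) x hx)
    · intro x hx
      rw [SemidirectProduct.right_inl, map_one, one_smul]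
      exact hfix g x fun hxJ => hx 1 x hxJ (by rw [map_one, one_smul])
  have hr : ∀ h, ActsAs θ η J y (SemidirectProduct.inr h) (η h) := by
    refine fun h => ⟨fun k x _ => ?_, fun x _ => by rw [SemidirectProduct.right_inr]⟩
    rw [SemidirectProduct.left_inr, SemidirectProduct.right_inr]
    show _ = _ • _ • θ 1 • x
    rw [map_one, one_smul]
  have hacts : ∀ w : FreeGroup (G ⊕ H), ActsAs θ η J y (FreeGroup.lift (wreathGen G H y) w)
      (FreeGroup.lift δ w : Δ) := by
    have hof : ∀ x : G ⊕ H, ActsAs θ η J y (wreathGen G H y x) (δ x : Δ) := by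
      rintro (g | h)
      · exact hl g
      · exact hr h
    have hinv : ∀ x : G ⊕ H, ActsAs θ η J y (wreathGen G H y x)⁻¹ ((δ x)⁻¹ : Δ) := by
      rintro (g | h)
      · have := hl g⁻¹
        have e : (single y g⁻¹ : directSum G Y) = (single y g)⁻¹ := by
          rw [eq_inv_iff_mul_eq_one, ← single_mul, inv_mul_cancel]
          ext z
          show Pi.mulSingle (M := fun _ => G) y 1 z = 1
          rw [Pi.mulSingle_one]
          rfl
        rw [e, map_inv, map_inv] at this
        exact this
      · have := hr h⁻¹
        rw [map_inv, map_inv] at this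
        exact this
    intro w
    induction w using FreeGroup.induction_on with
    | C1 =>
      have := hr 1
      rwa [map_one, map_one] at this
    | of x => simpa using hof x
    | inv_of x _ => simpa using hinv x
    | mul u v hu hv =>
      rw [map_mul, map_mul]
      exact hu.mul hJ hv
  have hker : ∀ w : FreeGroup (G ⊕ H),
      FreeGroup.lift δ w = 1 ↔ FreeGroup.lift (wreathGen G H y) w = 1 := by
    intro w
    have hw := hacts w
    constructor
    · intro h1
      rw [h1] at hw
      generalize FreeGroup.lift (wreathGen G H y) w = ω at hw ⊢
      -- The conjugate of ω.right by h sends some point of J into J, so by `hmove` it fixes J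
      -- pointwise.
      have key : ∀ h, ∀ x ∈ J, η ω.right • η h • x = η h • x := by
        intro h x hx
        have e1 := hw.1 h x hx
        rw [Subgroup.coe_one, one_smul] at e1
        have e2 : η (h⁻¹ * ω.right * h) • θ (ω.left.1 ((ω.right * h) • y)) • x = x := by
          rw [map_mul, map_mul, mul_smul, mul_smul, ← e1, map_inv, inv_smul_smul]
        have e3 := (hmove (h⁻¹ * ω.right * h)).resolve_right
          (fun hcon => hcon _ (hJ (ω.left.1 ((ω.right * h) • y)) x hx) (by rwa [e2])) x hx
        rw [map_mul, map_mul, mul_smul, mul_smul, map_inv, inv_smul_eq_iff] at e3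
        exact e3
      have hright : ω.right = 1 := by
        apply hη
        rw [map_one]
        apply eq_of_smul_eq_smul (α := X)
        intro x
        rw [one_smul]
        by_cases hx : ∀ h, ∀ z ∈ J, x ≠ η h • z
        · have := hw.2 x hx
          rw [Subgroup.coe_one, one_smul] at this
          exact this.symm
        · push Not at hx
          obtain ⟨h, z, hz, rfl⟩ := hx
          exact key h z hz
      refine SemidirectProduct.ext ?_ hright
      ext z
      obtain ⟨h, rfl⟩ := htrans z
      apply hθ
      show _ = θ 1
      rw [map_one]
      apply eq_of_smul_eq_smul (α := X)
      intro x
      rw [one_smul]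
      by_cases hx : x ∈ J
      · have := hw.1 h x hx
        rw [Subgroup.coe_one, one_smul, hright, map_one, one_smul, one_mul] at this
        exact (MulAction.injective (η h) this).symm
      · exact hfix _ x hx
    · intro h1
      rw [h1] at hw
      apply Subtype.ext
      apply eq_of_smul_eq_smul (α := X)
      intro x
      rw [Subgroup.coe_one, one_smul]
      by_cases hx : ∀ h, ∀ z ∈ J, x ≠ η h • z
      · rw [hw.2 x hx, SemidirectProduct.one_right, map_one, one_smul]
      · push Not at hx
        obtain ⟨h, z, hz, rfl⟩ := hx
        rw [hw.1 h z hz, SemidirectProduct.one_right, map_one, one_smul]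
        show _ • θ 1 • z = _
        rw [map_one, one_smul]
  obtain ⟨φ, hφ⟩ := exists_mulEquiv_of_ker δ (wreathGen G H y) hδ (closure_wreathGen y htrans) hker
  refine ⟨φ, fun g hg => ?_, fun h hh => ?_⟩
  · simpa [δ, wreathGen] using hφ (FreeGroup.of (Sum.inl g))
  · simpa [δ, wreathGen] using hφ (FreeGroup.of (Sum.inr h))

end Wreath

/-! ### Groups generated by elements with separated supports -/

theorem smul_eq_of_mem_closure {Γ X : Type*} [Group Γ] [MulAction Γ X] {S : Set Γ} {g : Γ}
    (hg : g ∈ Subgroup.closure S) {x : X} (hx : ∀ s ∈ S, s • x = x) : g • x = x :=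
  (Subgroup.closure_le (MulAction.stabilizer Γ x)).2 (fun s hs => hx s hs) hg

theorem commute_of_disjoint {Γ X : Type*} [Group Γ] [MulAction Γ X] [FaithfulSMul Γ X]
    {g h : Γ} {S : Set X} (hg : ∀ x ∉ S, g • x = x) (hh : ∀ x ∈ S, h • x = x) : Commute g h := by
  apply eq_of_smul_eq_smul (α := X)
  intro x
  rw [mul_smul, mul_smul]
  by_cases hx : x ∈ S
  · rw [hh x hx]
    refine (hh _ ?_).symm
    by_contra hcon
    have := MulAction.injective g (hg _ hcon)
    exact hcon (by rwa [show g • x = x from this])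
  · rw [hg x hx]
    refine hg _ fun hcon => hx ?_
    have : h • x = x := MulAction.injective h (hh _ hcon)
    rwa [this] at hcon

/-- Elements supported in S commute with those that fix S pointwise, and a product of two such
elements is trivial only if both factors are. -/
theorem exists_mulEquiv_prod {Γ X K H : Type*} [Group Γ] [MulAction Γ X] [FaithfulSMul Γ X]
    [Group K] [Group H] (θ : K →* Γ) (η : H →* Γ) (hθ : Function.Injective θ)
    (hη : Function.Injective η) {S : Set X} (hg : ∀ g, ∀ x ∉ S, θ g • x = x)
    (hh : ∀ h, ∀ x ∈ S, η h • x = x) {Δ : Subgroup Γ} (hΔ : θ.range ⊔ η.range = Δ) :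
    ∃ φ : Δ ≃* K × H, (∀ (g : K) (hg : θ g ∈ Δ), φ ⟨θ g, hg⟩ = (g, 1)) ∧
      ∀ (h : H) (hh : η h ∈ Δ), φ ⟨η h, hh⟩ = (1, h) := by
  have comm : ∀ g h, Commute (θ g) (η h) := fun g h => commute_of_disjoint (hg g) (hh h)
  have hinj : Function.Injective (θ.noncommCoprod η comm) := by
    rw [injective_iff_map_eq_one]
    rintro ⟨g, h⟩ he
    rw [MonoidHom.noncommCoprod_apply] at he
    have hg1 : θ g = 1 := by
      apply eq_of_smul_eq_smul (α := X)
      intro x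
      rw [one_smul]
      by_cases hx : x ∈ S
      · have : (θ g * η h) • x = x := by rw [he, one_smul]
        rwa [mul_smul, hh h x hx] at this
      · exact hg g x hx
    rw [hg1, one_mul] at he
    rw [Prod.mk_eq_one]
    exact ⟨hθ (hg1.trans (map_one θ).symm), hη (he.trans (map_one η).symm)⟩
  rw [← MonoidHom.noncommCoprod_range θ η comm] at hΔ
  refine ⟨((MonoidHom.ofInjective hinj).trans (MulEquiv.subgroupCongr hΔ)).symm,
    fun g hg => ?_, fun h hh => ?_⟩
  · rw [MulEquiv.symm_apply_eq]
    apply Subtype.ext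
    show θ g = θ g * η 1
    rw [map_one, mul_one]
  · rw [MulEquiv.symm_apply_eq]
    apply Subtype.ext
    show η h = θ 1 * η h
    rw [map_one, one_mul]

theorem smul_eq_of_mem_grp {n : ℕ} {a : Fin n → MarkedFun} (g : grp a) {x : I}
    (hx : ∀ i, (a i).map x = x) : (g : I ≃o I) • x = x :=
  smul_eq_of_mem_closure g.2 (by rintro _ ⟨i, rfl⟩; exact hx i)

/-! ### Sums and products of signatures on the level of groups -/

namespace HasSignature

section Glue

variable {k : ℕ} {B C : PairFun} {a : Fin (B.card + C.card) → MarkedFun}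

theorem left (h : HasSignature (PairFun.glue k B C) a) :
    HasSignature B fun i => a (Fin.castAdd C.card i) where
  genSet := ⟨fun i => h.genSet.standard _, fun i j hij => h.genSet.pair _ _ hij⟩
  osc_eq i j hij := by
    have := h.osc_eq (Fin.castAdd C.card i) (Fin.castAdd C.card j) hij
    rw [this]
    simp [PairFun.glue]

theorem right (h : HasSignature (PairFun.glue k B C) a) :
    HasSignature C fun j => a (Fin.natAdd B.card j) where
  genSet := ⟨fun i => h.genSet.standard _, fun i j hij => h.genSet.pair _ _
    (Nat.add_lt_add_left hij _)⟩
  osc_eq i j hij := by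
    have := h.osc_eq (Fin.natAdd B.card i) (Fin.natAdd B.card j) (Nat.add_lt_add_left hij _)
    rw [this]
    simp [PairFun.glue]

/-- The oscillation is the depth, so the constant cross value of the glued signature gives the
relative position of every mixed pair. -/
theorem depth_cross (h : HasSignature (PairFun.glue k B C) a) (i : Fin B.card) (j : Fin C.card) :
    StandardPairDepth k (a (Fin.castAdd C.card i)) (a (Fin.natAdd B.card j)) := by
  have hlt : Fin.castAdd C.card i < Fin.natAdd B.card j := by
    rw [Fin.lt_def, Fin.val_castAdd, Fin.val_natAdd]
    omega
  obtain ⟨d, hd⟩ := (h.genSet.pair _ _ hlt).exists_depth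
  have h1 := h.osc_eq _ _ hlt
  rw [hd.osc_eq (h.frame _) (h.frame _)] at h1
  have : (PairFun.glue k B C).val (Fin.castAdd C.card i) (Fin.natAdd B.card j) = k := by
    have := i.2
    have := j.2
    simp [PairFun.glue]
  rw [this] at h1
  exact h1 ▸ hd

theorem grp_eq_sup (a : Fin (B.card + C.card) → MarkedFun) :
    grp (fun i => a (Fin.castAdd C.card i)) ⊔ grp (fun j => a (Fin.natAdd B.card j)) = grp a := by
  rw [grp, grp, grp, ← Subgroup.closure_union]
  congr 1
  ext x
  simp only [Set.mem_union, Set.mem_range]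
  constructor
  · rintro (⟨i, rfl⟩ | ⟨i, rfl⟩) <;> exact ⟨_, rfl⟩
  · rintro ⟨i, rfl⟩
    induction i using Fin.addCases with
    | left i => exact Or.inl ⟨i, rfl⟩
    | right i => exact Or.inr ⟨i, rfl⟩

end Glue

variable {B C : PairFun} {a : Fin (B.card + C.card) → MarkedFun} {b : Fin B.card → MarkedFun}
  {c : Fin C.card → MarkedFun}

theorem range_subtype_comp {n m : ℕ} {a : Fin n → MarkedFun} {b : Fin m → MarkedFun}
    (φ : grp b ≃* grp a) : ((grp a).subtype.comp φ.toMonoidHom).range = grp a := by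
  rw [MonoidHom.range_comp, MonoidHom.range_eq_top.2 φ.surjective, ← MonoidHom.range_eq_map,
    Subgroup.range_subtype]

/-- Depth 0 places the first part to the left of the second, so inside A the two subgroups have
disjoint supports. They are identified with the given groups by their signatures. -/
theorem exists_mulEquiv_add (ha : HasSignature (B + C) a) (hb : HasSignature B b)
    (hc : HasSignature C c) :
    ∃ φ : grp a ≃* grp b × grp c,
      (∀ i, φ (gen a (Fin.castAdd C.card i)) = (gen b i, 1)) ∧
      (∀ j, φ (gen a (Fin.natAdd B.card j)) = (1, gen c j)) := by
  change HasSignature (PairFun.glue 0 B C) a at ha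
  obtain ⟨θ, hθ, -⟩ := hb.exists_mulEquiv ha.left
  obtain ⟨η, hη, -⟩ := hc.exists_mulEquiv ha.right
  obtain ⟨φ, h1, h2⟩ := exists_mulEquiv_prod
    ((grp fun i => a (Fin.castAdd C.card i)).subtype.comp θ.toMonoidHom)
    ((grp fun i => a (Fin.natAdd B.card i)).subtype.comp η.toMonoidHom)
    (Subtype.val_injective.comp θ.injective) (Subtype.val_injective.comp η.injective)
    (S := {x : I | ∃ i, (a (Fin.castAdd C.card i)).map x ≠ x})
    (fun g x hx => smul_eq_of_mem_grp _ fun i => not_not.1 fun hcon => hx ⟨i, hcon⟩)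
    (fun g x ⟨i, hx⟩ => smul_eq_of_mem_grp _ fun j => by
      have := ha.depth_cross i j
      cases this with
      | left _ hl =>
        rw [Frame.leftOf_iff (ha.left.frame i) (ha.right.frame j)] at hl
        by_contra hcon
        obtain ⟨i', hi', -, h1⟩ := ((ha.left.frame i).move x).1 hx
        obtain ⟨j', hj', h2, -⟩ := ((ha.right.frame j).move x).1 hcon
        exact (h1.trans_le ((ha.left.frame i).x_le hi' le_rfl)).not_ge
          (hl.trans (((ha.right.frame j).x_le (Nat.zero_le _) hj'.le).trans h2.le)))
    (Δ := grp a) (by rw [range_subtype_comp, range_subtype_comp, grp_eq_sup])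
  refine ⟨φ, fun i => ?_, fun j => ?_⟩
  · rw [← h1 (gen b i)]
    · congr 1
      apply Subtype.ext
      show _ = ((θ (gen b i) : grp _) : I ≃o I)
      rw [hθ]
      rfl
    · show ((θ (gen b i) : grp _) : I ≃o I) ∈ grp a
      rw [hθ]
      exact (gen a (Fin.castAdd C.card i)).2
  · rw [← h2 (gen c j)]
    · congr 1
      apply Subtype.ext
      show _ = ((η (gen c j) : grp _) : I ≃o I)
      rw [hη]
      rfl
    · show ((η (gen c j) : grp _) : I ≃o I) ∈ grp a
      rw [hη]
      exact (gen a (Fin.natAdd B.card j)).2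

/-- The supports of the functions in the left part of a product lie in a common gap of the
right part. -/
theorem exists_gap (ha : HasSignature (B * C) a) (hB : B ≠ 0) :
    ∃ p q : I, IsGap (fun j => a (Fin.natAdd B.card j)) p q ∧
      ∀ i x, (a (Fin.castAdd C.card i)).map x ≠ x → x ∈ Set.Ioo p q := by
  change HasSignature (PairFun.glue 1 B C) a at ha
  have : Nonempty (Fin B.card) := ⟨⟨0, PairFun.card_pos hB⟩⟩
  let F := fun i => ha.left.frame i
  let G := fun i => ha.right.frame i
  obtain ⟨i0, hi0⟩ := Finite.exists_min fun i => (F i).x 0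
  obtain ⟨i1, hi1⟩ := Finite.exists_max fun i => (F i).x (F i).m
  have hlt : ∀ i, (F i).x 0 < (F i).x (F i).m := fun i => (F i).x_lt (F i).m_pos le_rfl
  -- The smallest interval containing all supports of the left part.
  refine ⟨(F i0).x 0, (F i1).x (F i1).m, ⟨(hlt i0).trans_le (hi1 i0), fun j => ⟨?_, ?_⟩⟩, ?_⟩
  · refine ⟨_, _, (G j).isMaxOrbital_iff.2 ⟨rfl, rfl⟩, ?_, ?_⟩
    · exact ((ha.depth_cross i0 j).x_lt_of_one (F i0) (G j)).1.le
    · exact ((ha.depth_cross i1 j).x_lt_of_one (F i1) (G j)).2.le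
  · have hm := (G j).m_pos
    have hm' : (G j).m - 1 < (G j).m := by omega
    rw [Set.disjoint_left]
    intro z hz hz'
    obtain ⟨j', hj', hfoot⟩ := (G j).mem_feet_iff.1 hz'
    have hmax : (G j).x ((G j).m - 1) < z ∧ z < (G j).x ((G j).m - 1 + 1) := by
      refine ⟨((ha.depth_cross i0 j).x_lt_of_one (F i0) (G j)).1.trans hz.1, ?_⟩
      rw [Nat.sub_add_cancel hm]
      exact hz.2.trans ((ha.depth_cross i1 j).x_lt_of_one (F i1) (G j)).2
    have hne : ∀ i, Fin.castAdd C.card i ≠ Fin.natAdd B.card j := fun i he => by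
      have := congrArg Fin.val he
      simp at this
      omega
    -- A left foot of the last orbital that meets (p, q) contains the points just to the right of p,
    -- which belong to the left foot of the function starting at p. At q the argument is symmetric,
    -- with right feet.
    rcases hfoot with h1 | h1
    · obtain rfl := (G j).index_unique hj' hm' ⟨h1.1, h1.2.trans ((G j).s_lt_x hj')⟩ hmax
      have hd := ha.fast (hne i0)
      obtain ⟨w, hw, hw'⟩ := exists_between
        (lt_min ((F i0).x_lt_s 0 (F i0).m_pos) (hz.1.trans h1.2))
      exact Set.disjoint_left.1 hd
        ((F i0).left_foot_subset (F i0).m_pos hw (hw'.trans_le (min_le_left _ _)))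
        ((G j).left_foot_subset hj'
          (((ha.depth_cross i0 j).x_lt_of_one (F i0) (G j)).1.trans hw)
          (hw'.trans_le (min_le_right _ _)))
    · obtain rfl := (G j).index_unique hj' hm' ⟨((G j).x_lt_t hj').trans_le h1.1, h1.2⟩ hmax
      have hd := ha.fast (hne i1)
      have hm1 := (F i1).m_pos
      have hm1' : (F i1).m - 1 < (F i1).m := by omega
      have htx := (F i1).t_lt_x _ hm1'
      rw [Nat.sub_add_cancel hm1] at htx
      obtain ⟨w, hw, hw'⟩ := exists_between (max_lt htx (h1.1.trans_lt hz.2))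
      refine Set.disjoint_left.1 hd
        ((F i1).right_foot_subset hm1' ((le_max_left _ _).trans hw.le)
          (by rwa [Nat.sub_add_cancel hm1]))
        ((G j).right_foot_subset hj' ((le_max_right _ _).trans hw.le) ?_)
      rw [Nat.sub_add_cancel hm]
      exact hw'.trans ((ha.depth_cross i1 j).x_lt_of_one (F i1) (G j)).2
  · intro i x hx
    obtain ⟨i', hi', h1, h2⟩ := ((F i).move x).1 hx
    exact ⟨(hi0 i).trans_lt (((F i).x_le (Nat.zero_le _) hi'.le).trans_lt h1),
      (h2.trans_le ((F i).x_le hi' le_rfl)).trans_le (hi1 i)⟩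

/-- Since gaps are fixed pointwise or moved off themselves, setwise and pointwise stabilizers
coincide. -/
theorem smul_base_eq_iff (hc : HasSignature C c) {p q : I} (hJ : IsGap c p q) (g : grp c) :
    g • base c p q = base c p q ↔ ∀ z ∈ Set.Ioo p q, g • z = z := by
  have : g • base c p q = base c p q ↔ g • Set.Ioo p q = Set.Ioo p q := Subtype.ext_iff
  rw [this]
  constructor
  · intro he
    refine (hc.fixes_or_moves_gap hJ g).resolve_right fun hcon => ?_
    obtain ⟨z, hz⟩ := exists_between hJ.1
    exact hcon z hz (he ▸ Set.smul_mem_smul_set hz)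
  · intro hfix
    rw [← Set.image_smul]
    exact (Set.image_congr hfix).trans (Set.image_id' _)

/-- The wreath product is found inside A, over the gap that holds the left part. The given gap of c
may be a different one, but the isomorphism between the two copies of the group of c matches the
stabilizers of the two gaps, hence the actions on translates. -/
theorem exists_mulEquiv_mul (ha : HasSignature (B * C) a) (hb : HasSignature B b)
    (hc : HasSignature C c) (hB : B ≠ 0) {p q : I} (hJ : IsGap c p q) :
    ∃ φ : grp a ≃* PermWreath (grp b) (grp c) (translates c p q),
      (∀ i, φ (gen a (Fin.castAdd C.card i)) =
        SemidirectProduct.inl (single (base c p q) (gen b i))) ∧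
      (∀ j, φ (gen a (Fin.natAdd B.card j)) = SemidirectProduct.inr (gen c j)) := by
  obtain ⟨p', q', hJ', hsupp⟩ := ha.exists_gap hB
  change HasSignature (PairFun.glue 1 B C) a at ha
  obtain ⟨θ, hθ, -⟩ := hb.exists_mulEquiv ha.left
  obtain ⟨η, hη, hgap⟩ := hc.exists_mulEquiv ha.right
  obtain ⟨φ, h1, h2⟩ := exists_mulEquiv_permWreath (X := I)
    (θ := (grp fun i => a (Fin.castAdd C.card i)).subtype.comp θ.toMonoidHom)
    (η := (grp fun i => a (Fin.natAdd B.card i)).subtype.comp η.toMonoidHom)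
    (J := Set.Ioo p' q') (y := base c p q)
    (Subtype.val_injective.comp θ.injective) (Subtype.val_injective.comp η.injective)
    (fun g x hx => smul_eq_of_mem_grp _ fun i => not_not.1 fun hcon => hx (hsupp i x hcon))
    (fun h => ha.right.fixes_or_moves_gap hJ' (η h))
    (fun z => by
      obtain ⟨h, hh⟩ := z.2
      exact ⟨h, Subtype.ext hh⟩)
    (fun h => (hc.smul_base_eq_iff hJ h).trans (hgap p q p' q' hJ hJ' h))
    (Δ := grp a) (by rw [range_subtype_comp, range_subtype_comp, grp_eq_sup])
  refine ⟨φ, fun i => ?_, fun j => ?_⟩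
  · rw [← h1 (gen b i)]
    · congr 1
      apply Subtype.ext
      show _ = ((θ (gen b i) : grp _) : I ≃o I)
      rw [hθ]
      rfl
    · show ((θ (gen b i) : grp _) : I ≃o I) ∈ grp a
      rw [hθ]
      exact (gen a (Fin.castAdd C.card i)).2
  · rw [← h2 (gen c j)]
    · congr 1
      apply Subtype.ext
      show _ = ((η (gen c j) : grp _) : I ≃o I)
      rw [hη]
      rfl
    · show ((η (gen c j) : grp _) : I ≃o I) ∈ grp a
      rw [hη]
      exact (gen a (Fin.natAdd B.card j)).2

end HasSignature

/-! ### Construction of marked functions -/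

theorem exists_orderIso_max {α : Type*} [LinearOrder α] (e e' : α ≃o α) :
    ∃ f : α ≃o α, ∀ y, f y = max (e y) (e' y) := by
  refine ⟨StrictMono.orderIsoOfRightInverse (fun y => max (e y) (e' y))
    (fun y z h => max_lt_max (e.strictMono h) (e'.strictMono h))
    (fun z => min (e.symm z) (e'.symm z)) fun z => ?_, fun y => rfl⟩
  show max (e (min _ _)) (e' (min _ _)) = z
  rcases le_total (e.symm z) (e'.symm z) with h | h
  · rw [min_eq_left h, e.apply_symm_apply, max_eq_left (by rwa [← e'.le_symm_apply])]
  · rw [min_eq_right h, e'.apply_symm_apply, max_eq_right (by rwa [← e.le_symm_apply])]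

theorem exists_orderIso_min {α : Type*} [LinearOrder α] (e e' : α ≃o α) :
    ∃ f : α ≃o α, ∀ y, f y = min (e y) (e' y) := by
  refine ⟨StrictMono.orderIsoOfRightInverse (fun y => min (e y) (e' y))
    (fun y z h => min_lt_min (e.strictMono h) (e'.strictMono h))
    (fun z => max (e.symm z) (e'.symm z)) fun z => ?_, fun y => rfl⟩
  show min (e (max _ _)) (e' (max _ _)) = z
  rcases le_total (e.symm z) (e'.symm z) with h | h
  · rw [max_eq_right h, e'.apply_symm_apply, min_eq_right (by rwa [← e.symm_apply_le])]
  · rw [max_eq_left h, e.apply_symm_apply, min_eq_left (by rwa [← e'.symm_apply_le])]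

theorem exists_real_affine (u : ℝ) {a : ℝ} (ha : 0 < a) :
    ∃ f : ℝ ≃o ℝ, ∀ y, f y = u + (y - u) * a := by
  refine ⟨((OrderIso.addRight (-u)).trans (OrderIso.mulRight₀ a ha)).trans (OrderIso.addRight u),
    fun y => ?_⟩
  simp only [OrderIso.trans_apply, OrderIso.addRight_apply, OrderIso.mulRight₀_apply]
  ring

/-- The map is the maximum of the identity and the minimum of two lines through (s, t): one through
(u, u), of slope greater than 1, and one through (v, v), of slope less than 1. -/
theorem exists_real_bump {u s t v : ℝ} (us : u < s) (st : s < t) (tv : t < v) :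
    ∃ f : ℝ ≃o ℝ, f s = t ∧ ∀ y, f y ≠ y ↔ u < y ∧ y < v := by
  have h1 : 1 < (t - u) / (s - u) := by rw [lt_div_iff₀] <;> linarith
  have h2 : (v - t) / (v - s) < 1 := by rw [div_lt_iff₀] <;> linarith
  have h3 : 0 < (v - t) / (v - s) := div_pos (by linarith) (by linarith)
  have e1 : (s - u) * ((t - u) / (s - u)) = t - u := mul_div_cancel₀ _ (by linarith)
  have e2 : (v - s) * ((v - t) / (v - s)) = v - t := mul_div_cancel₀ _ (by linarith)
  generalize (t - u) / (s - u) = a at h1 e1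
  generalize (v - t) / (v - s) = b at h2 h3 e2
  obtain ⟨f1, hf1⟩ := exists_real_affine u (by linarith : 0 < a)
  obtain ⟨f2, hf2⟩ := exists_real_affine v h3
  obtain ⟨f3, hf3⟩ := exists_orderIso_min f1 f2
  obtain ⟨f, hf⟩ := exists_orderIso_max (OrderIso.refl ℝ) f3
  have key : ∀ y, f y = max y (min (u + (y - u) * a) (v + (y - v) * b)) := fun y => by
    rw [hf, hf3, hf1, hf2]
    rfl
  refine ⟨f, ?_, fun y => ?_⟩
  · rw [key, e1, show v + (s - v) * b = t by linarith, show u + (t - u) = t by ring, min_self,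
      max_eq_right st.le]
  · rw [key, Ne, max_eq_left_iff, not_le, lt_min_iff]
    constructor
    · rintro ⟨h4, h5⟩
      exact ⟨by nlinarith, by nlinarith⟩
    · rintro ⟨h4, h5⟩
      exact ⟨by nlinarith, by nlinarith⟩

theorem exists_orderIso_unitInterval (e : ℝ ≃o ℝ) (h0 : e 0 = 0) (h1 : e 1 = 1) :
    ∃ f : I ≃o I, ∀ y, (f y : ℝ) = e y := by
  have key : ∀ g : ℝ ≃o ℝ, g 0 = 0 → g 1 = 1 → ∀ y : I, g y ∈ I := fun g h0 h1 y =>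
    ⟨h0 ▸ g.monotone y.2.1, h1 ▸ g.monotone y.2.2⟩
  have h0' : e.symm 0 = 0 := by rw [OrderIso.symm_apply_eq, h0]
  have h1' : e.symm 1 = 1 := by rw [OrderIso.symm_apply_eq, h1]
  exact ⟨StrictMono.orderIsoOfRightInverse (fun y => ⟨e y, key e h0 h1 y⟩)
    (fun y z h => e.strictMono h) (fun y => ⟨e.symm y, key e.symm h0' h1' y⟩)
    fun y => Subtype.ext (e.apply_symm_apply _), fun y => rfl⟩

theorem exists_bump {u s t v : I} (us : u < s) (st : s < t) (tv : t < v) :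
    ∃ f : I ≃o I, f s = t ∧ ∀ y, f y ≠ y ↔ u < y ∧ y < v := by
  obtain ⟨e, h1, h2⟩ := exists_real_bump (u := u) (s := s) (t := t) (v := v) us st tv
  obtain ⟨f, hf⟩ := exists_orderIso_unitInterval e
    (not_not.1 fun h => ((h2 0).1 h).1.not_ge u.2.1)
    (not_not.1 fun h => ((h2 1).1 h).2.not_ge v.2.2)
  refine ⟨f, Subtype.ext ((hf s).trans h1), fun y => ?_⟩
  rw [Ne, Subtype.ext_iff, hf]
  exact h2 y

theorem exists_signed_bump (neg : Prop) {u s t v : I} (us : u < s) (st : s < t) (tv : t < v) :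
    ∃ f : I ≃o I, (neg → f t = s) ∧ (¬ neg → f s = t) ∧ ∀ y, f y ≠ y ↔ u < y ∧ y < v := by
  obtain ⟨f, h1, h2⟩ := exists_bump us st tv
  by_cases h : neg
  · refine ⟨f.symm, fun _ => by rw [OrderIso.symm_apply_eq, h1], fun h' => absurd h h', fun y => ?_⟩
    rw [Ne, OrderIso.symm_apply_eq, eq_comm]
    exact h2 y
  · exact ⟨f, fun h' => absurd h' h, fun _ => h1, h2⟩

theorem exists_restrict (f : I ≃o I) {p q : I} (hp : f p = p) (hq : f q = q) :
    ∃ f' : I ≃o I, (∀ y, p ≤ y → y ≤ q → f' y = f y) ∧ ∀ y, ¬ (p ≤ y ∧ y ≤ q) → f' y = y := by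
  classical
  have mem : ∀ y, (p ≤ f y ∧ f y ≤ q) ↔ (p ≤ y ∧ y ≤ q) := fun y => by
    conv_lhs => rw [← hp, ← hq]
    rw [f.le_iff_le, f.le_iff_le]
  refine ⟨StrictMono.orderIsoOfRightInverse (fun y => if p ≤ y ∧ y ≤ q then f y else y) ?_
    (fun y => if p ≤ y ∧ y ≤ q then f.symm y else y) ?_,
    fun y h h' => if_pos ⟨h, h'⟩, fun y h => if_neg h⟩
  · intro y z hyz
    have hlt := f.strictMono hyz
    have hy := mem y
    have hz := mem z
    dsimp only
    split_ifs with h1 h2 h2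
    · exact hlt
    · exact (hy.2 h1).2.trans_lt (not_le.1 fun h => h2 ⟨h1.1.trans hyz.le, h⟩)
    · exact (not_le.1 fun h => h1 ⟨h, hyz.le.trans h2.2⟩).trans_le (hz.2 h2).1
    · exact hyz
  · intro y
    have hy := mem (f.symm y)
    rw [f.apply_symm_apply] at hy
    dsimp only
    by_cases h : p ≤ y ∧ y ≤ q
    · rw [if_pos h, if_pos (hy.1 h), f.apply_symm_apply]
    · rw [if_neg h, if_neg h]

/-- Points `x 0 < s 0 < t 0 < x 1 < s 1 < t 1 < ⋯ < x m`. -/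
structure Chain (m : ℕ) (x s t : ℕ → I) : Prop where
  x_lt_s : ∀ i < m, x i < s i
  s_lt_t : ∀ i < m, s i < t i
  t_lt_x : ∀ i < m, t i < x (i + 1)

namespace Chain

variable {m : ℕ} {x s t : ℕ → I}

theorem mono {n : ℕ} (h : Chain m x s t) (hn : n ≤ m) : Chain n x s t :=
  ⟨fun i hi => h.x_lt_s i (hi.trans_le hn), fun i hi => h.s_lt_t i (hi.trans_le hn),
    fun i hi => h.t_lt_x i (hi.trans_le hn)⟩

theorem x_le (h : Chain m x s t) {i j : ℕ} (hij : i ≤ j) (hj : j ≤ m) : x i ≤ x j := by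
  induction j, hij using Nat.le_induction with
  | base => exact le_rfl
  | succ j _ ih =>
    exact (ih (by omega)).trans
      ((h.x_lt_s j hj).trans ((h.s_lt_t j hj).trans (h.t_lt_x j hj))).le

theorem lt_of_x_lt (h : Chain m x s t) {i j : ℕ} (hi : i ≤ m) (hx : x i < x j) : i < j := by
  by_contra h'
  exact (h.x_le (not_lt.1 h') hi).not_gt hx

theorem index_unique (h : Chain m x s t) {i j : ℕ} {y : I} (hi : i < m) (hj : j < m)
    (h1 : x i < y ∧ y < x (i + 1)) (h2 : x j < y ∧ y < x (j + 1)) : i = j := by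
  have h3 := h.lt_of_x_lt (by omega) (h1.1.trans h2.2)
  have h4 := h.lt_of_x_lt (by omega) (h2.1.trans h1.2)
  omega

theorem s_mem (h : Chain m x s t) {i : ℕ} (hi : i < m) : x i < s i ∧ s i < x (i + 1) :=
  ⟨h.x_lt_s i hi, (h.s_lt_t i hi).trans (h.t_lt_x i hi)⟩

theorem t_mem (h : Chain m x s t) {i : ℕ} (hi : i < m) : x i < t i ∧ t i < x (i + 1) :=
  ⟨(h.x_lt_s i hi).trans (h.s_lt_t i hi), h.t_lt_x i hi⟩

theorem exists_orderIso (neg : ℕ → Prop) (h : Chain m x s t) :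
    ∃ f : I ≃o I, (∀ y, f y ≠ y ↔ ∃ i < m, x i < y ∧ y < x (i + 1)) ∧
      (∀ i < m, neg i → f (t i) = s i) ∧ ∀ i < m, ¬ neg i → f (s i) = t i := by
  induction m with
  | zero => exact ⟨OrderIso.refl I, fun y => by simp, by simp, by simp⟩
  | succ m ih =>
    obtain ⟨f, hf, h1, h2⟩ := ih (h.mono m.le_succ)
    have hm := m.lt_succ_self
    obtain ⟨g, g1, g2, hg⟩ := exists_signed_bump (neg m) (h.x_lt_s m hm) (h.s_lt_t m hm)
      (h.t_lt_x m hm)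
    have hfix : ∀ y, x m < y → f y = y := fun y hy => not_not.1 fun hne => by
      obtain ⟨i, hi, h3, h4⟩ := (hf y).1 hne
      exact (h4.trans_le (h.x_le hi (by omega))).not_gt hy
    have gfix : ∀ i < m, ∀ y, x i < y ∧ y < x (i + 1) → g y = y := fun i hi y hy =>
      not_not.1 fun hne => ((hg y).1 hne).1.not_gt (hy.2.trans_le (h.x_le hi (by omega)))
    refine ⟨g.trans f, fun y => ?_, fun i hi hn => ?_, fun i hi hn => ?_⟩
    · rw [OrderIso.trans_apply]
      by_cases hy : x m < y ∧ y < x (m + 1)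
      · have hne := (hg y).2 hy
        have : g (g y) ≠ g y := fun he => hne (g.injective he)
        rw [hfix _ ((hg (g y)).1 this).1]
        exact iff_of_true hne ⟨m, hm, hy⟩
      · rw [not_not.1 fun hne => hy ((hg y).1 hne), hf]
        constructor
        · rintro ⟨i, hi, h'⟩
          exact ⟨i, by omega, h'⟩
        · rintro ⟨i, hi, h'⟩
          rcases Nat.lt_succ_iff_lt_or_eq.1 hi with hi | rfl
          · exact ⟨i, hi, h'⟩
          · exact absurd h' hy
    · rw [OrderIso.trans_apply]
      rcases Nat.lt_succ_iff_lt_or_eq.1 hi with hi' | rfl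
      · rw [gfix i hi' _ (h.t_mem hi), h1 i hi' hn]
      · rw [g1 hn, hfix _ (h.s_mem hi).1]
    · rw [OrderIso.trans_apply]
      rcases Nat.lt_succ_iff_lt_or_eq.1 hi with hi' | rfl
      · rw [gfix i hi' _ (h.s_mem hi), h2 i hi' hn]
      · rw [g2 hn, hfix _ (h.t_mem hi).1]

theorem exists_frame_of_map (h : Chain m x s t) (hm : 0 < m) {f : I ≃o I}
    (move : ∀ y, f y ≠ y ↔ ∃ i < m, x i < y ∧ y < x (i + 1))
    (neg : ∀ i < m, i < m / 2 → f (t i) = s i) (pos : ∀ i < m, m / 2 ≤ i → f (s i) = t i) :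
    ∃ (g : MarkedFun) (G : Frame g), g.map = f ∧ G.m = m ∧ G.x = x ∧ G.s = s ∧ G.t = t := by
  have fix : ∀ i ≤ m, f (x i) = x i := fun i hi => not_not.1 fun hne => by
    obtain ⟨j, hj, h1, h2⟩ := (move _).1 hne
    have h3 := h.lt_of_x_lt (by omega) h1
    have h4 := h.lt_of_x_lt hi h2
    omega
  refine ⟨⟨f, {y | ∃ i < m, y = s i}, ?_, ?_⟩,
    ⟨m, x, s, t, hm, h.x_lt_s, h.s_lt_t, h.t_lt_x, move, neg, pos, fun y => Iff.rfl⟩,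
    rfl, rfl, rfl, rfl, rfl⟩
  · rintro _ ⟨i, hi, rfl⟩
    exact (move _).2 ⟨i, hi, h.s_mem hi⟩
  · rintro u v ⟨huv, hu, hv, hmove⟩
    obtain ⟨z, hz, hz'⟩ := exists_between huv
    obtain ⟨i, hi, h1, h2⟩ := (move z).1 (hmove z hz hz')
    have hxu : x i = u := by
      rcases lt_trichotomy (x i) u with hlt | heq | hgt
      · exact absurd hu ((move u).2 ⟨i, hi, hlt, hz.trans h2⟩)
      · exact heq
      · exact absurd (fix i hi.le) (hmove _ hgt (h1.trans hz'))
    have hxv : x (i + 1) = v := by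
      rcases lt_trichotomy v (x (i + 1)) with hlt | heq | hgt
      · exact absurd hv ((move v).2 ⟨i, hi, h1.trans hz', hlt⟩)
      · exact heq.symm
      · exact absurd (fix (i + 1) hi) (hmove _ (hz.trans h2) hgt)
    subst hxu hxv
    refine ⟨s i, ⟨⟨i, hi, rfl⟩, h.s_mem hi⟩, ?_⟩
    rintro _ ⟨⟨j, hj, rfl⟩, hj'⟩
    rw [h.index_unique hj hi (h.s_mem hj) hj']

theorem exists_frame (h : Chain m x s t) (hm : 0 < m) :
    ∃ (g : MarkedFun) (G : Frame g), G.m = m ∧ G.x = x ∧ G.s = s ∧ G.t = t := by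
  obtain ⟨f, h1, h2, h3⟩ := h.exists_orderIso (fun i => i < m / 2)
  obtain ⟨g, G, -, hG⟩ := h.exists_frame_of_map hm h1 h2 fun i hi hi' => h3 i hi (not_lt.2 hi')
  exact ⟨g, G, hG⟩

end Chain

/-- The nested clause of a standard pair requires an actual choice of the reduct. -/
theorem Frame.exists_isReduct {f : MarkedFun} (F : Frame f) : ∃ f', IsReduct f f' := by
  have hm0 := F.m_pos
  rcases lt_or_ge 2 F.m with hm | hm
  · obtain ⟨g, h1, h2⟩ := exists_restrict f.map (F.map_x (i := 1) (by omega))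
      (F.map_x (i := F.m - 1) (by omega))
    have hin : ∀ i < F.m - 2, ∀ y, F.x (i + 1) < y → y < F.x (i + 1 + 1) → g y = f.map y :=
      fun i hi y hy hy' => h1 y ((F.x_le (by omega) (by omega)).trans hy.le)
        (hy'.le.trans (F.x_le (by omega) (by omega)))
    have hout : ∀ y, y ∉ innerOrbitals f.map → g y = y := by
      intro y hy
      by_cases h : F.x 1 ≤ y ∧ y ≤ F.x (F.m - 1)
      · rw [h1 y h.1 h.2]
        by_contra hne
        obtain ⟨i, hi, h3, h4⟩ := (F.move y).1 hne
        have h5 := F.lt_of_x_lt (by omega) (h.1.trans_lt h4)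
        have h6 := F.lt_of_x_lt hi.le (h3.trans_le h.2)
        exact hy (F.mem_innerOrbitals_iff.2 ⟨i, by omega, by omega, h3, h4⟩)
      · exact h2 y h
    have hch : Chain (F.m - 2) (fun i => F.x (i + 1)) (fun i => F.s (i + 1))
        (fun i => F.t (i + 1)) :=
      ⟨fun i hi => F.x_lt_s _ (by omega), fun i hi => F.s_lt_t _ (by omega),
        fun i hi => F.t_lt_x _ (by omega)⟩
    obtain ⟨f', F', hf', hm', hx, hs, ht⟩ := hch.exists_frame_of_map (by omega) (f := g)
      (fun y => by
        constructor
        · intro hne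
          have : y ∈ innerOrbitals f.map := by
            by_contra hn
            exact hne (hout y hn)
          obtain ⟨i, h0, hi, h4, h5⟩ := F.mem_innerOrbitals_iff.1 this
          obtain ⟨i, rfl⟩ : ∃ j, i = j + 1 := ⟨i - 1, by omega⟩
          exact ⟨i, by omega, h4, h5⟩
        · rintro ⟨i, hi, hy, hy'⟩
          rw [hin i hi y hy hy']
          exact F.map_ne (by omega) hy hy')
      (fun i hi hi' => by
        rw [hin i hi _ (F.x_lt_t (by omega)) (F.t_lt_x _ (by omega))]
        exact F.neg _ (by omega) (by omega))
      (fun i hi hi' => by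
        rw [hin i hi _ (F.x_lt_s _ (by omega)) (F.s_lt_x (by omega))]
        exact F.pos _ (by omega) (by omega))
    refine ⟨f', Or.inl ⟨by rwa [F.ncard_orbitals], fun y hy => ?_, fun y hy => ?_, ?_⟩⟩
    · obtain ⟨i, h0, hi, h4, h5⟩ := F.mem_innerOrbitals_iff.1 hy
      obtain ⟨i, rfl⟩ : ∃ j, i = j + 1 := ⟨i - 1, by omega⟩
      rw [hf', hin i (by omega) y h4 h5]
    · rw [hf', hout y hy]
    · ext y
      rw [F'.marks, Set.mem_inter_iff, F.marks, hm', hs]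
      constructor
      · rintro ⟨i, hi, rfl⟩
        exact ⟨⟨i + 1, by omega, rfl⟩, F.mem_innerOrbitals_iff.2 ⟨i + 1, by omega, by omega,
          F.x_lt_s _ (by omega), F.s_lt_x (by omega)⟩⟩
      · rintro ⟨⟨i, hi, rfl⟩, hy⟩
        obtain ⟨j, h0, hj, h4, h5⟩ := F.mem_innerOrbitals_iff.1 hy
        obtain rfl := F.index_unique hi (by omega) ⟨F.x_lt_s i hi, F.s_lt_x hi⟩ ⟨h4, h5⟩
        exact ⟨i - 1, by omega, congrArg F.s (Nat.sub_add_cancel h0).symm⟩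
  · have hi : F.m - 1 < F.m := by omega
    obtain ⟨s, hs, hs'⟩ := exists_between (F.x_lt_s _ hi)
    obtain ⟨t, ht, ht'⟩ := exists_between hs'
    have hch : Chain 1 (fun i => if i = 0 then F.x (F.m - 1) else F.s (F.m - 1)) (fun _ => s)
        (fun _ => t) :=
      ⟨fun i hi => by obtain rfl : i = 0 := by omega
                      exact hs,
        fun i hi => ht, fun i hi => ht'⟩
    obtain ⟨f', F', hm', hx, -, -⟩ := hch.exists_frame one_pos
    have hpos : IsPosOrbital f'.map (F.x (F.m - 1)) (F.s (F.m - 1)) :=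
      F'.isPosOrbital_iff.2 ⟨0, by omega, by omega, by rw [hx]; rfl, by rw [hx]; rfl⟩
    refine ⟨f', Or.inr ⟨by rwa [F.ncard_orbitals], F.x (F.m - 1), F.x (F.m - 1 + 1),
      F.s (F.m - 1), F.isPosOrbital_iff.2 ⟨F.m - 1, hi, by omega, rfl, rfl⟩, ?_,
      F.x_lt_s _ hi, F.s_lt_x hi, fun y => ?_, hpos⟩⟩
    · exact (F.marks _).2 ⟨_, hi, rfl⟩
    · rw [F'.move, hm', hx]
      constructor
      · rintro ⟨i, hi, h⟩
        obtain rfl : i = 0 := by omega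
        exact h
      · exact fun h => ⟨0, one_pos, h⟩

/-- Inner orbitals keep their feet, and a one-bump reduct lives on a foot. Hence disjointness of
feet passes to reducts and has to be checked only once. -/
theorem IsReduct.feet_subset {f f' : MarkedFun} (h : IsReduct f f') (F : Frame f) :
    f'.feet ⊆ f.feet := by
  have hm0 := F.m_pos
  intro y hy
  rcases lt_or_ge 2 F.m with hm | hm
  · obtain ⟨F', h1, h2, h3, h4⟩ := F.exists_frame_of_isReduct h hm
    obtain ⟨i, hi, hy⟩ := F'.mem_feet_iff.1 hy
    rw [h2, h2, h3, h4] at hy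
    exact F.mem_feet_iff.2 ⟨i + 1, by omega, hy⟩
  · obtain ⟨F', h1, h2, h3⟩ := F.exists_frame_of_isReduct_small h hm
    have h4 := F'.x_zero_lt_of_mem_feet hy
    have h5 := F'.lt_x_of_mem_feet hy
    rw [h1, h3] at h5
    rw [h2] at h4
    exact F.left_foot_subset (by omega) h4 h5

/-! ### Realization of patterns of transition points -/

/-- A strictly increasing sequence of points. -/
def gridPoint (n : ℕ) : I := ⟨1 - 1 / (n + 1), by
  have h : (0 : ℝ) < n + 1 := by positivity
  have h1 : 1 / ((n : ℝ) + 1) ≤ 1 := by rw [div_le_one h]; linarith [n.cast_nonneg (α := ℝ)]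
  have h2 : 0 ≤ 1 / ((n : ℝ) + 1) := by positivity
  constructor <;> linarith⟩

theorem gridPoint_strictMono : StrictMono gridPoint := by
  intro n m h
  show (1 : ℝ) - 1 / (n + 1) < 1 - 1 / (m + 1)
  have := one_div_lt_one_div_of_lt (by positivity : (0 : ℝ) < n + 1)
    (by exact_mod_cast Nat.succ_lt_succ h : (n : ℝ) + 1 < m + 1)
  linarith

/-- The marked function `f` has the transition points numbered by the list `P`; if `P` is a
singleton, `f` is a bump on a short interval to the right of its only element. -/
inductive Realizes (P : List ℕ) (f : MarkedFun) : Prop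
  | bump (w : ℕ) (F : Frame f) : P = [w] → F.m = 1 → F.x 0 = gridPoint (3 * w + 1) →
      F.x 1 = gridPoint (3 * w + 2) → Realizes P f
  | chain (F : Frame f) : P.length = F.m + 1 →
      (∀ i ≤ F.m, F.x i = gridPoint (3 * P.getD i 0 + 1)) →
      (∀ i < F.m, F.s i = gridPoint (3 * P.getD i 0 + 2)) → Realizes P f

theorem getD_mem {P : List ℕ} {i : ℕ} (h : i < P.length) : P.getD i 0 ∈ P := by
  rw [List.getD_eq_getElem _ _ h]
  exact List.getElem_mem h

theorem Realizes.exists_frame {P : List ℕ} {f : MarkedFun} (h : Realizes P f) :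
    ∃ F : Frame f, (∃ p ∈ P, F.x 0 = gridPoint (3 * p + 1)) ∧
      ∃ p ∈ P, F.x F.m ≤ gridPoint (3 * p + 2) := by
  cases h with
  | bump w F hP hm h0 h1 =>
    subst hP
    exact ⟨F, ⟨w, by simp, h0⟩, w, by simp, by rw [hm, h1]⟩
  | chain F hP hx hs =>
    exact ⟨F, ⟨_, getD_mem (by omega), hx 0 (Nat.zero_le _)⟩, _, getD_mem (by omega),
      (hx _ le_rfl).trans_le (gridPoint_strictMono.monotone (Nat.le_succ _))⟩

theorem getD_cons_concat {Q : List ℕ} (q q' : ℕ) {i : ℕ} (h : i < Q.length) :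
    (q :: Q ++ [q']).getD (i + 1) 0 = Q.getD i 0 := by
  rw [List.cons_append, List.getD_cons_succ, List.getD_append _ _ _ _ h]

/-- Lists of transition points reproduce the reduct by dropping both ends. If a single number
remains, the reduct is the bump on the left foot that starts there. -/
theorem Realizes.reduct {Q : List ℕ} {q q' : ℕ} {g g' : MarkedFun}
    (h : Realizes (q :: Q ++ [q']) g) (hQ : Q ≠ []) (hg : IsReduct g g') : Realizes Q g' := by
  have hlen := List.length_pos_iff.2 hQ
  cases h with
  | bump w F hP hm h0 h1 =>
    have := congrArg List.length hP
    simp at this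
  | chain F hP hx hs =>
    simp only [List.length_append, List.length_cons, List.length_nil] at hP
    rcases lt_or_ge 2 F.m with hm | hm
    · obtain ⟨F', h1, h2, h3, -⟩ := F.exists_frame_of_isReduct hg hm
      refine .chain F' (by omega) (fun i hi => ?_) fun i hi => ?_
      · rw [h2, hx _ (by omega), getD_cons_concat _ _ (by omega)]
      · rw [h3, hs _ (by omega), getD_cons_concat _ _ (by omega)]
    · obtain ⟨F', h1, h2, h3⟩ := F.exists_frame_of_isReduct_small hg hm
      have hm' : F.m = 2 := by omega
      obtain ⟨w, rfl⟩ := List.length_eq_one_iff.1 (by omega : Q.length = 1)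
      refine .bump w F' rfl h1 ?_ ?_
      · rw [h2, hm', hx 1 (by omega)]
        rfl
      · rw [h3, hm', hs 1 (by omega)]
        rfl

theorem Realizes.reduct_pair {q q' : ℕ} {g g' : MarkedFun}
    (h : Realizes [q, q'] g) (hg : IsReduct g g') : Realizes [q] g' := by
  cases h with
  | bump w F hP hm h0 h1 => simp at hP
  | chain F hP hx hs =>
    have hm : F.m = 1 := by simpa using hP.symm
    obtain ⟨F', h1, h2, h3⟩ := F.exists_frame_of_isReduct_small hg (by omega)
    refine .bump q F' rfl h1 ?_ ?_
    · rw [h2, hm, hx 0 (by omega)]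
      rfl
    · rw [h3, hm, hs 0 (by omega)]
      rfl

/-- Combinatorial description of the standard pairs of a given depth. -/
inductive Pattern : ℕ → List ℕ → List ℕ → Prop
  | left {P Q : List ℕ} : Q ≠ [] → (∀ p ∈ P, ∀ q ∈ Q, p < q) → Pattern 0 P Q
  | mid {P Q : List ℕ} {z : ℕ} : Q ≠ [] → P ≠ [] → (∀ q ∈ Q, ∀ p ∈ P, q < p) →
      (∀ p ∈ P, p < z) → Pattern 1 P (Q ++ [z])
  | nest {k : ℕ} {P Q : List ℕ} {p p' q q' : ℕ} : Pattern k P Q → q < p →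
      (∀ n ∈ P ++ Q, p < n ∧ n < p') → p' < q' →
      Pattern (k + 2) (p :: P ++ [p']) (q :: Q ++ [q'])

theorem Pattern.ne_nil {k : ℕ} {P Q : List ℕ} (h : Pattern k P Q) : Q ≠ [] := by
  cases h <;> simp_all

theorem Pattern.map {φ : ℕ → ℕ} (hφ : StrictMono φ) {k : ℕ} {P Q : List ℕ} (h : Pattern k P Q) :
    Pattern k (P.map φ) (Q.map φ) := by
  induction h with
  | left hQ h => exact .left (by simpa using hQ) (by simpa [hφ.lt_iff_lt] using h)
  | mid hQ hP h h' =>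
    rw [List.map_append]
    exact .mid (by simpa using hQ) (by simpa using hP) (by simpa [hφ.lt_iff_lt] using h)
      (by simpa [hφ.lt_iff_lt] using h')
  | nest h h1 h2 h3 ih =>
    simp only [List.map_append, List.map_cons, List.map_nil]
    refine .nest ih (hφ h1) ?_ (hφ h3)
    rw [← List.map_append]
    intro n hn
    obtain ⟨m, hm, rfl⟩ := List.mem_map.1 hn
    exact ⟨hφ (h2 m hm).1, hφ (h2 m hm).2⟩

/-- The clauses mirror zero, one and two unfoldings of the definition of standard pairs. The
inequalities between numbers give the positions, and disjointness of feet is inherited by the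
reducts. -/
theorem Pattern.standardPairDepth {k : ℕ} {P Q : List ℕ} (h : Pattern k P Q) :
    ∀ {f g : MarkedFun}, Realizes P f → Realizes Q g → Fast f g → StandardPairDepth k f g := by
  have hleft : ∀ {P Q : List ℕ} {f g : MarkedFun}, (∀ p ∈ P, ∀ q ∈ Q, p < q) → Realizes P f →
      Realizes Q g → Fast f g → StandardPairDepth 0 f g := by
    intro P Q f g h hf hg hfast
    obtain ⟨F, -, p, hp, h1⟩ := hf.exists_frame
    obtain ⟨G, ⟨q, hq, h2⟩, -⟩ := hg.exists_frame
    refine .left hfast ((F.leftOf_iff G).2 (h1.trans ?_))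
    rw [h2]
    have := h p hp q hq
    exact gridPoint_strictMono.monotone (by omega)
  induction h with
  | left hQ h => exact hleft h
  | @mid P Q z hQ hP h h' =>
    intro f g hf hg hfast
    obtain ⟨F, ⟨p, hp, h1⟩, p', hp', h2⟩ := hf.exists_frame
    have hlen := List.length_pos_iff.2 hQ
    cases hg with
    | bump w G hP hm h0 h1 =>
      have := congrArg List.length hP
      simp only [List.length_append, List.length_cons, List.length_nil] at this
      omega
    | chain G hl hx hs =>
      simp only [List.length_append, List.length_cons, List.length_nil] at hl
      have hm : Q.length = G.m := by omega
      have hxm : G.x G.m = gridPoint (3 * z + 1) := by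
        rw [hx _ le_rfl, ← hm, List.getD_append_right _ _ _ _ le_rfl]
        simp
      have hQm : ∀ i < G.m, (Q ++ [z]).getD i 0 ∈ Q := fun i hi => by
        rw [List.getD_append _ _ _ _ (by omega)]
        exact getD_mem (by omega)
      have hsp : ∀ i < G.m, gridPoint (3 * (Q ++ [z]).getD i 0 + 2) ≤ F.x 0 := fun i hi => by
        have := h _ (hQm i hi) _ hp
        rw [h1]
        exact gridPoint_strictMono.monotone (by omega)
      have hxp : ∀ i < G.m, G.x i < F.x 0 := fun i hi => by
        rw [hx i hi.le]
        exact (gridPoint_strictMono (by omega)).trans_le (hsp i hi)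
      have hin : Inside f g := by
        refine (F.inside_iff G).2 ⟨hxp 0 G.m_pos, h2.trans_lt ?_⟩
        rw [hxm]
        have := h' p' hp'
        exact gridPoint_strictMono (by omega)
      obtain ⟨g', hred⟩ := G.exists_isReduct
      refine .inside hfast hin hred (.left (hfast.symm.mono_left (hred.feet_subset G)) ?_)
      rcases lt_or_ge 2 G.m with hm2 | hm2
      · obtain ⟨G', e1, e2, -, -⟩ := G.exists_frame_of_isReduct hred hm2
        rw [G'.leftOf_iff F, e2, e1]
        exact (hxp _ (by omega)).le
      · obtain ⟨G', e1, -, e2⟩ := G.exists_frame_of_isReduct_small hred hm2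
        rw [G'.leftOf_iff F, e1, e2, hs _ (by omega)]
        exact hsp _ (by omega)
  | @nest k P Q p p' q q' hpat hqp hn hpq ih =>
    intro f g hf hg hfast
    have hQ := hpat.ne_nil
    have bounds : ∀ {p p' : ℕ} {P : List ℕ} {f : MarkedFun}, Realizes (p :: P ++ [p']) f →
        ∃ F : Frame f, F.x 0 = gridPoint (3 * p + 1) ∧ F.x F.m = gridPoint (3 * p' + 1) := by
      intro p p' P f hf
      cases hf with
      | bump w F hP =>
        have := congrArg List.length hP
        simp at this
      | chain F hl hx hs =>
        refine ⟨F, hx 0 (Nat.zero_le _), ?_⟩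
        simp only [List.length_append, List.length_cons, List.length_nil] at hl
        rw [hx _ le_rfl, List.getD_append_right _ _ _ _ (by simp; omega)]
        simp [show F.m = P.length + 1 by omega]
    obtain ⟨F, hF0, hFm⟩ := bounds hf
    obtain ⟨G, hG0, hGm⟩ := bounds hg
    obtain ⟨g', hgr⟩ := G.exists_isReduct
    obtain ⟨f', hfr⟩ := F.exists_isReduct
    have hg' := hg.reduct hQ hgr
    have hfast' := hfast.symm.mono_left (hgr.feet_subset G)
    have hfast'' := hfast'.symm.mono_left (hfr.feet_subset F)
    have hin : Inside f g := by
      rw [F.inside_iff G, hF0, hFm, hG0, hGm]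
      exact ⟨gridPoint_strictMono (by omega), gridPoint_strictMono (by omega)⟩
    have hin' : Inside g' f := by
      obtain ⟨G', ⟨n, hn1, h1⟩, n', hn2, h2⟩ := hg'.exists_frame
      have h3 := hn n (List.mem_append_right _ hn1)
      have h4 := hn n' (List.mem_append_right _ hn2)
      rw [G'.inside_iff F, hF0, hFm, h1]
      exact ⟨gridPoint_strictMono (by omega), h2.trans_lt (gridPoint_strictMono (by omega))⟩
    refine .inside hfast hin hgr (.inside hfast' hin' hfr ?_)
    -- Then f has the single orbital from p to p', and its reduct is a bump next to p, to the left
    -- of everything in Q.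
    by_cases hP : P = []
    · subst hP
      have hk : k = 0 := by
        cases hpat with
        | left => rfl
        | mid _ h => exact absurd rfl h
      subst hk
      exact hleft (fun a ha n hn' => by
        rw [List.mem_singleton.1 ha]
        exact (hn n (List.mem_append_right _ hn')).1) (hf.reduct_pair hfr) hg' hfast''
    · exact ih (hf.reduct hP hfr) hg' hfast''

/-- Each number p owns the block of grid points 3p, 3p + 1, 3p + 2: the transition point is in the
middle, the right foot ending there starts at 3p, and the left foot starting there ends at 3p + 2.
Distinct numbers therefore have disjoint feet around them. -/
theorem exists_realizes {P : List ℕ} (hP : P.Pairwise (· < ·)) (hlen : 2 ≤ P.length) :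
    ∃ f, IsStandard f ∧ Realizes P f ∧
      (∀ z ∈ f.feet, ∃ p ∈ P, gridPoint (3 * p) ≤ z ∧ z < gridPoint (3 * p + 2)) ∧
      ∀ L l r, P = L ++ [l, r] → IsMaxOrbital f.map (gridPoint (3 * l + 1)) (gridPoint (3 * r + 1)) := by
  have hlt : ∀ i < P.length - 1, P.getD i 0 < P.getD (i + 1) 0 := fun i hi => by
    rw [List.getD_eq_getElem _ _ (by omega), List.getD_eq_getElem _ _ (by omega)]
    exact List.pairwise_iff_getElem.1 hP _ _ _ _ (Nat.lt_succ_self i)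
  have hch : Chain (P.length - 1) (fun i => gridPoint (3 * P.getD i 0 + 1))
      (fun i => gridPoint (3 * P.getD i 0 + 2)) (fun i => gridPoint (3 * P.getD (i + 1) 0)) :=
    ⟨fun i hi => gridPoint_strictMono (by omega),
      fun i hi => gridPoint_strictMono (by have := hlt i hi; omega),
      fun i hi => gridPoint_strictMono (by omega)⟩
  obtain ⟨f, F, hm, hx, hs, ht⟩ := hch.exists_frame (by omega)
  refine ⟨f, F.isStandard, .chain F (by omega) (fun i hi => by rw [hx]) (fun i hi => by rw [hs]),
    fun z hz => ?_, fun L l r he => ?_⟩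
  · obtain ⟨i, hi, h | h⟩ := F.mem_feet_iff.1 hz
    · rw [hx, hs] at h
      exact ⟨_, getD_mem (i := i) (by omega),
        (gridPoint_strictMono.monotone (Nat.le_succ _)).trans h.1.le, h.2⟩
    · rw [hx, ht] at h
      exact ⟨_, getD_mem (i := i + 1) (by omega), h.1, h.2.trans (gridPoint_strictMono (by omega))⟩
  · rw [F.isMaxOrbital_iff, hx, hm, he]
    have h1 : (L ++ [l, r]).length - 1 = L.length + 1 := by simp
    rw [h1]
    dsimp only
    rw [List.getD_append_right _ _ _ _ (by omega), List.getD_append_right _ _ _ _ (by omega)]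
    simp

/-- The lists `P i` describe the transition points of functions with signature `A`. -/
structure Describes (A : PairFun) (P : ℕ → List ℕ) : Prop where
  sorted : ∀ i < A.card, (P i).Pairwise (· < ·)
  two_le : ∀ i < A.card, 2 ≤ (P i).length
  disjoint : ∀ i < A.card, ∀ j < A.card, i ≠ j → ∀ n ∈ P i, n ∉ P j
  pattern : ∀ i j, i < j → j < A.card → Pattern (A.val i j) (P i) (P j)

/-- The place `h` lies in the last interval determined by each of the lists `P i`. -/
def HasGap (A : PairFun) (P : ℕ → List ℕ) (h : ℕ) : Prop :=
  0 < h ∧ ∀ i < A.card, ∃ L r, P i = L ++ [r] ∧ L ≠ [] ∧ (∀ n ∈ L, n < h) ∧ h ≤ r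

theorem Describes.exists_hasSignature {A : PairFun} {P : ℕ → List ℕ} (hP : Describes A P) :
    ∃ a : Fin A.card → MarkedFun, HasSignature A a ∧
      ∀ h, HasGap A P h → IsGap a (gridPoint (3 * h - 1)) (gridPoint (3 * h)) := by
  choose a h1 h2 h3 h4 using fun i : Fin A.card =>
    exists_realizes (hP.sorted i i.2) (hP.two_le i i.2)
  have hfast : ∀ i j : Fin A.card, i ≠ j → Fast (a i) (a j) := by
    intro i j hij
    refine Set.disjoint_left.2 fun z hz hz' => ?_
    obtain ⟨p, hp, hp1, hp2⟩ := h3 i z hz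
    obtain ⟨q, hq, hq1, hq2⟩ := h3 j z hz'
    have e1 := gridPoint_strictMono.lt_iff_lt.1 (hp1.trans_lt hq2)
    have e2 := gridPoint_strictMono.lt_iff_lt.1 (hq1.trans_lt hp2)
    obtain rfl : p = q := by omega
    exact hP.disjoint i i.2 j j.2 (Fin.val_ne_of_ne hij) p hp hq
  have hdepth : ∀ i j : Fin A.card, i < j → StandardPairDepth (A.val i j) (a i) (a j) :=
    fun i j hij => (hP.pattern i j hij j.2).standardPairDepth (h2 i) (h2 j) (hfast i j hij.ne)
  refine ⟨a, ⟨⟨h1, fun i j hij => (hdepth i j hij).standardPair⟩, fun i j hij =>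
    (hdepth i j hij).osc_eq (h1 i).nonempty_frame.some (h1 j).nonempty_frame.some⟩, ?_⟩
  -- The interval from 3h - 1 to 3h runs from the end of the block of h - 1 to the start of the
  -- block of h, so no foot enters it. Positivity of h keeps the natural subtraction from
  -- truncating.
  rintro h ⟨hpos, hgap⟩
  refine ⟨gridPoint_strictMono (by omega), fun j => ⟨?_, ?_⟩⟩
  · obtain ⟨L, r, hL, hne, hlt, hle⟩ := hgap j j.2
    obtain rfl | ⟨L, l, rfl⟩ := List.eq_nil_or_concat' L
    · exact absurd rfl hne
    have := hlt l (by simp)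
    exact ⟨_, _, h4 j L l r (by simpa using hL), gridPoint_strictMono.monotone (by omega),
      gridPoint_strictMono.monotone (by omega)⟩
  · refine Set.disjoint_left.2 fun z hz hz' => ?_
    obtain ⟨p, -, hp1, hp2⟩ := h3 j z hz'
    have e1 := gridPoint_strictMono.lt_iff_lt.1 (hp1.trans_lt hz.2)
    have e2 := gridPoint_strictMono.lt_iff_lt.1 (hz.1.trans hp2)
    omega

theorem exists_forall_mem_lt (P : ℕ → List ℕ) (m : ℕ) : ∃ N, ∀ i < m, ∀ n ∈ P i, n < N := by
  refine ⟨((Finset.range m).sup fun i => (P i).foldr max 0) + 1, fun i hi n hn => ?_⟩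
  have h1 : ∀ l : List ℕ, n ∈ l → n ≤ l.foldr max 0 := by
    intro l
    induction l with
    | nil => simp
    | cons a l ih =>
      intro h
      rcases List.mem_cons.1 h with rfl | h
      · exact le_max_left _ _
      · exact (ih h).trans (le_max_right _ _)
  have := (h1 _ hn).trans (Finset.le_sup (f := fun i => (P i).foldr max 0) (Finset.mem_range.2 hi))
  omega

/-- The lists of `P` relabelled by `φ`, followed by the lists of `Q` relabelled by `ψ`. -/
def joinLists (m : ℕ) (P Q : ℕ → List ℕ) (φ ψ : ℕ → ℕ) (i : ℕ) : List ℕ :=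
  if i < m then (P i).map φ else (Q (i - m)).map ψ

theorem Describes.glue {k : ℕ} {B C : PairFun} {P Q : ℕ → List ℕ} (hP : Describes B P)
    (hQ : Describes C Q) {φ ψ : ℕ → ℕ} (hφ : StrictMono φ) (hψ : StrictMono ψ)
    (hdis : ∀ i < B.card, ∀ j < C.card, ∀ n ∈ P i, ∀ n' ∈ Q j, φ n ≠ ψ n')
    (hpat : ∀ i < B.card, ∀ j < C.card, Pattern k ((P i).map φ) ((Q j).map ψ)) :
    Describes (PairFun.glue k B C) (joinLists B.card P Q φ ψ) where
  sorted i hi := by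
    rw [joinLists]
    split_ifs with h
    · exact List.Pairwise.map _ (fun _ _ hab => hφ hab) (hP.sorted i h)
    · exact List.Pairwise.map _ (fun _ _ hab => hψ hab)
        (hQ.sorted _ (by rw [PairFun.card_glue] at hi; omega))
  two_le i hi := by
    rw [joinLists]
    split_ifs with h
    · rw [List.length_map]
      exact hP.two_le i h
    · rw [List.length_map]
      exact hQ.two_le _ (by rw [PairFun.card_glue] at hi; omega)
  disjoint i hi j hj hij n := by
    rw [PairFun.card_glue] at hi hj
    rw [joinLists, joinLists]
    split_ifs with h1 h2 h2 <;> intro hn hn' <;> obtain ⟨a, ha, rfl⟩ := List.mem_map.1 hn <;>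
      obtain ⟨b, hb, he⟩ := List.mem_map.1 hn'
    · obtain rfl := hφ.injective he
      exact hP.disjoint i h1 j h2 hij _ ha hb
    · exact hdis i h1 _ (by omega) a ha b hb he.symm
    · exact hdis j h2 _ (by omega) b hb a ha he
    · obtain rfl := hψ.injective he
      exact hQ.disjoint _ (by omega) _ (by omega) (by omega) _ ha hb
  pattern i j hij hj := by
    rw [PairFun.card_glue] at hj
    rw [PairFun.val_glue, joinLists, joinLists]
    by_cases h2 : j < B.card
    · rw [if_pos h2, if_pos (hij.trans h2), if_pos h2]
      exact (hP.pattern i j hij h2).map hφ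
    · rw [if_neg h2, if_neg h2]
      by_cases h1 : i < B.card
      · rw [if_pos h1, if_pos hj, if_pos h1]
        exact hpat i h1 _ (by omega)
      · rw [if_neg h1, if_neg h1]
        exact (hQ.pattern _ _ (by omega) (by omega)).map hψ

theorem Describes.ne_nil {A : PairFun} {P : ℕ → List ℕ} (hP : Describes A P) {i : ℕ}
    (hi : i < A.card) : P i ≠ [] := fun h => by
  have := hP.two_le i hi
  rw [h] at this
  simp at this

/-- Shift the second pattern past the first. -/
theorem Describes.exists_add {B C : PairFun} {P Q : ℕ → List ℕ} (hP : Describes B P)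
    (hQ : Describes C Q) : ∃ R, Describes (B + C) R := by
  obtain ⟨N, hN⟩ := exists_forall_mem_lt P B.card
  refine ⟨_, hP.glue hQ strictMono_id (ψ := fun n => n + N) (fun a b h => by simpa using h)
    (fun i hi j hj n hn n' _ => ?_) fun i hi j hj => .left (by simpa using hQ.ne_nil hj) ?_⟩
  · have := hN i hi n hn
    dsimp only [id]
    omega
  · rw [List.map_id]
    intro n hn n' hn'
    obtain ⟨b, _, rfl⟩ := List.mem_map.1 hn'
    have := hN i hi n hn
    omega

/-- The first pattern is inserted into the gap of the second, hence into the last orbital of each of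
its functions. The gap of the inserted pattern then lies in the last interval of every list of the
product. -/
theorem Describes.exists_mul {B C : PairFun} {P Q : ℕ → List ℕ} {p q : ℕ} (hP : Describes B P)
    (hQ : Describes C Q) (hp : HasGap B P p) (hq : HasGap C Q q) :
    ∃ R, Describes (B * C) R ∧ HasGap (B * C) R (p + q) := by
  obtain ⟨N, hN⟩ := exists_forall_mem_lt P B.card
  -- Opens the place q by N + p numbers: the inserted lists, shifted by q, lie below q + N, and the
  -- new gap p + q lies at or below every shifted right end.
  set ψ : ℕ → ℕ := fun n => if n < q then n else n + (N + p) with hψ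
  have hψ1 : ∀ n, n < q → ψ n = n := fun n h => if_pos h
  have hψ2 : ∀ n, q ≤ n → ψ n = n + (N + p) := fun n h => if_neg (not_lt.2 h)
  have hψm : StrictMono ψ := by
    intro a b h
    rcases lt_or_ge a q with ha | ha <;> rcases lt_or_ge b q with hb | hb
    · rwa [hψ1 a ha, hψ1 b hb]
    · rw [hψ1 a ha, hψ2 b hb]
      omega
    · omega
    · rw [hψ2 a ha, hψ2 b hb]
      omega
  clear_value ψ
  refine ⟨_, hP.glue hQ (φ := fun n => n + q) (fun a b h => by simpa using h) hψm
    (fun i hi j hj n hn n' hn' => ?_) fun i hi j hj => ?_, by have := hp.1; omega,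
    fun i hi => ?_⟩
  · have := hN i hi n hn
    rcases lt_or_ge n' q with h | h
    · rw [hψ1 n' h]
      omega
    · rw [hψ2 n' h]
      omega
  · obtain ⟨L, r, hL, hne, h1, h2⟩ := hq.2 j hj
    rw [hL, List.map_append]
    refine .mid (by simpa using hne) (by simpa using hP.ne_nil hi) ?_ ?_
    · intro a ha b hb
      obtain ⟨a', ha', rfl⟩ := List.mem_map.1 ha
      obtain ⟨b', -, rfl⟩ := List.mem_map.1 hb
      have := h1 a' ha'
      rw [hψ1 a' this]
      omega
    · intro b hb
      obtain ⟨b', hb', rfl⟩ := List.mem_map.1 hb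
      have := hN i hi b' hb'
      rw [hψ2 r h2]
      omega
  · rw [PairFun.card_mul] at hi
    rw [joinLists]
    split_ifs with h
    · obtain ⟨L, r, hL, hne, h1, h2⟩ := hp.2 i h
      refine ⟨L.map fun n => n + q, r + q, by rw [hL, List.map_append]; rfl, by simpa using hne,
        fun n hn => ?_, by omega⟩
      obtain ⟨a, ha, rfl⟩ := List.mem_map.1 hn
      have := h1 a ha
      omega
    · obtain ⟨L, r, hL, hne, h1, h2⟩ := hq.2 (i - B.card) (by omega)
      refine ⟨L.map ψ, ψ r, by rw [hL, List.map_append]; rfl, by simpa using hne,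
        fun n hn => ?_, ?_⟩
      · obtain ⟨a, ha, rfl⟩ := List.mem_map.1 hn
        have := h1 a ha
        rw [hψ1 a this]
        omega
      · rw [hψ2 r h2]
        omega

/-- One new number on each side of every list raises the depth of every pair by two, provided that
the new pairs are nested in increasing order. -/
theorem Describes.exists_E {A : PairFun} {P : ℕ → List ℕ} (hP : Describes A P) :
    ∃ R h, Describes A.exp.exp R ∧ HasGap A.exp.exp R h := by
  obtain ⟨N, hN⟩ := exists_forall_mem_lt P A.card
  have hmem : ∀ i < A.card, ∀ n ∈ (P i).map (fun n => n + A.card), A.card ≤ n ∧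
      n < A.card + N := by
    intro i hi n hn
    obtain ⟨a, ha, rfl⟩ := List.mem_map.1 hn
    have := hN i hi a ha
    omega
  have hmem' : ∀ i < A.card, ∀ n ∈ (A.card - 1 - i) :: (P i).map (fun n => n + A.card) ++
      [A.card + N + i + 1], n = A.card - 1 - i ∨ n ∈ (P i).map (fun n => n + A.card) ∨
      n = A.card + N + i + 1 := by
    intro i _ n hn
    rw [List.cons_append] at hn
    rcases List.mem_cons.1 hn with h | h
    · exact Or.inl h
    · rcases List.mem_append.1 h with h | h
      · exact Or.inr (Or.inl h)
      · exact Or.inr (Or.inr (List.mem_singleton.1 h))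
  -- The old numbers are moved to the interval from A.card to A.card + N; the new ends spread
  -- outwards as i grows. All right ends are at least A.card + N + 1 and all other entries are
  -- smaller, so this number is a common gap.
  refine ⟨fun i => (A.card - 1 - i) :: (P i).map (fun n => n + A.card) ++ [A.card + N + i + 1],
    A.card + N + 1, ⟨fun i hi => ?_, fun i hi => ?_, fun i hi j hj hij n hn hn' => ?_,
    fun i j hij hj => ?_⟩, by omega, fun i hi => ?_⟩
  all_goals simp only [PairFun.card_exp] at *
  · rw [List.cons_append, List.pairwise_cons, List.pairwise_append]
    refine ⟨fun n hn => ?_, List.Pairwise.map _ (fun _ _ hab => Nat.add_lt_add_right hab _)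
      (hP.sorted i hi), List.pairwise_singleton _ _, fun n hn n' hn' => ?_⟩
    · rcases List.mem_append.1 hn with h | h
      · have := (hmem i hi n h).1
        omega
      · rw [List.mem_singleton.1 h]
        omega
    · rw [List.mem_singleton.1 hn']
      have := (hmem i hi n hn).2
      omega
  · simp
  · rcases hmem' i hi n hn with h | h | h <;> rcases hmem' j hj n hn' with h' | h' | h'
    · omega
    · have := hmem j hj n h'
      omega
    · omega
    · have := hmem i hi n h
      omega
    · obtain ⟨a, ha, rfl⟩ := List.mem_map.1 h
      obtain ⟨b, hb, he⟩ := List.mem_map.1 h'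
      obtain rfl : b = a := by omega
      exact hP.disjoint i hi j hj hij _ ha hb
    · have := hmem i hi n h
      omega
    · omega
    · have := hmem j hj n h'
      omega
    · omega
  · have hi := hij.trans hj
    have hval : A.exp.exp.val i j = A.val i j + 2 := by
      rw [PairFun.val_exp, PairFun.val_exp, PairFun.card_exp, if_pos ⟨hij, hj⟩,
        if_pos ⟨hij, hj⟩]
    rw [hval]
    refine .nest ((hP.pattern i j hij hj).map fun a b h => Nat.add_lt_add_right h _)
      (by omega) (fun n hn => ?_) (by omega)
    rcases List.mem_append.1 hn with h | h
    · have := hmem i hi n h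
      omega
    · have := hmem j hj n h
      omega
  · refine ⟨_, _, rfl, by simp, fun n hn => ?_, by omega⟩
    rcases List.mem_cons.1 hn with h | h
    · omega
    · have := hmem i hi n h
      omega

/-- As with terms, exp A is carried along: exp of a sum is a product, for which gaps of both factors
are available, and exp of exp A is obtained by wrapping. A gap is claimed only for exponentials,
since the parts of a sum have no common place for one. -/
theorem IsArith.exists_describes {A : PairFun} (h : IsArith A) :
    (∃ P, Describes A P) ∧ ∃ P h, Describes A.exp P ∧ HasGap A.exp P h := by
  have hcard : ∀ A : PairFun, A.card ≤ 1 → ∃ P, Describes A P ∧ HasGap A P 1 := fun A hA =>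
    ⟨fun _ => [0, 1], ⟨fun _ _ => by simp, fun _ _ => by simp, fun i hi j hj hij => by omega,
      fun i j hij hj => by omega⟩, one_pos, fun i _ => ⟨[0], 1, rfl, by simp, by simp, le_rfl⟩⟩
  induction h with
  | zero =>
    obtain ⟨P, hP, -⟩ := hcard 0 zero_le_one
    exact ⟨⟨P, hP⟩, ⟨_, _, (hcard (PairFun.exp 0) zero_le_one).choose_spec⟩⟩
  | one =>
    obtain ⟨P, hP, -⟩ := hcard 1 le_rfl
    exact ⟨⟨P, hP⟩, ⟨_, _, (hcard (PairFun.exp 1) le_rfl).choose_spec⟩⟩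
  | add _ _ ihB ihC =>
    obtain ⟨⟨P, hP⟩, P', p, hP', hp⟩ := ihB
    obtain ⟨⟨Q, hQ⟩, Q', q, hQ', hq⟩ := ihC
    refine ⟨hP.exists_add hQ, ?_⟩
    rw [PairFun.exp_add]
    obtain ⟨R, hR⟩ := hP'.exists_mul hQ' hp hq
    exact ⟨R, _, hR⟩
  | exp _ ih =>
    obtain ⟨⟨P, hP⟩, P', p, hP', hp⟩ := ih
    exact ⟨⟨P', hP'⟩, hP.exists_E⟩

theorem IsArith.exists_hasSignature {A : PairFun} (h : IsArith A) :
    ∃ a : Fin A.card → MarkedFun, HasSignature A a := by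
  obtain ⟨⟨P, hP⟩, -⟩ := h.exists_describes
  obtain ⟨a, ha, -⟩ := hP.exists_hasSignature
  exact ⟨a, ha⟩

theorem IsArith.exists_gap_exp {A : PairFun} (h : IsArith A) :
    ∃ (c : Fin A.exp.card → MarkedFun) (p q : I), HasSignature A.exp c ∧ IsGap c p q := by
  obtain ⟨-, P, h, hP, hh⟩ := h.exists_describes
  obtain ⟨c, hc, hgap⟩ := hP.exists_hasSignature
  exact ⟨c, _, _, hc, hgap h hh⟩

end OscSig

end

/-! ### Assembly of the theorem -/

theorem mainTheorem9 :
    -- reduced signatures are signatures of standard generating sets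
    (∀ A : OscSig.PairFun, OscSig.Reduced A →
      ∃ a : Fin A.card → OscSig.MarkedFun, OscSig.HasSignature A a) ∧
    -- exactly one of the three forms occurs
    (∀ A : OscSig.PairFun, OscSig.Reduced A →
      (OscSig.IsEForm A ∨ OscSig.IsSumForm A ∨ OscSig.IsProdForm A) ∧
      ¬ (OscSig.IsEForm A ∧ OscSig.IsSumForm A) ∧
      ¬ (OscSig.IsEForm A ∧ OscSig.IsProdForm A) ∧
      ¬ (OscSig.IsSumForm A ∧ OscSig.IsProdForm A)) ∧
    -- the group of a sum is the direct sum of the groups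
    (∀ B C : OscSig.PairFun, OscSig.Reduced B → OscSig.Reduced C → B ≠ 0 → C ≠ 0 →
      OscSig.Reduced (B + C) →
      ∀ (a : Fin (B.card + C.card) → OscSig.MarkedFun) (b : Fin B.card → OscSig.MarkedFun)
        (c : Fin C.card → OscSig.MarkedFun),
        OscSig.HasSignature (B + C) a → OscSig.HasSignature B b → OscSig.HasSignature C c →
        ∃ φ : OscSig.grp a ≃* OscSig.grp b × OscSig.grp c,
          (∀ i, φ (OscSig.gen a (Fin.castAdd C.card i)) = (OscSig.gen b i, 1)) ∧
          (∀ j, φ (OscSig.gen a (Fin.natAdd B.card j)) = (1, OscSig.gen c j))) ∧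
    -- the group of a product is the permutation wreath product of the groups
    (∀ B C : OscSig.PairFun, OscSig.Reduced B → OscSig.Reduced C → B ≠ 0 → C ≠ 0 →
      OscSig.Reduced (B * C) →
      (∃ (c : Fin C.card → OscSig.MarkedFun) (p q : unitInterval),
        OscSig.HasSignature C c ∧ OscSig.IsGap c p q) ∧
      ∀ (a : Fin (B.card + C.card) → OscSig.MarkedFun) (b : Fin B.card → OscSig.MarkedFun)
        (c : Fin C.card → OscSig.MarkedFun) (p q : unitInterval),
        OscSig.HasSignature (B * C) a → OscSig.HasSignature B b → OscSig.HasSignature C c →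
        OscSig.IsGap c p q →
        ∃ φ : OscSig.grp a ≃* OscSig.PermWreath (OscSig.grp b) (OscSig.grp c)
            (OscSig.translates c p q),
          (∀ i, φ (OscSig.gen a (Fin.castAdd C.card i)) =
            SemidirectProduct.inl (OscSig.single (OscSig.base c p q) (OscSig.gen b i))) ∧
          (∀ j, φ (OscSig.gen a (Fin.natAdd B.card j)) =
            SemidirectProduct.inr (OscSig.gen c j))) ∧
    -- unique term expression
    (∀ A : OscSig.PairFun, OscSig.Reduced A → A ≠ 0 →
      (∃ t : OscSig.Term, t.NoEOne ∧ t.eval = A) ∧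
      ∀ s t : OscSig.Term, s.NoEOne → t.NoEOne → s.eval = A → t.eval = A →
        OscSig.Term.AssocEq s t) := by
  refine ⟨fun A hA => ?_, fun A hA => ⟨hA.form, OscSig.forms_exclusive A⟩, ?_, ?_, fun A hA hA0 => ?_⟩
  · exact (OscSig.IsArith.of_reduced hA).exists_hasSignature
  · intro B C _ _ _ _ _ a b c ha hb hc
    exact ha.exists_mulEquiv_add hb hc
  · intro B C _ hC hB0 hC0 hBC
    refine ⟨?_, fun a b c p q ha hb hc hJ => ha.exists_mulEquiv_mul hb hc hB0 hJ⟩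
    -- The right factor of a reduced product is an exponential, which is the kind of signature for
    -- which gaps have been constructed.
    obtain ⟨X, hX, rfl⟩ := OscSig.exists_exp_of_reduced_mul hC hB0 hC0 hBC
    exact (OscSig.IsArith.of_reduced hX).exists_gap_exp
  · exact ⟨(OscSig.IsArith.of_reduced hA).exists_term.1.resolve_left hA0, fun s t hs ht h h' =>
      OscSig.Term.assocEq_of_eval_eq _ s t le_rfl hs ht (h.trans h'.symm)⟩
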